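/- Let $0<q<1$ and let $\mathcal{A}=\mathcal{O}(SU_q(2))$ be the unital $*$-algebra generated by $\mathsf{a},\mathsf{b},\mathsf{c},\mathsf{d}$ with relations $$\mathsf{ab}=q\,\mathsf{ba},\quad \mathsf{ac}=q\,\mathsf{ca},\quad \mathsf{bd}=q\,\mathsf{db},\quad \mathsf{cd}=q\,\mathsf{dc},\quad \mathsf{bc}=\mathsf{cb},\quad \mathsf{ad}=1+q\,\mathsf{cb},\quad \mathsf{da}=1+q^{-1}\mathsf{bc},$$ involution $\mathsf{a}^*=\mathsf{d}$, $\mathsf{b}^*=-q\mathsf{c}$, $\mathsf{c}^*=-q^{-1}\mathsf{b}$, $\mathsf{d}^*=\mathsf{a}$, and the coproduct $\Delta$ for which $\begin{pmatrix}\mathsf{a}&\mathsf{b}\\ \mathsf{c}&\mathsf{d}\end{pmatrix}$ is a matrix corepresentation. There is exactly one bi-invariant state $h$ on $\mathcal{A}$, the Haar state: $h(1)=1$, $h(x^*x)\ge 0$ and $(\mathrm{id}\otimes h)\Delta(x)=h(x)1=(h\otimes\mathrm{id})\Delta(x)$ for all $x\in\mathcal{A}$. Let $\mathcal{H}_h$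 be its GNS space, the completion of $\mathcal{A}$ for $(x,y)=h(x^*y)$, and let $\mathcal{A}$ act on $\mathcal{H}=\mathcal{H}_h\oplus\mathcal{H}_h$ diagonally by left multiplication. Let $k,k^{-1},e,f$ be the generators of $U_q(\mathfrak{su}(2))$, with $\Delta(k)=k\otimes k$, $\Delta(e)=e\otimes k+k^{-1}\otimes e$, $\Delta(f)=f\otimes k+k^{-1}\otimes f$, paired with $\mathcal{A}$ by $\langle k,\mathsf{a}\rangle=q^{-1/2}$, $\langle k,\mathsf{d}\rangle=q^{1/2}$, $\langle e,\mathsf{c}\rangle=\langle f,\mathsf{b}\rangle=1$ and zero on the other pairs of one of $k,e,f$ and one of $\mathsf{a},\mathsf{b},\mathsf{c},\mathsf{d}$. Write $g\triangleright x=x_{(1)}\langle g,x_{(2)}\rangle$, $x\triangleleft g=\langle g,x_{(1)}\rangle x_{(2)}$ and $\partial_g=g\,\triangleright$. Let $\Delta_L$ and $\Delta_R$ be the positive operators on $\mathcal{H}_h$ given on $\mathcal{A}$ by $\Delta_L x=k^2\triangleright x$ and $\Delta_R x=x\triangleleft k^2$, acting diagonally on $\mathcal{H}$, and let $$D_q=\begin{pmatrix}(q^{-1}-q)^{-1}(q\,\partial_{k^{-2}}-1)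 & q^{-1/2}\,\partial_e\partial_{k^{-1}}\\ q^{1/2}\,\partial_f\partial_{k^{-1}} & (q^{-1}-q)^{-1}(1-q^{-1}\partial_{k^{-2}})\end{pmatrix}$$ on $\mathcal{H}$. Let $a>1$ be real. For $x\in\mathcal{A}$ put $\zeta_x(z)=\mathrm{Tr}(\Delta_L^{-a}\Delta_R\,x\,|D_q|^{-z})$. Then: 1. the spectral dimension $n=\inf\{s>0:\zeta_1(s)<\infty\}$ equals $a+1$; 2. for every $x\in\mathcal{A}$ the operator $\Delta_L^{-a}\Delta_R\,x\,|D_q|^{-z}$ is trace class for $\mathrm{Re}(z)>a+1$, and $\zeta_x$ extends meromorphically to a neighbourhood of $a+1$ with at most a simple pole at $a+1$, so that $\varphi(x)=\operatorname{res}_{z=a+1}\zeta_x(z)$ is defined; 3. $\varphi(1)\neq 0$, and $\varphi(x)/\varphi(1)=h(x)$ for every $x\in\mathcal{A}$. In particular the normalized non-commutative integral does not depend on $a$. -/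

import Mathlib

open scoped InnerProductSpace TensorProduct Topology ComplexOrder

noncomputable section

/-! ### The coordinate algebra of quantum `SU(2)` -/

/-- The four generators of the coordinate algebra. -/
inductive SUq2Gen
  | a | b | c | d

/-- The defining relations of `O(SU_q(2))` for four elements of a complex algebra. -/
structure SUq2Rel (q : ℝ) {R : Type*} [Ring R] [Algebra ℂ R] (a b c d : R) : Prop where
  ab : a * b = (q : ℂ) • (b * a)
  ac : a * c = (q : ℂ) • (c * a)
  bd : b * d = (q : ℂ) • (d * b)
  cd : c * d = (q : ℂ) • (d * c)
  bc : b * c = c * b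
  ad : a * d = 1 + (q : ℂ) • (c * b)
  da : d * a = 1 + (q : ℂ)⁻¹ • (b * c)

/-- The relations on the free algebra. -/
inductive SUq2FreeRel (q : ℝ) : FreeAlgebra ℂ SUq2Gen → FreeAlgebra ℂ SUq2Gen → Prop
  | ab : SUq2FreeRel q (FreeAlgebra.ι ℂ .a * FreeAlgebra.ι ℂ .b)
      (algebraMap ℂ _ (q : ℂ) * (FreeAlgebra.ι ℂ .b * FreeAlgebra.ι ℂ .a))
  | ac : SUq2FreeRel q (FreeAlgebra.ι ℂ .a * FreeAlgebra.ι ℂ .c)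
      (algebraMap ℂ _ (q : ℂ) * (FreeAlgebra.ι ℂ .c * FreeAlgebra.ι ℂ .a))
  | bd : SUq2FreeRel q (FreeAlgebra.ι ℂ .b * FreeAlgebra.ι ℂ .d)
      (algebraMap ℂ _ (q : ℂ) * (FreeAlgebra.ι ℂ .d * FreeAlgebra.ι ℂ .b))
  | cd : SUq2FreeRel q (FreeAlgebra.ι ℂ .c * FreeAlgebra.ι ℂ .d)
      (algebraMap ℂ _ (q : ℂ) * (FreeAlgebra.ι ℂ .d * FreeAlgebra.ι ℂ .c))
  | bc : SUq2FreeRel q (FreeAlgebra.ι ℂ .b * FreeAlgebra.ι ℂ .c)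
      (FreeAlgebra.ι ℂ .c * FreeAlgebra.ι ℂ .b)
  | ad : SUq2FreeRel q (FreeAlgebra.ι ℂ .a * FreeAlgebra.ι ℂ .d)
      (1 + algebraMap ℂ _ (q : ℂ) * (FreeAlgebra.ι ℂ .c * FreeAlgebra.ι ℂ .b))
  | da : SUq2FreeRel q (FreeAlgebra.ι ℂ .d * FreeAlgebra.ι ℂ .a)
      (1 + algebraMap ℂ _ (q : ℂ)⁻¹ * (FreeAlgebra.ι ℂ .b * FreeAlgebra.ι ℂ .c))

/-- The coordinate algebra `O(SU_q(2))`, `0 < q < 1`, by generators and relations. -/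
def SUq2 (q : Set.Ioo (0 : ℝ) 1) : Type := RingQuot (SUq2FreeRel q)

namespace SUq2

variable {q : Set.Ioo (0 : ℝ) 1}

instance : Ring (SUq2 q) := inferInstanceAs (Ring (RingQuot (SUq2FreeRel q)))
instance : Algebra ℂ (SUq2 q) := inferInstanceAs (Algebra ℂ (RingQuot (SUq2FreeRel q)))

/-- The quotient map from the free algebra. -/
def mk (q : Set.Ioo (0 : ℝ) 1) : FreeAlgebra ℂ SUq2Gen →ₐ[ℂ] SUq2 q :=
  RingQuot.mkAlgHom ℂ (SUq2FreeRel q)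

lemma mk_rel {x y : FreeAlgebra ℂ SUq2Gen} (h : SUq2FreeRel q x y) : mk q x = mk q y :=
  RingQuot.mkAlgHom_rel ℂ h

/-- The generators as elements of `O(SU_q(2))`. -/
def gen (q : Set.Ioo (0 : ℝ) 1) (s : SUq2Gen) : SUq2 q := mk q (FreeAlgebra.ι ℂ s)

lemma gen_rel (q : Set.Ioo (0 : ℝ) 1) :
    SUq2Rel q (gen q .a) (gen q .b) (gen q .c) (gen q .d) := by
  constructor
  · have h := mk_rel (SUq2FreeRel.ab (q := q))
    simpa only [gen, map_mul, map_add, map_one, AlgHom.commutes, ← Algebra.smul_def (A := SUq2 q)] using h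
  · have h := mk_rel (SUq2FreeRel.ac (q := q))
    simpa only [gen, map_mul, map_add, map_one, AlgHom.commutes, ← Algebra.smul_def (A := SUq2 q)] using h
  · have h := mk_rel (SUq2FreeRel.bd (q := q))
    simpa only [gen, map_mul, map_add, map_one, AlgHom.commutes, ← Algebra.smul_def (A := SUq2 q)] using h
  · have h := mk_rel (SUq2FreeRel.cd (q := q))
    simpa only [gen, map_mul, map_add, map_one, AlgHom.commutes, ← Algebra.smul_def (A := SUq2 q)] using h
  · have h := mk_rel (SUq2FreeRel.bc (q := q))
    simpa only [gen, map_mul, map_add, map_one, AlgHom.commutes, ← Algebra.smul_def (A := SUq2 q)] using h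
  · have h := mk_rel (SUq2FreeRel.ad (q := q))
    simpa only [gen, map_mul, map_add, map_one, AlgHom.commutes, ← Algebra.smul_def (A := SUq2 q)] using h
  · have h := mk_rel (SUq2FreeRel.da (q := q))
    simpa only [gen, map_mul, map_add, map_one, AlgHom.commutes, ← Algebra.smul_def (A := SUq2 q)] using h

/-- The universal property: four elements satisfying the relations define an algebra map. -/
def lift {R : Type*} [Ring R] [Algebra ℂ R] (v : SUq2Gen → R)
    (hv : SUq2Rel q (v .a) (v .b) (v .c) (v .d)) : SUq2 q →ₐ[ℂ] R :=
  RingQuot.liftAlgHom ℂ ⟨FreeAlgebra.lift ℂ v, by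
    intro x y hxy
    cases hxy
    · simpa [Algebra.smul_def] using hv.ab
    · simpa [Algebra.smul_def] using hv.ac
    · simpa [Algebra.smul_def] using hv.bd
    · simpa [Algebra.smul_def] using hv.cd
    · simpa [Algebra.smul_def] using hv.bc
    · simpa [Algebra.smul_def] using hv.ad
    · simpa [Algebra.smul_def] using hv.da⟩

@[simp] lemma lift_gen {R : Type*} [Ring R] [Algebra ℂ R] (v : SUq2Gen → R)
    (hv : SUq2Rel q (v .a) (v .b) (v .c) (v .d)) (s : SUq2Gen) :
    lift v hv (gen q s) = v s := by
  refine Eq.trans (RingQuot.liftAlgHom_mkAlgHom_apply ℂ _ _ _) ?_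
  simp

lemma algHom_ext {R : Type*} [Ring R] [Algebra ℂ R] {f g : SUq2 q →ₐ[ℂ] R}
    (H : ∀ s, f (gen q s) = g (gen q s)) : f = g := by
  refine RingQuot.ringQuot_ext' ℂ f g (FreeAlgebra.hom_ext (funext fun s => ?_))
  exact H s

lemma q_ne_zero (q : Set.Ioo (0 : ℝ) 1) : ((q : ℝ) : ℂ) ≠ 0 := by
  exact_mod_cast q.2.1.ne'

lemma sqrt_ne_zero (q : Set.Ioo (0 : ℝ) 1) : ((Real.sqrt q : ℝ) : ℂ) ≠ 0 := by
  exact_mod_cast (Real.sqrt_pos.mpr q.2.1).ne'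

lemma sqrt_mul_self (q : Set.Ioo (0 : ℝ) 1) :
    ((Real.sqrt q : ℝ) : ℂ) * ((Real.sqrt q : ℝ) : ℂ) = ((q : ℝ) : ℂ) := by
  exact_mod_cast Real.mul_self_sqrt q.2.1.le

/-! ### The involution -/

/-- The opposite algebra with conjugated scalars; the involution is an algebra map into it. -/
def ConjOp (q : Set.Ioo (0 : ℝ) 1) : Type := (SUq2 q)ᵐᵒᵖ

instance : Ring (ConjOp q) := inferInstanceAs (Ring (SUq2 q)ᵐᵒᵖ)

instance : Algebra ℂ (ConjOp q) :=
  ((algebraMap ℂ (SUq2 q)ᵐᵒᵖ).comp (starRingEnd ℂ)).toAlgebra'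
    fun r x => Algebra.commutes (A := (SUq2 q)ᵐᵒᵖ) (starRingEnd ℂ r) x

/-- The identity map `O(SU_q(2)) → ConjOp q`, an additive isomorphism. -/
def toConjOp : SUq2 q ≃+ ConjOp q := MulOpposite.opAddEquiv

lemma toConjOp_mul (x y : SUq2 q) : toConjOp (x * y) = toConjOp y * toConjOp x := rfl

lemma toConjOp_one : toConjOp (1 : SUq2 q) = 1 := rfl

lemma smul_toConjOp (r : ℂ) (x : SUq2 q) :
    r • toConjOp x = toConjOp ((starRingEnd ℂ r) • x) := by
  rw [Algebra.smul_def, Algebra.smul_def, Algebra.commutes]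
  rfl

/-- The values of the involution on the generators:
`a* = d`, `b* = -q c`, `c* = -q⁻¹ b`, `d* = a`. -/
def starGen (q : Set.Ioo (0 : ℝ) 1) : SUq2Gen → SUq2 q
  | .a => gen q .d
  | .b => -((q : ℝ) : ℂ) • gen q .c
  | .c => -((q : ℝ) : ℂ)⁻¹ • gen q .b
  | .d => gen q .a

/-- The involution, as an algebra map to the opposite algebra with conjugated scalars. -/
def starHom (q : Set.Ioo (0 : ℝ) 1) : SUq2 q →ₐ[ℂ] ConjOp q :=
  lift (fun s => toConjOp (starGen q s)) (by
    have H := gen_rel q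
    have hq := q_ne_zero q
    constructor <;>
      simp only [← toConjOp_mul, ← toConjOp_one, smul_toConjOp, ← map_add, starGen,
        EmbeddingLike.apply_eq_iff_eq, map_inv₀, Complex.conj_ofReal, smul_mul_assoc,
        mul_smul_comm, smul_smul, H.cd, H.bd, H.ab, H.ac, H.ad, H.da, H.bc] <;>
      field_simp)

instance : Star (SUq2 q) := ⟨fun x => toConjOp.symm (starHom q x)⟩

lemma star_def (x : SUq2 q) : star x = toConjOp.symm (starHom q x) := rfl

lemma star_gen (s : SUq2Gen) : star (gen q s) = starGen q s := by
  simp [star_def, starHom]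

lemma star_smul' (r : ℂ) (x : SUq2 q) : star (r • x) = (starRingEnd ℂ r) • star x := by
  rw [star_def, star_def, map_smul, AddEquiv.symm_apply_eq, ← smul_toConjOp,
    AddEquiv.apply_symm_apply]

lemma star_mul' (x y : SUq2 q) : star (x * y) = star y * star x := by
  rw [star_def, star_def, star_def, map_mul, AddEquiv.symm_apply_eq, toConjOp_mul,
    AddEquiv.apply_symm_apply, AddEquiv.apply_symm_apply]

lemma star_add' (x y : SUq2 q) : star (x + y) = star x + star y := by
  simp [star_def]

lemma star_one' : star (1 : SUq2 q) = 1 := by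
  rw [star_def, map_one, AddEquiv.symm_apply_eq, toConjOp_one]

/-- The square of the involution is an algebra map, hence the identity. -/
def starStar (q : Set.Ioo (0 : ℝ) 1) : SUq2 q →ₐ[ℂ] SUq2 q :=
  AlgHom.ofLinearMap
    { toFun := fun x => star (star x)
      map_add' := fun x y => by rw [star_add', star_add']
      map_smul' := fun r x => by rw [star_smul', star_smul']; simp }
    (by change star (star (1 : SUq2 q)) = 1; rw [star_one', star_one'])
    (fun x y => by
      change star (star (x * y)) = star (star x) * star (star y)
      rw [star_mul', star_mul'])

instance : StarRing (SUq2 q) where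
  star_involutive x := by
    have hq := q_ne_zero q
    have key : starStar q = AlgHom.id ℂ (SUq2 q) := by
      refine algHom_ext fun s => ?_
      change star (star (gen q s)) = gen q s
      rw [star_gen]
      cases s <;> simp only [starGen, star_gen, star_smul', smul_smul]
      all_goals simp [hq]
    exact DFunLike.congr_fun key x
  star_mul := star_mul'
  star_add := star_add'

instance : StarModule ℂ (SUq2 q) := ⟨star_smul'⟩

/-! ### The coproduct and the actions of `k`, `e`, `f` -/

/-- The values of the coproduct on the generators. -/
def comulGen (q : Set.Ioo (0 : ℝ) 1) : SUq2Gen → SUq2 q ⊗[ℂ] SUq2 q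
  | .a => gen q .a ⊗ₜ gen q .a + gen q .b ⊗ₜ gen q .c
  | .b => gen q .a ⊗ₜ gen q .b + gen q .b ⊗ₜ gen q .d
  | .c => gen q .c ⊗ₜ gen q .a + gen q .d ⊗ₜ gen q .c
  | .d => gen q .c ⊗ₜ gen q .b + gen q .d ⊗ₜ gen q .d


/-- The coproduct: an algebra map with `Δ(t_ij) = ∑ₖ t_ik ⊗ t_kj` on the generators
`t = [[a, b], [c, d]]`. -/
def comul (q : Set.Ioo (0 : ℝ) 1) : SUq2 q →ₐ[ℂ] SUq2 q ⊗[ℂ] SUq2 q :=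
  lift (comulGen q) (by
    have H := gen_rel q
    have hq := q_ne_zero q
    constructor <;>
      simp only [comulGen, add_mul, mul_add, Algebra.TensorProduct.tmul_mul_tmul,
        H.ab, H.ac, H.bd, H.cd, H.bc, H.ad, H.da, Algebra.TensorProduct.one_def,
        TensorProduct.tmul_add, TensorProduct.add_tmul, TensorProduct.tmul_smul,
        ← TensorProduct.smul_tmul', smul_add, smul_smul]
    all_goals
      try simp only [mul_inv_cancel₀ hq, inv_mul_cancel₀ hq, one_smul]
      abel)

/-- The functional `x ↦ ⟨kⁿ, x⟩`, `n ∈ ℤ`: the character with `a ↦ q^{-n/2}`, `d ↦ q^{n/2}`,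
`b, c ↦ 0`. -/
def pairK (q : Set.Ioo (0 : ℝ) 1) (n : ℤ) : SUq2 q →ₐ[ℂ] ℂ :=
  lift (fun
    | .a => ((Real.sqrt q : ℝ) : ℂ) ^ (-n)
    | .b => 0
    | .c => 0
    | .d => ((Real.sqrt q : ℝ) : ℂ) ^ n) (by
    have hs := sqrt_ne_zero q
    constructor <;> simp [zpow_ne_zero n hs])

/-- The algebra map `x ↦ [[⟨k⁻¹, x⟩, ⟨e, x⟩], [0, ⟨k, x⟩]]`. It encodes the rule
`⟨e, xy⟩ = ⟨e, x⟩⟨k, y⟩ + ⟨k⁻¹, x⟩⟨e, y⟩`, dual to `Δ(e) = e ⊗ k + k⁻¹ ⊗ e`, and the values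
`⟨e, c⟩ = 1`, `⟨e, a⟩ = ⟨e, b⟩ = ⟨e, d⟩ = 0`. -/
def pairEMatrix (q : Set.Ioo (0 : ℝ) 1) : SUq2 q →ₐ[ℂ] Matrix (Fin 2) (Fin 2) ℂ :=
  lift (fun
    | .a => !![((Real.sqrt q : ℝ) : ℂ), 0; 0, ((Real.sqrt q : ℝ) : ℂ)⁻¹]
    | .b => 0
    | .c => !![0, 1; 0, 0]
    | .d => !![((Real.sqrt q : ℝ) : ℂ)⁻¹, 0; 0, ((Real.sqrt q : ℝ) : ℂ)]) (by
    have hs := sqrt_ne_zero q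
    have h2 := sqrt_mul_self q
    constructor <;> ext i j <;> fin_cases i <;> fin_cases j <;>
      simp [hs, Matrix.mul_apply, Fin.sum_univ_two] <;> rw [← h2] <;> field_simp)

/-- The algebra map `x ↦ [[⟨k⁻¹, x⟩, ⟨f, x⟩], [0, ⟨k, x⟩]]`. It encodes the rule
`⟨f, xy⟩ = ⟨f, x⟩⟨k, y⟩ + ⟨k⁻¹, x⟩⟨f, y⟩`, dual to `Δ(f) = f ⊗ k + k⁻¹ ⊗ f`, and the values
`⟨f, b⟩ = 1`, `⟨f, a⟩ = ⟨f, c⟩ = ⟨f, d⟩ = 0`. -/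
def pairFMatrix (q : Set.Ioo (0 : ℝ) 1) : SUq2 q →ₐ[ℂ] Matrix (Fin 2) (Fin 2) ℂ :=
  lift (fun
    | .a => !![((Real.sqrt q : ℝ) : ℂ), 0; 0, ((Real.sqrt q : ℝ) : ℂ)⁻¹]
    | .b => !![0, 1; 0, 0]
    | .c => 0
    | .d => !![((Real.sqrt q : ℝ) : ℂ)⁻¹, 0; 0, ((Real.sqrt q : ℝ) : ℂ)]) (by
    have hs := sqrt_ne_zero q
    have h2 := sqrt_mul_self q
    constructor <;> ext i j <;> fin_cases i <;> fin_cases j <;>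
      simp [hs, Matrix.mul_apply, Fin.sum_univ_two] <;> rw [← h2] <;> field_simp)

/-- The functional `x ↦ ⟨e, x⟩`. -/
def pairE (q : Set.Ioo (0 : ℝ) 1) : SUq2 q →ₗ[ℂ] ℂ :=
  Matrix.entryLinearMap ℂ ℂ 0 1 ∘ₗ (pairEMatrix q).toLinearMap

/-- The functional `x ↦ ⟨f, x⟩`. -/
def pairF (q : Set.Ioo (0 : ℝ) 1) : SUq2 q →ₗ[ℂ] ℂ :=
  Matrix.entryLinearMap ℂ ℂ 0 1 ∘ₗ (pairFMatrix q).toLinearMap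

/-- The map `x ↦ x₍₁₎ u(x₍₂₎)` for a functional `u`; for `u = ⟨g, ·⟩` it is `g ▷ x`. -/
def leftAct (u : SUq2 q →ₗ[ℂ] ℂ) : SUq2 q →ₗ[ℂ] SUq2 q :=
  (TensorProduct.rid ℂ (SUq2 q)).toLinearMap ∘ₗ LinearMap.lTensor (SUq2 q) u ∘ₗ
    (comul q).toLinearMap

/-- The map `x ↦ u(x₍₁₎) x₍₂₎` for a functional `u`; for `u = ⟨g, ·⟩` it is `x ◁ g`. -/
def rightAct (u : SUq2 q →ₗ[ℂ] ℂ) : SUq2 q →ₗ[ℂ] SUq2 q :=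
  (TensorProduct.lid ℂ (SUq2 q)).toLinearMap ∘ₗ LinearMap.rTensor (SUq2 q) u ∘ₗ
    (comul q).toLinearMap

/-- `∂_{kⁿ} = kⁿ ▷`. -/
def dK (q : Set.Ioo (0 : ℝ) 1) (n : ℤ) : SUq2 q →ₗ[ℂ] SUq2 q :=
  leftAct (pairK q n).toLinearMap

/-- `∂_e = e ▷`. -/
def dE (q : Set.Ioo (0 : ℝ) 1) : SUq2 q →ₗ[ℂ] SUq2 q := leftAct (pairE q)

/-- `∂_f = f ▷`. -/
def dF (q : Set.Ioo (0 : ℝ) 1) : SUq2 q →ₗ[ℂ] SUq2 q := leftAct (pairF q)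

/-- The left modular operator on the core: `Δ_L = k² ▷`, so that `Δ_L(t_ij) = q^{2j} t_ij`. -/
def modL (q : Set.Ioo (0 : ℝ) 1) : SUq2 q →ₗ[ℂ] SUq2 q := dK q 2

/-- The right modular operator on the core: `Δ_R = ◁ k²`, so that `Δ_R(t_ij) = q^{2i} t_ij`. -/
def modR (q : Set.Ioo (0 : ℝ) 1) : SUq2 q →ₗ[ℂ] SUq2 q := rightAct (pairK q 2).toLinearMap

/-- The Dirac operator `D_q` on its core `O(SU_q(2)) ⊕ O(SU_q(2))`. -/
def dirac (q : Set.Ioo (0 : ℝ) 1) : SUq2 q × SUq2 q →ₗ[ℂ] SUq2 q × SUq2 q :=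
  let p : ℂ := ((q : ℝ) : ℂ)
  let r : ℂ := ((Real.sqrt q : ℝ) : ℂ)
  ((LinearMap.coprod
      ((p⁻¹ - p)⁻¹ • (p • dK q (-2) - LinearMap.id))
      (r⁻¹ • (dE q ∘ₗ dK q (-1))))).prod
    (LinearMap.coprod
      (r • (dF q ∘ₗ dK q (-1)))
      ((p⁻¹ - p)⁻¹ • (LinearMap.id - p⁻¹ • dK q (-2))))

end SUq2

/-! ### Functions of diagonalizable operators -/

/-- `S` is the function `f` of the operator `T`: it acts on each eigenvector of `T` as the scalar
`f μ`, `μ` the eigenvalue. If the eigenvectors of `T` span, there is exactly one such `S`. -/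
def IsDiagFun {V : Type*} [AddCommGroup V] [Module ℂ V] (T : V →ₗ[ℂ] V) (f : ℂ → ℂ)
    (S : V →ₗ[ℂ] V) : Prop :=
  ∀ (μ : ℂ) (v : V), T v = μ • v → S v = f μ • v

/-- The operator `f(T)` for an operator `T` whose eigenvectors span the space. -/
def diagFun {V : Type*} [AddCommGroup V] [Module ℂ V] (T : V →ₗ[ℂ] V) (f : ℂ → ℂ) :
    V →ₗ[ℂ] V :=
  Classical.epsilon (IsDiagFun T f)

/-- If the eigenvectors of `T` span, then `f(T)` is the only operator with the defining
property. -/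
lemma diagFun_eq {V : Type*} [AddCommGroup V] [Module ℂ V] (T : V →ₗ[ℂ] V) (f : ℂ → ℂ)
    (hT : Submodule.span ℂ {v : V | ∃ μ : ℂ, T v = μ • v} = ⊤) (S : V →ₗ[ℂ] V)
    (hS : IsDiagFun T f S) : diagFun T f = S := by
  have h : IsDiagFun T f (diagFun T f) := Classical.epsilon_spec ⟨S, hS⟩
  refine LinearMap.ext_on hT ?_
  rintro v ⟨μ, hv⟩
  rw [h μ v hv, hS μ v hv]

/-! ### Trace class operators -/

/-- A bounded operator on a Hilbert space is trace class if it is a sum of rank one operators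
`x ↦ ⟪u n, x⟫ • v n` with `∑ ‖u n‖ ‖v n‖ < ∞`. -/
def IsTraceClass {H : Type*} [NormedAddCommGroup H] [InnerProductSpace ℂ H]
    (T : H →L[ℂ] H) : Prop :=
  ∃ u v : ℕ → H, Summable (fun n => ‖u n‖ * ‖v n‖) ∧
    ∀ x, HasSum (fun n => ⟪u n, x⟫_ℂ • v n) (T x)

/-- The trace `∑ ⟪ξ, T ξ⟫` over the vectors `ξ` of an orthonormal basis; for a trace class operator
it does not depend on the basis. -/
def opTrace {H : Type*} [NormedAddCommGroup H] [InnerProductSpace ℂ H] [CompleteSpace H]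
    (T : H →L[ℂ] H) : ℂ :=
  ∑' ξ : (exists_hilbertBasis ℂ H).choose, ⟪(ξ : H), T ξ⟫_ℂ

/-- `T` is a trace class operator of the Hilbert space `H` that extends the operator `A` given on a
core `V`, mapped to `H` by `ι`. -/
def IsTraceClassExt {V H : Type*} [AddCommGroup V] [Module ℂ V] [NormedAddCommGroup H]
    [InnerProductSpace ℂ H] (ι : V →ₗ[ℂ] H) (A : V →ₗ[ℂ] V) (T : H →L[ℂ] H) : Prop :=
  IsTraceClass T ∧ ∀ v, T (ι v) = ι (A v)

open Classical in
/-- The trace of the trace class extension of an operator on a (dense) core. -/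
def coreTrace {V H : Type*} [AddCommGroup V] [Module ℂ V] [NormedAddCommGroup H]
    [InnerProductSpace ℂ H] [CompleteSpace H] (ι : V →ₗ[ℂ] H) (A : V →ₗ[ℂ] V) : ℂ :=
  if h : ∃ T : H →L[ℂ] H, IsTraceClassExt ι A T then opTrace h.choose else 0

/-! ### Residues -/

/-- `f`, given on the half plane `Re z > n`, extends meromorphically to a neighbourhood of `n` with
at most a simple pole at `n`, with residue `r`. -/
def HasResidue (f : ℂ → ℂ) (n : ℝ) (r : ℂ) : Prop :=
  ∃ F : ℂ → ℂ, MeromorphicAt F n ∧ (∀ᶠ z in 𝓝 (n : ℂ), n < z.re → F z = f z) ∧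
    Filter.Tendsto (fun z : ℂ => (z - n) * F z) (𝓝[≠] (n : ℂ)) (𝓝 r)

open Classical in
/-- The residue at `n` of the extension of `f`. -/
def residueAt (f : ℂ → ℂ) (n : ℝ) : ℂ := if h : ∃ r, HasResidue f n r then h.choose else 0

/-! ### The Haar state and its GNS space -/

/-- The Haar state: the bi-invariant state on `O(SU_q(2))`. -/
structure IsHaarState (q : Set.Ioo (0 : ℝ) 1) (h : SUq2 q →ₗ[ℂ] ℂ) : Prop where
  map_one : h 1 = 1
  nonneg : ∀ x, 0 ≤ h (star x * x)
  /-- `(id ⊗ h) Δ(x) = h(x) 1` -/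
  left_inv : ∀ x, SUq2.leftAct h x = h x • (1 : SUq2 q)
  /-- `(h ⊗ id) Δ(x) = h(x) 1` -/
  right_inv : ∀ x, SUq2.rightAct h x = h x • (1 : SUq2 q)

namespace IsHaarState

variable {q : Set.Ioo (0 : ℝ) 1} {h : SUq2 q →ₗ[ℂ] ℂ}

lemma conj_symm (hh : IsHaarState q h) (x y : SUq2 q) :
    (starRingEnd ℂ) (h (star y * x)) = h (star x * y) := by
  have key : ∀ c : ℂ, (c * h (star x * y) + (starRingEnd ℂ) c * h (star y * x)).im = 0 := by
    intro c
    have h1 := (Complex.nonneg_iff.mp (hh.nonneg (x + c • y))).2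
    have h2 := (Complex.nonneg_iff.mp (hh.nonneg x)).2
    have h3 := (Complex.nonneg_iff.mp (hh.nonneg y)).2
    simp [add_mul, mul_add, star_add, star_smul] at h1 h2 h3 ⊢
    rw [← h2, ← h3] at h1
    linarith
  have k1 := key 1
  have k2 := key Complex.I
  simp at k1 k2
  apply Complex.ext
  · simp; linarith
  · simp; linarith

set_option linter.unusedVariables false in
/-- `O(SU_q(2))` with the inner product `(x, y) = h(x* y)`. -/
def PreGNS (hh : IsHaarState q h) : Type := SUq2 q

variable (hh : IsHaarState q h)

instance : AddCommGroup hh.PreGNS := inferInstanceAs (AddCommGroup (SUq2 q))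
instance : Module ℂ hh.PreGNS := inferInstanceAs (Module ℂ (SUq2 q))

/-- The identity map onto the pre-Hilbert space. -/
def toPreGNS : SUq2 q ≃ₗ[ℂ] hh.PreGNS := LinearEquiv.refl ℂ _

/-- The inner product `(x, y) = h(x* y)`. -/
abbrev preGNSCore : PreInnerProductSpace.Core ℂ hh.PreGNS where
  inner x y := h (star (hh.toPreGNS.symm x) * hh.toPreGNS.symm y)
  conj_inner_symm x y := hh.conj_symm _ _
  re_inner_nonneg x := (Complex.nonneg_iff.mp (hh.nonneg (hh.toPreGNS.symm x))).1
  add_left x y z := by rw [map_add, star_add, add_mul, map_add]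
  smul_left x y r := by rw [map_smul, star_smul, smul_mul_assoc, map_smul]; rfl

instance : SeminormedAddCommGroup hh.PreGNS :=
  InnerProductSpace.Core.toSeminormedAddCommGroup (c := hh.preGNSCore)
instance : InnerProductSpace ℂ hh.PreGNS := InnerProductSpace.ofCore hh.preGNSCore

/-- The GNS Hilbert space `H_h = L²(SU_q(2), h)`. -/
abbrev GNS : Type := UniformSpace.Completion hh.PreGNS

/-- The canonical map of `O(SU_q(2))` to `H_h`. -/
def toGNS : SUq2 q →ₗ[ℂ] hh.GNS :=
  (UniformSpace.Completion.toComplL (𝕜 := ℂ) (E := hh.PreGNS)).toLinearMap ∘ₗ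
    hh.toPreGNS.toLinearMap

/-- The Hilbert space `H = H_h ⊕ H_h`. -/
abbrev Space : Type := WithLp 2 (hh.GNS × hh.GNS)

/-- The inclusion of the core `O(SU_q(2)) ⊕ O(SU_q(2))` in `H_h ⊕ H_h`. -/
def core : SUq2 q × SUq2 q →ₗ[ℂ] hh.Space :=
  (WithLp.linearEquiv 2 ℂ (hh.GNS × hh.GNS)).symm.toLinearMap ∘ₗ
    hh.toGNS.prodMap hh.toGNS

end IsHaarState

/-! ### The zeta functions and the non-commutative integral -/

namespace SUq2

variable {q : Set.Ioo (0 : ℝ) 1}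

/-- The weight operator `Δ_φ = Δ_L^{-α} Δ_R^β` on one copy of the core. -/
def weightOp (q : Set.Ioo (0 : ℝ) 1) (α β : ℝ) : SUq2 q →ₗ[ℂ] SUq2 q :=
  diagFun (modL q) (fun μ => μ ^ (-(α : ℂ))) ∘ₗ diagFun (modR q) (fun μ => μ ^ (β : ℂ))

/-- The operator `|D_q|^{-z} = (D_q²)^{-z/2}` on the core. -/
def absDiracPow (q : Set.Ioo (0 : ℝ) 1) (z : ℂ) : SUq2 q × SUq2 q →ₗ[ℂ] SUq2 q × SUq2 q :=
  diagFun (dirac q ∘ₗ dirac q) (fun μ => μ ^ (-z / 2))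

/-- The operator `Δ_L^{-α} Δ_R^β x |D_q|^{-z}` on the core, `x` acting by left multiplication. -/
def zetaOp (α β : ℝ) (x : SUq2 q) (z : ℂ) : SUq2 q × SUq2 q →ₗ[ℂ] SUq2 q × SUq2 q :=
  (weightOp q α β).prodMap (weightOp q α β) ∘ₗ
    (LinearMap.mulLeft ℂ x).prodMap (LinearMap.mulLeft ℂ x) ∘ₗ absDiracPow q z

end SUq2

namespace IsHaarState

variable {q : Set.Ioo (0 : ℝ) 1} {h : SUq2 q →ₗ[ℂ] ℂ} (hh : IsHaarState q h)

/-- `Δ_L^{-α} Δ_R^β x |D_q|^{-z}` is a trace class operator on `H_h ⊕ H_h`. -/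
def ZetaTraceClass (α β : ℝ) (x : SUq2 q) (z : ℂ) : Prop :=
  ∃ T : hh.Space →L[ℂ] hh.Space, IsTraceClassExt hh.core (SUq2.zetaOp α β x z) T

/-- The zeta function `ζ_x(z) = Tr(Δ_L^{-α} Δ_R^β x |D_q|^{-z})`. -/
def zeta (α β : ℝ) (x : SUq2 q) (z : ℂ) : ℂ := coreTrace hh.core (SUq2.zetaOp α β x z)

/-- The spectral dimension `inf {s > 0 : ζ(s) < ∞}`, where `ζ = ζ_1`. -/
def spectralDim (α β : ℝ) : ℝ := sInf {s : ℝ | 0 < s ∧ hh.ZetaTraceClass α β 1 s}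

/-- The non-commutative integral `φ(x)`: the residue of `ζ_x` at the spectral dimension. -/
def ncIntegral (α β : ℝ) (x : SUq2 q) : ℂ :=
  residueAt (hh.zeta α β x) (hh.spectralDim α β)

end IsHaarState

end

/-!
Weighted by `Δ_R`, the trace of left multiplication by `x` is a quantum trace on every eigenspace
of `Δ_L` inside a spin: for fixed `N` and `n ≤ N`, on the span of the weight vectors
`eⁿ ▷ (aⁱ c^{N-i})`, `0 ≤ i ≤ N`, the functional `x ↦ Tr(Δ_R x)` (compressed to their span) is
invariant under `◁ f` and `◁ k`, hence is a multiple of the Haar state (`IsHaarState.qTrace_eq`).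
Both `Δ_L` and `D_q²` are scalar on that span, so `ζ_x = h(x) ζ_1` holds exactly and not only for
the residues (`IsHaarState.zeta_eq`). This is why the normalized integral is `h` for every `a`.

The Haar state is constructed by `h(x) = (1 - q²) ∑ₙ q²ⁿ ⟨e_{n,0}, x e_{n,0}⟩` from the
representation of `O(SU_q(2))` by weighted shifts on `ℕ × ℤ`. Positivity is visible from the
formula. Left invariance follows from `h(e ▷ x) = 0` and `h(k ▷ x) = h(x)`, since the vectors
`eⁿ ▷ (aⁱ cʲ)` span the algebra (`SUq2.wtSpan_eq_top`): on those with `n > 0`, or of nontrivial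
weight, both `(id ⊗ h)Δ` and `h` vanish. Right invariance is transported by the automorphism that
exchanges `b` and `c`, and a left invariant and a right invariant normalized functional coincide,
which also gives uniqueness.

For any Haar state `e` and `f` are adjoint to each other and `k` is symmetric. So the vectors
`eⁿ ▷ (aⁱ cʲ)`, `n ≤ i + j`, are an orthogonal basis of the core, and `Δ_L`, `Δ_R` and `D_q²` are
diagonal in it: with `N = i + j` the eigenvalues of `Δ_L` and `Δ_R` are `q^{2n - N}` and
`q^{N - 2i}`, and those of `|D_q|` are `q^{-n} (1 - q^{N+1}) / (q⁻¹ - q)` and `q⁻¹` times that on the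
two summands of `𝓗`. The trace norm estimate comes from the geometric decay of
`Δ_L^{-a} Δ_R |D_q|^{-z}` for `Re z > a + 1` (`SUq2.summable_eig`), and its failure for `s ≤ a + 1`
from the corner `i = n = N`.

Summing `ζ_1` over `i` and `n` leaves a series over the spins whose `N`-th term is `q^{N(z-a-1)}`,
times a factor `(1 - q^{2(N+1)}) (1 - q^{N+1})^{-z} = 1 + O(q^N)`, plus a term of order
`q^{N(a-1)}` (`SUq2.zetaSum_eq`). The leading geometric series `1 / (1 - q^{z-a-1})` carries the
simple pole at `a + 1`; the rest is holomorphic near `a + 1` because `a > 1`.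
-/

noncomputable section

namespace SUq2

variable {q : Set.Ioo (0 : ℝ) 1}

/-- Induction over the generators. -/
lemma gen_induction {P : SUq2 q → Prop} (hs : ∀ r : ℂ, P (r • 1)) (hg : ∀ s, P (gen q s))
    (ha : ∀ x y, P x → P y → P (x + y)) (hm : ∀ x y, P x → P y → P (x * y)) (x : SUq2 q) :
    P x := by
  obtain ⟨y, rfl⟩ : ∃ y, mk q y = x := RingQuot.mkAlgHom_surjective ℂ (SUq2FreeRel q) x
  induction y using FreeAlgebra.induction with
  | grade0 r => rw [AlgHom.commutes, Algebra.algebraMap_eq_smul_one]; exact hs r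
  | grade1 s => exact hg s
  | mul x y hx hy => rw [map_mul]; exact hm _ _ hx hy
  | add x y hx hy => rw [map_add]; exact ha _ _ hx hy

/-- A subspace that contains `1` and is stable under left multiplication by the generators is
everything. -/
lemma eq_top_of_gen_mul_mem (W : Submodule ℂ (SUq2 q)) (h1 : (1 : SUq2 q) ∈ W)
    (hmul : ∀ s, ∀ x ∈ W, gen q s * x ∈ W) : W = ⊤ := by
  have key : ∀ x : SUq2 q, ∀ w ∈ W, x * w ∈ W := by
    refine gen_induction ?_ hmul ?_ ?_
    · intro r w hw; rw [smul_mul_assoc, one_mul]; exact W.smul_mem r hw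
    · intro x y hx hy w hw; rw [add_mul]; exact W.add_mem (hx w hw) (hy w hw)
    · intro x y hx hy w hw; rw [mul_assoc]; exact hx _ (hy w hw)
  refine Submodule.eq_top_iff'.2 fun x => ?_
  simpa using key x 1 h1

/-! ### The coproduct and the actions of functionals -/

lemma comul_gen (s : SUq2Gen) : comul q (gen q s) = comulGen q s := lift_gen _ _ s

lemma comul_coassoc (x : SUq2 q) :
    TensorProduct.assoc ℂ _ _ _ ((comul q).toLinearMap.rTensor (SUq2 q) (comul q x)) =
      (comul q).toLinearMap.lTensor (SUq2 q) (comul q x) := by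
  have key : (Algebra.TensorProduct.assoc ℂ ℂ ℂ (SUq2 q) (SUq2 q) (SUq2 q)).toAlgHom.comp
      ((Algebra.TensorProduct.map (comul q) (AlgHom.id ℂ _)).comp (comul q)) =
      (Algebra.TensorProduct.map (AlgHom.id ℂ _) (comul q)).comp (comul q) := by
    refine algHom_ext fun s => ?_
    cases s <;> simp [comul_gen, comulGen, TensorProduct.add_tmul, TensorProduct.tmul_add] <;> abel
  exact DFunLike.congr_fun key x

/-- `(id ⊗ u)` on the tensor square. -/
def slice (u : SUq2 q →ₗ[ℂ] ℂ) : SUq2 q ⊗[ℂ] SUq2 q →ₗ[ℂ] SUq2 q :=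
  (TensorProduct.rid ℂ (SUq2 q)).toLinearMap ∘ₗ LinearMap.lTensor (SUq2 q) u

/-- `(u ⊗ id)` on the tensor square. -/
def coslice (u : SUq2 q →ₗ[ℂ] ℂ) : SUq2 q ⊗[ℂ] SUq2 q →ₗ[ℂ] SUq2 q :=
  (TensorProduct.lid ℂ (SUq2 q)).toLinearMap ∘ₗ LinearMap.rTensor (SUq2 q) u

lemma slice_tmul (u : SUq2 q →ₗ[ℂ] ℂ) (x y : SUq2 q) : slice u (x ⊗ₜ y) = u y • x := by
  simp [slice]

lemma coslice_tmul (u : SUq2 q →ₗ[ℂ] ℂ) (x y : SUq2 q) : coslice u (x ⊗ₜ y) = u x • y := by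
  simp [coslice]

lemma leftAct_eq (u : SUq2 q →ₗ[ℂ] ℂ) (x : SUq2 q) : leftAct u x = slice u (comul q x) := rfl

lemma rightAct_eq (u : SUq2 q →ₗ[ℂ] ℂ) (x : SUq2 q) : rightAct u x = coslice u (comul q x) := rfl

lemma leftAct_one (u : SUq2 q →ₗ[ℂ] ℂ) : leftAct u 1 = u 1 • (1 : SUq2 q) := by
  rw [leftAct_eq, map_one, Algebra.TensorProduct.one_def, slice_tmul]

lemma rightAct_one (u : SUq2 q →ₗ[ℂ] ℂ) : rightAct u 1 = u 1 • (1 : SUq2 q) := by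
  rw [rightAct_eq, map_one, Algebra.TensorProduct.one_def, coslice_tmul]

lemma leftAct_mul {u u₁ v₁ u₂ v₂ : SUq2 q →ₗ[ℂ] ℂ}
    (H : ∀ x y, u (x * y) = u₁ x * v₁ y + u₂ x * v₂ y) (x y : SUq2 q) :
    leftAct u (x * y) = leftAct u₁ x * leftAct v₁ y + leftAct u₂ x * leftAct v₂ y := by
  simp only [leftAct_eq, map_mul]
  generalize comul q x = z
  generalize comul q y = w
  induction z using TensorProduct.induction_on with
  | zero => simp
  | add z₁ z₂ h₁ h₂ => simp only [add_mul, map_add, h₁, h₂]; abel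
  | tmul a b =>
    induction w using TensorProduct.induction_on with
    | zero => simp
    | add z₁ z₂ h₁ h₂ => simp only [mul_add, map_add, h₁, h₂]; abel
    | tmul c d =>
      simp only [Algebra.TensorProduct.tmul_mul_tmul, slice_tmul, H, smul_mul_smul_comm, add_smul]

lemma rightAct_mul {u u₁ v₁ u₂ v₂ : SUq2 q →ₗ[ℂ] ℂ}
    (H : ∀ x y, u (x * y) = u₁ x * v₁ y + u₂ x * v₂ y) (x y : SUq2 q) :
    rightAct u (x * y) = rightAct u₁ x * rightAct v₁ y + rightAct u₂ x * rightAct v₂ y := by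
  simp only [rightAct_eq, map_mul]
  generalize comul q x = z
  generalize comul q y = w
  induction z using TensorProduct.induction_on with
  | zero => simp
  | add z₁ z₂ h₁ h₂ => simp only [add_mul, map_add, h₁, h₂]; abel
  | tmul a b =>
    induction w using TensorProduct.induction_on with
    | zero => simp
    | add z₁ z₂ h₁ h₂ => simp only [mul_add, map_add, h₁, h₂]; abel
    | tmul c d =>
      simp only [Algebra.TensorProduct.tmul_mul_tmul, coslice_tmul, H, smul_mul_smul_comm,
        add_smul]

/-- `u(x₍₁₎ v(x₍₂₎)) = v(u(x₍₁₎) x₍₂₎)`. -/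
lemma apply_leftAct (u v : SUq2 q →ₗ[ℂ] ℂ) (x : SUq2 q) : u (leftAct v x) = v (rightAct u x) := by
  rw [leftAct_eq, rightAct_eq]
  generalize comul q x = z
  induction z using TensorProduct.induction_on with
  | zero => simp
  | add z₁ z₂ h₁ h₂ => simp only [map_add, h₁, h₂]
  | tmul a b => simp [slice_tmul, coslice_tmul, mul_comm]

lemma leftAct_leftAct (u v : SUq2 q →ₗ[ℂ] ℂ) (x : SUq2 q) :
    leftAct u (leftAct v x) = leftAct (u ∘ₗ leftAct v) x := by
  have h1 : ∀ z, leftAct u (slice v z) =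
      (TensorProduct.rid ℂ (SUq2 q)) (LinearMap.lTensor (SUq2 q) (u ∘ₗ slice v)
        (TensorProduct.assoc ℂ _ _ _ ((comul q).toLinearMap.rTensor (SUq2 q) z))) := by
    intro z
    induction z using TensorProduct.induction_on with
    | zero => simp
    | add z₁ z₂ h₁ h₂ => simp only [map_add, h₁, h₂]
    | tmul a b =>
      rw [slice_tmul, map_smul, leftAct_eq, LinearMap.rTensor_tmul, AlgHom.toLinearMap_apply]
      generalize comul q a = w
      induction w using TensorProduct.induction_on with
      | zero => simp
      | add z₁ z₂ h₁ h₂ => simp only [map_add, TensorProduct.add_tmul, smul_add, h₁, h₂]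
      | tmul c d => simp [slice_tmul, smul_smul]
  rw [leftAct_eq v, h1, comul_coassoc, leftAct_eq]
  generalize comul q x = z
  induction z using TensorProduct.induction_on with
  | zero => simp
  | add z₁ z₂ h₁ h₂ => simp only [map_add, h₁, h₂]
  | tmul a b => simp [slice_tmul, leftAct_eq]

lemma leftAct_rightAct (u v : SUq2 q →ₗ[ℂ] ℂ) (x : SUq2 q) :
    leftAct u (rightAct v x) = rightAct v (leftAct u x) := by
  have h1 : ∀ z, rightAct v (slice u z) =
      coslice v (LinearMap.lTensor (SUq2 q) (slice u)
        (TensorProduct.assoc ℂ _ _ _ ((comul q).toLinearMap.rTensor (SUq2 q) z))) := by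
    intro z
    induction z using TensorProduct.induction_on with
    | zero => simp
    | add z₁ z₂ h₁ h₂ => simp only [map_add, h₁, h₂]
    | tmul a b =>
      rw [slice_tmul, map_smul, rightAct_eq, LinearMap.rTensor_tmul, AlgHom.toLinearMap_apply]
      generalize comul q a = w
      induction w using TensorProduct.induction_on with
      | zero => simp
      | add z₁ z₂ h₁ h₂ => simp only [map_add, TensorProduct.add_tmul, smul_add, h₁, h₂]
      | tmul c d => simp [slice_tmul, coslice_tmul, smul_smul]
  rw [leftAct_eq u x, h1, comul_coassoc, rightAct_eq v x]
  generalize comul q x = z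
  induction z using TensorProduct.induction_on with
  | zero => simp
  | add z₁ z₂ h₁ h₂ => simp only [map_add, h₁, h₂]
  | tmul a b => simp [coslice_tmul, leftAct_eq]

/-! ### The flip automorphism -/

/-- The exchange of `b` and `c` on generators. -/
def flipGen : SUq2Gen → SUq2Gen
  | .a => .a
  | .b => .c
  | .c => .b
  | .d => .d

/-- The algebra automorphism that exchanges `b` and `c` (transposition of the fundamental
matrix). It reverses the coproduct. -/
def flip (q : Set.Ioo (0 : ℝ) 1) : SUq2 q →ₐ[ℂ] SUq2 q :=
  lift (fun s => gen q (flipGen s)) (by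
    have H := gen_rel q
    constructor <;> simp only [flipGen, H.ab, H.ac, H.bd, H.cd, H.bc, H.ad, H.da])

lemma flip_gen (s : SUq2Gen) : flip q (gen q s) = gen q (flipGen s) := lift_gen _ _ s

lemma flip_flip (x : SUq2 q) : flip q (flip q x) = x := by
  have : (flip q).comp (flip q) = AlgHom.id ℂ _ := by
    refine algHom_ext fun s => ?_
    cases s <;> simp [flip_gen, flipGen]
  exact DFunLike.congr_fun this x

lemma comul_flip (x : SUq2 q) :
    comul q (flip q x) = TensorProduct.comm ℂ _ _
      (TensorProduct.map (flip q).toLinearMap (flip q).toLinearMap (comul q x)) := by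
  have : (comul q).comp (flip q) = (Algebra.TensorProduct.comm ℂ _ _).toAlgHom.comp
      ((Algebra.TensorProduct.map (flip q) (flip q)).comp (comul q)) := by
    refine algHom_ext fun s => ?_
    cases s <;> simp [comul_gen, comulGen, flip_gen, flipGen]
  exact DFunLike.congr_fun this x

lemma flip_leftAct (u : SUq2 q →ₗ[ℂ] ℂ) (x : SUq2 q) :
    flip q (leftAct u x) = rightAct (u ∘ₗ (flip q).toLinearMap) (flip q x) := by
  rw [leftAct_eq, rightAct_eq, comul_flip]
  generalize comul q x = z
  induction z using TensorProduct.induction_on with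
  | zero => simp
  | add z₁ z₂ h₁ h₂ => simp only [map_add, h₁, h₂]
  | tmul a b => simp [slice_tmul, coslice_tmul, flip_flip]

/-! ### The generators `k`, `e`, `f` -/

/-- `q^{1/2}` as a complex number. -/
def rt (q : Set.Ioo (0 : ℝ) 1) : ℂ := ((Real.sqrt q : ℝ) : ℂ)

lemma rt_ne (q : Set.Ioo (0 : ℝ) 1) : rt q ≠ 0 := sqrt_ne_zero q

lemma q_eq_rt (q : Set.Ioo (0 : ℝ) 1) : ((q : ℝ) : ℂ) = rt q ^ 2 := by
  rw [sq]; exact (sqrt_mul_self q).symm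

lemma pairK_gen (n : ℤ) :
    pairK q n (gen q .a) = rt q ^ (-n) ∧ pairK q n (gen q .b) = 0 ∧
    pairK q n (gen q .c) = 0 ∧ pairK q n (gen q .d) = rt q ^ n := by
  simp only [pairK, lift_gen, rt]; trivial

lemma pairEMatrix_entries (x : SUq2 q) :
    pairEMatrix q x 1 0 = 0 ∧ pairEMatrix q x 0 0 = pairK q (-1) x ∧
      pairEMatrix q x 1 1 = pairK q 1 x := by
  induction x using gen_induction with
  | hs r => simp
  | hg s => cases s <;> simp [pairEMatrix, pairK]
  | ha x y hx hy => simp [hx, hy]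
  | hm x y hx hy => simp [hx, hy, Matrix.mul_apply, Fin.sum_univ_two]

lemma pairE_mul (x y : SUq2 q) :
    pairE q (x * y) = pairE q x * pairK q 1 y + pairK q (-1) x * pairE q y := by
  have hx := pairEMatrix_entries x
  have hy := pairEMatrix_entries y
  simp [pairE, Matrix.mul_apply, Fin.sum_univ_two, hx, hy, add_comm]

lemma pairE_gen : pairE q (gen q .a) = 0 ∧ pairE q (gen q .b) = 0 ∧
    pairE q (gen q .c) = 1 ∧ pairE q (gen q .d) = 0 := by
  simp [pairE, pairEMatrix]

lemma pairE_flip : pairE q ∘ₗ (flip q).toLinearMap = pairF q := by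
  have : (pairEMatrix q).comp (flip q) = pairFMatrix q := by
    refine algHom_ext fun s => ?_
    cases s <;> simp [flip_gen, flipGen, pairEMatrix, pairFMatrix]
  ext x
  exact congrFun (congrFun (DFunLike.congr_fun this x) 0) 1

lemma pairK_flip (n : ℤ) : (pairK q n).toLinearMap ∘ₗ (flip q).toLinearMap =
    (pairK q n).toLinearMap := by
  have : (pairK q n).comp (flip q) = pairK q n := by
    refine algHom_ext fun s => ?_
    cases s <;> simp [flip_gen, flipGen, pairK]
  ext x
  exact DFunLike.congr_fun this x

lemma pairF_mul (x y : SUq2 q) :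
    pairF q (x * y) = pairF q x * pairK q 1 y + pairK q (-1) x * pairF q y := by
  have hK := fun (n : ℤ) (x : SUq2 q) => DFunLike.congr_fun (pairK_flip (q := q) n) x
  simp only [LinearMap.comp_apply, AlgHom.toLinearMap_apply] at hK
  simp only [← pairE_flip, LinearMap.comp_apply, AlgHom.toLinearMap_apply, map_mul, pairE_mul, hK]

lemma pairF_gen : pairF q (gen q .a) = 0 ∧ pairF q (gen q .b) = 1 ∧
    pairF q (gen q .c) = 0 ∧ pairF q (gen q .d) = 0 := by
  simp [pairF, pairFMatrix]

/-- `x ◁ kⁿ`. -/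
def rK (q : Set.Ioo (0 : ℝ) 1) (n : ℤ) : SUq2 q →ₗ[ℂ] SUq2 q := rightAct (pairK q n).toLinearMap

/-- `x ◁ f`. -/
def rF (q : Set.Ioo (0 : ℝ) 1) : SUq2 q →ₗ[ℂ] SUq2 q := rightAct (pairF q)

lemma dK_mul (n : ℤ) (x y : SUq2 q) : dK q n (x * y) = dK q n x * dK q n y := by
  have := leftAct_mul (u := (pairK q n).toLinearMap) (u₁ := (pairK q n).toLinearMap)
    (v₁ := (pairK q n).toLinearMap) (u₂ := 0) (v₂ := 0) (by simp) x y
  rw [dK, this]; simp [leftAct]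

lemma rK_mul (n : ℤ) (x y : SUq2 q) : rK q n (x * y) = rK q n x * rK q n y := by
  have := rightAct_mul (u := (pairK q n).toLinearMap) (u₁ := (pairK q n).toLinearMap)
    (v₁ := (pairK q n).toLinearMap) (u₂ := 0) (v₂ := 0) (by simp) x y
  rw [rK, this]; simp [rightAct]

lemma dE_mul (x y : SUq2 q) : dE q (x * y) = dE q x * dK q 1 y + dK q (-1) x * dE q y :=
  leftAct_mul (u₁ := pairE q) (v₁ := (pairK q 1).toLinearMap) (u₂ := (pairK q (-1)).toLinearMap)
    (v₂ := pairE q) pairE_mul x y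

lemma dF_mul (x y : SUq2 q) : dF q (x * y) = dF q x * dK q 1 y + dK q (-1) x * dF q y :=
  leftAct_mul (u₁ := pairF q) (v₁ := (pairK q 1).toLinearMap) (u₂ := (pairK q (-1)).toLinearMap)
    (v₂ := pairF q) pairF_mul x y

lemma rF_mul (x y : SUq2 q) : rF q (x * y) = rF q x * rK q 1 y + rK q (-1) x * rF q y :=
  rightAct_mul (u₁ := pairF q) (v₁ := (pairK q 1).toLinearMap) (u₂ := (pairK q (-1)).toLinearMap)
    (v₂ := pairF q) pairF_mul x y

lemma dK_one (n : ℤ) : dK q n 1 = 1 := by simp [dK, leftAct_one]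
lemma rK_one (n : ℤ) : rK q n 1 = 1 := by simp [rK, rightAct_one]

lemma dE_one : dE q 1 = 0 := by simp [dE, leftAct_one, pairE]

lemma dF_one : dF q 1 = 0 := by simp [dF, leftAct_one, pairF]

lemma rF_one : rF q 1 = 0 := by simp [rF, rightAct_one, pairF]

lemma dK_gen (n : ℤ) :
    dK q n (gen q .a) = rt q ^ (-n) • gen q .a ∧ dK q n (gen q .b) = rt q ^ n • gen q .b ∧
    dK q n (gen q .c) = rt q ^ (-n) • gen q .c ∧ dK q n (gen q .d) = rt q ^ n • gen q .d := by
  simp [dK, leftAct_eq, comul_gen, comulGen, slice_tmul, pairK_gen]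

lemma rK_gen (n : ℤ) :
    rK q n (gen q .a) = rt q ^ (-n) • gen q .a ∧ rK q n (gen q .b) = rt q ^ (-n) • gen q .b ∧
    rK q n (gen q .c) = rt q ^ n • gen q .c ∧ rK q n (gen q .d) = rt q ^ n • gen q .d := by
  simp [rK, rightAct_eq, comul_gen, comulGen, coslice_tmul, pairK_gen]

lemma dE_gen : dE q (gen q .a) = gen q .b ∧ dE q (gen q .b) = 0 ∧
    dE q (gen q .c) = gen q .d ∧ dE q (gen q .d) = 0 := by
  simp [dE, leftAct_eq, comul_gen, comulGen, slice_tmul, pairE_gen]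

lemma dF_gen : dF q (gen q .a) = 0 ∧ dF q (gen q .b) = gen q .a ∧
    dF q (gen q .c) = 0 ∧ dF q (gen q .d) = gen q .c := by
  simp [dF, leftAct_eq, comul_gen, comulGen, slice_tmul, pairF_gen]

lemma rF_gen : rF q (gen q .a) = gen q .c ∧ rF q (gen q .b) = gen q .d ∧
    rF q (gen q .c) = 0 ∧ rF q (gen q .d) = 0 := by
  simp [rF, rightAct_eq, comul_gen, comulGen, coslice_tmul, pairF_gen]

lemma dE_rF (x : SUq2 q) : dE q (rF q x) = rF q (dE q x) := leftAct_rightAct _ _ x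
lemma dE_rK (n : ℤ) (x : SUq2 q) : dE q (rK q n x) = rK q n (dE q x) := leftAct_rightAct _ _ x

lemma dK_dK (m n : ℤ) (x : SUq2 q) : dK q m (dK q n x) = dK q (m + n) x := by
  have hs := rt_ne q
  induction x using gen_induction with
  | hs r => simp [dK_one]
  | hg s => cases s <;> simp [dK_gen, smul_smul, zpow_add₀ hs, mul_comm]
  | ha x y hx hy => simp [hx, hy]
  | hm x y hx hy => simp only [dK_mul, hx, hy]

lemma rK_rK (m n : ℤ) (x : SUq2 q) : rK q m (rK q n x) = rK q (m + n) x := by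
  have hs := rt_ne q
  induction x using gen_induction with
  | hs r => simp [rK_one]
  | hg s => cases s <;> simp [rK_gen, smul_smul, zpow_add₀ hs, mul_comm]
  | ha x y hx hy => simp [hx, hy]
  | hm x y hx hy => simp only [rK_mul, hx, hy]

lemma dK_zero (x : SUq2 q) : dK q 0 x = x := by
  induction x using gen_induction with
  | hs r => simp [dK_one]
  | hg s => cases s <;> simp [dK_gen]
  | ha x y hx hy => simp [hx, hy]
  | hm x y hx hy => simp only [dK_mul, hx, hy]

lemma rK_zero (x : SUq2 q) : rK q 0 x = x := by
  induction x using gen_induction with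
  | hs r => simp [rK_one]
  | hg s => cases s <;> simp [rK_gen]
  | ha x y hx hy => simp [hx, hy]
  | hm x y hx hy => simp only [rK_mul, hx, hy]

/-- `kⁿ e = qⁿ e kⁿ`. -/
lemma dK_dE (n : ℤ) (x : SUq2 q) : dK q n (dE q x) = rt q ^ (2 * n) • dE q (dK q n x) := by
  have hs := rt_ne q
  induction x using gen_induction with
  | hs r => simp [dK_one, dE_one]
  | hg s =>
    cases s <;> simp [dK_gen, dE_gen, smul_smul]
    all_goals rw [← zpow_neg, ← zpow_add₀ hs]; congr 2; ring
  | ha x y hx hy => simp [hx, hy]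
  | hm x y hx hy =>
    simp only [dK_mul, dE_mul, map_add, hx, hy, dK_dK, smul_add, smul_mul_assoc, mul_smul_comm,
      add_comm]

/-- `kⁿ f = q⁻ⁿ f kⁿ`. -/
lemma dK_dF (n : ℤ) (x : SUq2 q) : dK q n (dF q x) = rt q ^ (-(2 * n)) • dF q (dK q n x) := by
  have hs := rt_ne q
  induction x using gen_induction with
  | hs r => simp [dK_one, dF_one]
  | hg s =>
    cases s <;> simp [dK_gen, dF_gen, smul_smul]
    all_goals rw [← zpow_neg, ← zpow_neg, ← zpow_add₀ hs]; congr 2; ring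
  | ha x y hx hy => simp [hx, hy]
  | hm x y hx hy =>
    simp only [dK_mul, dF_mul, map_add, hx, hy, dK_dK, smul_add, smul_mul_assoc, mul_smul_comm,
      add_comm]

/-- `q - q⁻¹` is not zero. -/
lemma q_sub_inv_ne (q : Set.Ioo (0 : ℝ) 1) : ((q : ℝ) : ℂ) - ((q : ℝ) : ℂ)⁻¹ ≠ 0 := by
  have h0 := q.2.1
  have h1 := q.2.2
  have : (q : ℝ) - (q : ℝ)⁻¹ < 0 := by
    have := one_lt_inv₀ h0 |>.2 h1
    linarith
  exact_mod_cast this.ne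

/-- `e f - f e = (k² - k⁻²) / (q - q⁻¹)`. -/
lemma dE_dF (x : SUq2 q) : dE q (dF q x) - dF q (dE q x) =
    (((q : ℝ) : ℂ) - ((q : ℝ) : ℂ)⁻¹)⁻¹ • (dK q 2 x - dK q (-2) x) := by
  have hs := rt_ne q
  have hq := q_sub_inv_ne q
  induction x using gen_induction with
  | hs r => simp [dK_one, dE_one, dF_one]
  | hg s =>
    rw [eq_inv_smul_iff₀ hq]
    have e1 : rt q ^ (2 : ℤ) = ((q : ℝ) : ℂ) := (q_eq_rt q).symm
    cases s <;> simp [dK_gen, dE_gen, dF_gen, e1] <;> module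
  | ha x y hx hy =>
    simp only [map_add]
    rw [add_sub_add_comm, hx, hy]; module
  | hm x y hx hy =>
    have c1 := dK_dF (-1) x
    have c2 := dK_dE 1 y
    have c3 := dK_dE (-1) x
    have c4 := dK_dF 1 y
    have e1 : dE q (dF q (x * y)) - dF q (dE q (x * y)) =
        (dE q (dF q x) - dF q (dE q x)) * dK q 2 y +
          dK q (-2) x * (dE q (dF q y) - dF q (dE q y)) := by
      simp only [dE_mul, dF_mul, map_add, dK_dK, c1, c2, c3, c4, smul_mul_assoc, mul_smul_comm]
      norm_num
      simp only [sub_mul, mul_sub]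
      match_scalars <;> field_simp <;> ring
    rw [e1, hx, hy]
    simp only [dK_mul, smul_mul_assoc, mul_smul_comm, sub_mul, mul_sub, smul_sub]
    abel

/-! ### The involution and the actions -/

lemma star_dK (n : ℤ) (x : SUq2 q) : star (dK q n x) = dK q (-n) (star x) := by
  have hr : ∀ m : ℤ, (starRingEnd ℂ) (rt q ^ m) = rt q ^ m := by
    intro m; rw [map_zpow₀, rt, Complex.conj_ofReal]
  induction x using gen_induction with
  | hs r => simp [dK_one]
  | hg s => cases s <;> simp only [dK_gen, star_gen, starGen, star_smul', hr, map_smul, map_neg,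
      neg_smul, smul_neg, neg_neg, smul_comm (_ : ℂ) (_ : ℂ) (_ : SUq2 q)]
  | ha x y hx hy => simp [hx, hy]
  | hm x y hx hy => simp only [dK_mul, star_mul, hx, hy]

lemma star_dE (x : SUq2 q) : star (dE q x) = -((q : ℝ) : ℂ) • dF q (star x) := by
  have hq := q_ne_zero q
  induction x using gen_induction with
  | hs r => simp [dE_one, dF_one]
  | hg s => cases s <;> simp [dE_gen, dF_gen, star_gen, starGen, hq]
  | ha x y hx hy => simp only [map_add, star_add, hx, hy, smul_add]
  | hm x y hx hy =>
    simp only [dE_mul, dF_mul, star_add, star_mul, hx, hy, star_dK, neg_neg, smul_add,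
      smul_mul_assoc, mul_smul_comm]
    abel

/-! ### The vectors `eⁿ ▷ (aⁱ cʲ)` -/

/-- The lowest weight vector `aⁱ cʲ`. -/
def lowVec (q : Set.Ioo (0 : ℝ) 1) (i j : ℕ) : SUq2 q := gen q .a ^ i * gen q .c ^ j

/-- The weight vector `eⁿ ▷ (aⁱ cʲ)`, a multiple of a matrix coefficient of spin `(i + j) / 2`. -/
def wtVec (q : Set.Ioo (0 : ℝ) 1) (i j n : ℕ) : SUq2 q := (dE q)^[n] (lowVec q i j)

lemma wtVec_zero (i j : ℕ) : wtVec q i j 0 = lowVec q i j := rfl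

lemma wtVec_succ (i j n : ℕ) : wtVec q i j (n + 1) = dE q (wtVec q i j n) :=
  Function.iterate_succ_apply' _ _ _

lemma lowVec_zero : lowVec q 0 0 = 1 := by simp [lowVec]

lemma dK_pow (n : ℤ) (x : SUq2 q) (i : ℕ) : dK q n (x ^ i) = dK q n x ^ i := by
  induction i with
  | zero => simp [dK_one]
  | succ i ih => rw [pow_succ, dK_mul, ih, pow_succ]

lemma rK_pow (n : ℤ) (x : SUq2 q) (i : ℕ) : rK q n (x ^ i) = rK q n x ^ i := by
  induction i with
  | zero => simp [rK_one]
  | succ i ih => rw [pow_succ, rK_mul, ih, pow_succ]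

lemma dK_lowVec (n : ℤ) (i j : ℕ) :
    dK q n (lowVec q i j) = rt q ^ (-n * (i + j)) • lowVec q i j := by
  rw [lowVec, dK_mul, dK_pow, dK_pow, (dK_gen n).1, (dK_gen n).2.2.1, smul_pow, smul_pow,
    smul_mul_smul_comm, ← pow_add]
  congr 1
  rw [zpow_mul]; norm_cast

lemma rK_lowVec (n : ℤ) (i j : ℕ) :
    rK q n (lowVec q i j) = rt q ^ (n * (j - i)) • lowVec q i j := by
  rw [lowVec, rK_mul, rK_pow, rK_pow, (rK_gen n).1, (rK_gen n).2.2.1, smul_pow, smul_pow,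
    smul_mul_smul_comm]
  congr 1
  rw [← zpow_natCast, ← zpow_natCast, ← zpow_mul, ← zpow_mul, ← zpow_add₀ (rt_ne q)]
  congr 1; ring

lemma dK_wtVec (n : ℤ) (i j m : ℕ) :
    dK q n (wtVec q i j m) = rt q ^ (n * (2 * m - (i + j))) • wtVec q i j m := by
  induction m with
  | zero => rw [wtVec_zero, dK_lowVec]; congr 2; push_cast; ring
  | succ m ih =>
    rw [wtVec_succ, dK_dE, ih, map_smul, smul_smul, ← zpow_add₀ (rt_ne q)]
    congr 2; push_cast; ring

lemma rK_wtVec (n : ℤ) (i j m : ℕ) :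
    rK q n (wtVec q i j m) = rt q ^ (n * (j - i)) • wtVec q i j m := by
  induction m with
  | zero => rw [wtVec_zero, rK_lowVec]
  | succ m ih => rw [wtVec_succ, ← dE_rK, ih, map_smul]

lemma dF_pow_eq_zero {x : SUq2 q} (hx : dF q x = 0) (i : ℕ) : dF q (x ^ i) = 0 := by
  induction i with
  | zero => simp [dF_one]
  | succ i ih => rw [pow_succ, dF_mul, ih, hx]; simp

lemma dF_lowVec (i j : ℕ) : dF q (lowVec q i j) = 0 := by
  rw [lowVec, dF_mul, dF_pow_eq_zero dF_gen.1, dF_pow_eq_zero dF_gen.2.2.1]; simp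

/-- The `q`-number `[n] = (q⁻ⁿ - qⁿ) / (q⁻¹ - q)`. -/
def qnum (q : Set.Ioo (0 : ℝ) 1) (n : ℤ) : ℝ :=
  ((q : ℝ) ^ (-n) - (q : ℝ) ^ n) / ((q : ℝ)⁻¹ - q)

lemma inv_sub_pos (q : Set.Ioo (0 : ℝ) 1) : 0 < (q : ℝ)⁻¹ - q := by
  have := (one_lt_inv₀ q.2.1).2 q.2.2
  have := q.2.2
  linarith

lemma qnum_pos {n : ℤ} (hn : 0 < n) : 0 < qnum q n := by
  refine div_pos ?_ (inv_sub_pos q)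
  have h1 : (q : ℝ) ^ n < 1 := by
    lift n to ℕ using hn.le
    rw [zpow_natCast]
    exact pow_lt_one₀ q.2.1.le q.2.2 (by omega)
  have h2 : 0 < (q : ℝ) ^ n := zpow_pos q.2.1 n
  have h3 : 1 < ((q : ℝ) ^ n)⁻¹ := (one_lt_inv₀ h2).2 h1
  rw [zpow_neg]; linarith

/-- The lowering relation, by induction from `e f - f e = (k² - k⁻²) / (q - q⁻¹)`. -/
lemma dF_wtVec_succ (i j n : ℕ) : dF q (wtVec q i j (n + 1)) =
    ((qnum q (n + 1) * qnum q (i + j - n) : ℝ) : ℂ) • wtVec q i j n := by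
  have hq := q_ne_zero q
  have hq0 : ((q : ℝ) : ℂ)⁻¹ - ((q : ℝ) : ℂ) ≠ 0 := by
    have := (inv_sub_pos q).ne'
    exact_mod_cast this
  have hq' := q_sub_inv_ne q
  have step : ∀ n, dF q (wtVec q i j (n + 1)) = dE q (dF q (wtVec q i j n)) -
      (((q : ℝ) : ℂ) - ((q : ℝ) : ℂ)⁻¹)⁻¹ •
        (((q : ℝ) : ℂ) ^ (2 * n - (i + j) : ℤ) - ((q : ℝ) : ℂ) ^ (-(2 * n - (i + j)) : ℤ)) •
          wtVec q i j n := by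
    intro n
    have h := dE_dF (wtVec q i j n)
    rw [dK_wtVec, dK_wtVec, ← sub_smul] at h
    have e1 : rt q ^ (2 * (2 * n - (i + j)) : ℤ) = ((q : ℝ) : ℂ) ^ (2 * n - (i + j) : ℤ) := by
      rw [zpow_mul, q_eq_rt]; norm_cast
    have e2 : rt q ^ (-2 * (2 * n - (i + j)) : ℤ) = ((q : ℝ) : ℂ) ^ (-(2 * n - (i + j)) : ℤ) := by
      rw [q_eq_rt, ← zpow_natCast, ← zpow_mul]; congr 1; push_cast; ring
    rw [e1, e2] at h
    rw [wtVec_succ, ← h]; abel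
  induction n with
  | zero =>
    rw [step, wtVec_zero, dF_lowVec]
    simp only [qnum]
    push_cast
    rw [map_zero, zero_sub, smul_smul, ← neg_smul]
    congr 1
    rw [show (((q : ℝ) : ℂ) - ((q : ℝ) : ℂ)⁻¹)⁻¹ = -(((q : ℝ) : ℂ)⁻¹ - ((q : ℝ) : ℂ))⁻¹ by
      rw [← inv_neg, neg_sub]]
    field_simp
    simp
  | succ n ih =>
    rw [step, ih, map_smul, ← wtVec_succ, smul_smul, ← sub_smul]
    congr 1
    simp only [qnum]
    push_cast
    rw [show (((q : ℝ) : ℂ) - ((q : ℝ) : ℂ)⁻¹)⁻¹ = -(((q : ℝ) : ℂ)⁻¹ - ((q : ℝ) : ℂ))⁻¹ by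
      rw [← inv_neg, neg_sub]]
    generalize hX : ((q : ℝ) : ℂ) = X at *
    have e1 : X ^ (-(n + 1) : ℤ) = (X ^ n)⁻¹ * X⁻¹ := by
      rw [zpow_neg, zpow_add₀ hq]; simp [mul_comm]
    have e2 : X ^ ((n : ℤ) + 1) = X ^ n * X := by rw [zpow_add₀ hq]; simp
    have e3 : X ^ (-((i : ℤ) + j - n)) = X ^ n * (X ^ (i + j))⁻¹ := by
      rw [← zpow_natCast, ← zpow_natCast, ← zpow_neg, ← zpow_add₀ hq]; congr 1; push_cast; ring
    have e4 : X ^ (((i : ℤ) + j - n)) = (X ^ n)⁻¹ * X ^ (i + j) := by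
      rw [← zpow_natCast, ← zpow_natCast, ← zpow_neg, ← zpow_add₀ hq]; congr 1; push_cast; ring
    have e5 : X ^ (2 * (n + 1 : ℤ) - (i + j)) = X ^ n * X ^ n * X ^ 2 * (X ^ (i + j))⁻¹ := by
      rw [← zpow_natCast, ← zpow_natCast, ← zpow_natCast, ← zpow_neg, ← zpow_add₀ hq,
        ← zpow_add₀ hq, ← zpow_add₀ hq]; congr 1; push_cast; ring
    have e6 : X ^ (-(2 * (n + 1 : ℤ) - (i + j))) = (X ^ n * X ^ n * X ^ 2)⁻¹ * X ^ (i + j) := by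
      rw [zpow_neg, e5, mul_inv, inv_inv]
    have e7 : X ^ (-((n : ℤ) + 1 + 1)) = (X ^ n)⁻¹ * (X ^ 2)⁻¹ := by
      rw [← zpow_natCast, ← zpow_natCast, ← zpow_neg, ← zpow_neg, ← zpow_add₀ hq]; congr 1
      push_cast; ring
    have e8 : X ^ ((n : ℤ) + 1 + 1) = X ^ n * X ^ 2 := by
      rw [← zpow_natCast, ← zpow_natCast, ← zpow_add₀ hq]; congr 1
    have e9 : X ^ (-((i : ℤ) + j - (n + 1))) = X ^ n * (X ^ (i + j))⁻¹ * X := by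
      rw [show (-((i : ℤ) + j - (n + 1))) = (-((i : ℤ) + j - n)) + 1 by ring, zpow_add₀ hq, e3]
      simp
    have e10 : X ^ (((i : ℤ) + j - (n + 1))) = (X ^ n)⁻¹ * X ^ (i + j) * X⁻¹ := by
      rw [show (((i : ℤ) + j - (n + 1))) = (((i : ℤ) + j - n)) - 1 by ring, zpow_sub₀ hq, e4]
      simp [div_eq_mul_inv]
    -- what remains is a rational identity in `X`, `A = Xⁿ` and `B = X^{i+j}`
    rw [e1, e2, e3, e4, e5, e6, e7, e8, e9, e10]
    have hA : X ^ n ≠ 0 := pow_ne_zero _ hq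
    have hB : X ^ (i + j) ≠ 0 := pow_ne_zero _ hq
    generalize X ^ n = A at *
    generalize X ^ (i + j) = B at *
    generalize hl : X⁻¹ - X = l at *
    field_simp
    subst hl
    field_simp
    ring

/-! ### The weight vectors span -/

lemma mul_pow_of_qcomm {x y : SUq2 q} {r : ℂ} (h : y * x = r • (x * y)) (n : ℕ) :
    y * x ^ n = r ^ n • (x ^ n * y) := by
  induction n with
  | zero => simp
  | succ n ih =>
    rw [pow_succ, ← mul_assoc, ih, smul_mul_assoc, mul_assoc, h, mul_smul_comm, smul_smul,
      mul_assoc, pow_succ]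

lemma ba_comm (q : Set.Ioo (0 : ℝ) 1) :
    gen q .b * gen q .a = ((q : ℝ) : ℂ)⁻¹ • (gen q .a * gen q .b) := by
  rw [(gen_rel q).ab, smul_smul, inv_mul_cancel₀ (q_ne_zero q), one_smul]

lemma ca_comm (q : Set.Ioo (0 : ℝ) 1) :
    gen q .c * gen q .a = ((q : ℝ) : ℂ)⁻¹ • (gen q .a * gen q .c) := by
  rw [(gen_rel q).ac, smul_smul, inv_mul_cancel₀ (q_ne_zero q), one_smul]

lemma dc_comm (q : Set.Ioo (0 : ℝ) 1) :
    gen q .d * gen q .c = ((q : ℝ) : ℂ)⁻¹ • (gen q .c * gen q .d) := by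
  rw [(gen_rel q).cd, smul_smul, inv_mul_cancel₀ (q_ne_zero q), one_smul]

/-- The coefficient in `e ▷ xⁱ⁺¹ = eCoef i • xⁱ (e ▷ x)` for `x = a, c`. -/
def eCoef (q : Set.Ioo (0 : ℝ) 1) : ℕ → ℝ
  | 0 => 1
  | i + 1 => (Real.sqrt q ^ (3 * (i + 1)))⁻¹ + Real.sqrt q * eCoef q i

lemma eCoef_pos (i : ℕ) : 0 < eCoef q i := by
  have hs := Real.sqrt_pos.2 q.2.1
  induction i with
  | zero => exact one_pos
  | succ i ih => rw [eCoef]; positivity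

lemma dE_pow {x y : SUq2 q} (hx : dE q x = y) (hk : ∀ n : ℤ, dK q n x = rt q ^ (-n) • x)
    (hyx : y * x = ((q : ℝ) : ℂ)⁻¹ • (x * y)) (i : ℕ) :
    dE q (x ^ (i + 1)) = (eCoef q i : ℂ) • (x ^ i * y) := by
  have hs := rt_ne q
  induction i with
  | zero => simp [hx, eCoef]
  | succ i ih =>
    rw [pow_succ', dE_mul, hx, hk, ih, dK_pow, hk, smul_pow, mul_smul_comm, smul_mul_smul_comm,
      mul_pow_of_qcomm hyx, smul_smul, ← mul_assoc, ← pow_succ', ← add_smul, eCoef]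
    congr 1
    push_cast
    rw [← rt, q_eq_rt, zpow_one, zpow_neg, zpow_one, ← inv_pow, ← mul_pow]
    congr 1
    rw [pow_mul, ← inv_pow]
    congr 1
    field_simp

lemma dE_pow_a (i : ℕ) :
    dE q (gen q .a ^ (i + 1)) = (eCoef q i : ℂ) • (gen q .a ^ i * gen q .b) :=
  dE_pow dE_gen.1 (fun n => (dK_gen n).1) (ba_comm q) i

lemma dE_pow_c (i : ℕ) :
    dE q (gen q .c ^ (i + 1)) = (eCoef q i : ℂ) • (gen q .c ^ i * gen q .d) :=
  dE_pow dE_gen.2.2.1 (fun n => (dK_gen n).2.2.1) (dc_comm q) i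

/-- `e ▷ (y x) = q^{-1/2} y (e ▷ x)` for `y = b, d`. -/
lemma dE_bd_mul {y : SUq2 q} (h0 : dE q y = 0) (hk : ∀ n : ℤ, dK q n y = rt q ^ n • y)
    (x : SUq2 q) : dE q (y * x) = (rt q)⁻¹ • (y * dE q x) := by
  rw [dE_mul, h0, hk, zero_mul, zero_add, zpow_neg_one, smul_mul_assoc]

/-- `e ▷ (y x) = z (k ▷ x) + q^{1/2} y (e ▷ x)` for `(y, z) = (a, b), (c, d)`. -/
lemma dE_ac_mul {y z : SUq2 q} (h0 : dE q y = z) (hk : ∀ n : ℤ, dK q n y = rt q ^ (-n) • y)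
    (x : SUq2 q) : dE q (y * x) = z * dK q 1 x + rt q • (y * dE q x) := by
  rw [dE_mul, h0, hk, neg_neg, zpow_one, smul_mul_assoc]

variable (q) in
/-- The span of the weight vectors. -/
def wtSpan : Submodule ℂ (SUq2 q) :=
  Submodule.span ℂ (Set.range fun p : ℕ × ℕ × ℕ => wtVec q p.1 p.2.1 p.2.2)

lemma wtVec_mem (i j n : ℕ) : wtVec q i j n ∈ wtSpan q := Submodule.subset_span ⟨(i, j, n), rfl⟩

lemma dE_mem {x : SUq2 q} (hx : x ∈ wtSpan q) : dE q x ∈ wtSpan q := by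
  induction hx using Submodule.span_induction with
  | mem x hx =>
    obtain ⟨p, rfl⟩ := hx
    change dE q (wtVec q _ _ _) ∈ _
    rw [← wtVec_succ]; exact wtVec_mem _ _ _
  | zero => simp
  | add x y _ _ hx hy => rw [map_add]; exact Submodule.add_mem _ hx hy
  | smul r x _ hx => rw [map_smul]; exact Submodule.smul_mem _ _ hx

/-- To multiply the weight vectors by a pair `(y, z)` of generators with `e ▷ y = z`, `e ▷ z = 0`
it is enough to do so for the lowest weight vectors. -/
lemma mul_wtVec_mem {y z : SUq2 q} (hy0 : dE q y = z) (hyk : ∀ n : ℤ, dK q n y = rt q ^ (-n) • y)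
    (hz0 : dE q z = 0) (hzk : ∀ n : ℤ, dK q n z = rt q ^ n • z) (i j : ℕ)
    (hy : y * lowVec q i j ∈ wtSpan q) (hz : z * lowVec q i j ∈ wtSpan q) (n : ℕ) :
    y * wtVec q i j n ∈ wtSpan q ∧ z * wtVec q i j n ∈ wtSpan q := by
  have hs := rt_ne q
  induction n with
  | zero => exact ⟨hy, hz⟩
  | succ n ih =>
    constructor
    · have h := dE_mem ih.1
      rw [dE_ac_mul hy0 hyk, dK_wtVec, mul_smul_comm, ← wtVec_succ] at h
      have h' := Submodule.sub_mem _ h (Submodule.smul_mem _ (rt q ^ (1 * (2 * n - (i + j)) : ℤ))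
        ih.2)
      rw [add_sub_cancel_left] at h'
      exact (Submodule.smul_mem_iff _ hs).1 h'
    · have h := dE_mem ih.2
      rw [dE_bd_mul hz0 hzk, ← wtVec_succ] at h
      exact (Submodule.smul_mem_iff _ (inv_ne_zero hs)).1 h

/-- Modulo weight vectors, `e ▷ (aⁱ⁺¹ cʲ)` is a multiple of `b aⁱ cʲ`; the factor is not zero because
all contributions to it are positive. -/
lemma b_mul_lowVec_mem (i j : ℕ) : gen q .b * lowVec q i j ∈ wtSpan q := by
  have hs := rt_ne q
  have hq := q_ne_zero q
  have H := gen_rel q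
  have hm := dE_mem (wtVec_mem (q := q) (i + 1) j 0)
  rw [wtVec_zero, lowVec, dE_mul, dE_pow_a, dK_pow, (dK_gen 1).2.2.1, dK_pow, (dK_gen _).1] at hm
  have hb : gen q .b * lowVec q i j =
      ((q : ℝ) : ℂ)⁻¹ ^ i • (gen q .a ^ i * gen q .b * gen q .c ^ j) := by
    rw [lowVec, ← mul_assoc, mul_pow_of_qcomm (ba_comm q), smul_mul_assoc]
  rw [hb]
  refine Submodule.smul_mem _ _ ?_
  cases j with
  | zero =>
    simp only [pow_zero, mul_one, dE_one, mul_zero, add_zero] at hm ⊢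
    exact (Submodule.smul_mem_iff _ (by exact_mod_cast (eCoef_pos i).ne')).1 hm
  | succ j =>
    have hcd : gen q .c ^ j * gen q .d = ((q : ℝ) : ℂ) ^ j • (gen q .d * gen q .c ^ j) := by
      rw [mul_pow_of_qcomm (dc_comm q), smul_smul, ← mul_pow, mul_inv_cancel₀ hq, one_pow, one_smul]
    have hcb : gen q .c * gen q .b * gen q .c ^ j = gen q .b * gen q .c ^ (j + 1) := by
      rw [← H.bc, mul_assoc, ← pow_succ']
    have e1 : gen q .a ^ (i + 1) * (gen q .c ^ j * gen q .d) = ((q : ℝ) : ℂ) ^ j •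
        (lowVec q i j + ((q : ℝ) : ℂ) • (gen q .a ^ i * gen q .b * gen q .c ^ (j + 1))) := by
      rw [hcd, mul_smul_comm, pow_succ, mul_assoc, ← mul_assoc (gen q .a) (gen q .d), H.ad,
        add_mul, one_mul, smul_mul_assoc, hcb, mul_add, mul_smul_comm, lowVec, mul_assoc]
    rw [dE_pow_c, smul_pow, smul_pow, smul_mul_smul_comm, smul_mul_smul_comm, e1] at hm
    have h2 := Submodule.sub_mem _ hm (Submodule.smul_mem _ (((rt q ^ (- -1 : ℤ)) ^ (i + 1) *
      (eCoef q j : ℂ)) * ((q : ℝ) : ℂ) ^ j) (wtVec_mem (q := q) i j 0))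
    -- `e ▷ a` and `e ▷ c` both contribute to the coefficient of `aⁱ b cʲ⁺¹`, the latter through
    -- `a d = 1 + q c b`
    have h3 : ((eCoef q i * (Real.sqrt q)⁻¹ ^ (j + 1) +
        Real.sqrt q ^ (i + 1) * eCoef q j * (q : ℝ) ^ (j + 1) : ℝ) : ℂ) •
        (gen q .a ^ i * gen q .b * gen q .c ^ (j + 1)) ∈ wtSpan q := by
      convert h2 using 1
      rw [wtVec_zero]
      push_cast
      simp only [show ((Real.sqrt q : ℝ) : ℂ) = rt q from rfl, smul_add, smul_smul, zpow_one,
        zpow_neg_one]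
      match_scalars <;> ring
    refine (Submodule.smul_mem_iff _ ?_).1 h3
    have h4 := Real.sqrt_pos.2 q.2.1
    have h5 := eCoef_pos (q := q) i
    have h6 := eCoef_pos (q := q) j
    have h7 := q.2.1
    exact_mod_cast (by positivity : (0 : ℝ) < eCoef q i * (Real.sqrt q)⁻¹ ^ (j + 1) +
        Real.sqrt q ^ (i + 1) * eCoef q j * (q : ℝ) ^ (j + 1)).ne'

lemma d_mul_lowVec_mem (i j : ℕ) : gen q .d * lowVec q i j ∈ wtSpan q := by
  have hq := q_ne_zero q
  have H := gen_rel q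
  cases i with
  | zero =>
    have hm := dE_mem (wtVec_mem (q := q) 0 (j + 1) 0)
    rw [wtVec_zero, lowVec, pow_zero, one_mul, dE_pow_c] at hm
    have hm' := (Submodule.smul_mem_iff _ (by exact_mod_cast (eCoef_pos j).ne')).1 hm
    rw [lowVec, pow_zero, one_mul, mul_pow_of_qcomm (dc_comm q)]
    exact Submodule.smul_mem _ _ hm'
  | succ i =>
    have e1 : gen q .d * lowVec q (i + 1) j = lowVec q i j +
        ((q : ℝ) : ℂ)⁻¹ • ((q : ℝ) : ℂ)⁻¹ ^ i • (gen q .b * lowVec q i (j + 1)) := by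
      rw [lowVec, pow_succ', ← mul_assoc, ← mul_assoc, H.da, add_mul, add_mul, one_mul, ← lowVec,
        smul_mul_assoc, smul_mul_assoc, mul_assoc (gen q .b), mul_pow_of_qcomm (ca_comm q),
        mul_smul_comm, smul_mul_assoc, lowVec, lowVec, pow_succ']
      simp only [mul_assoc]
    rw [e1]
    exact Submodule.add_mem _ (wtVec_mem i j 0) (Submodule.smul_mem _ _
      (Submodule.smul_mem _ _ (b_mul_lowVec_mem _ _)))

/-- The span of the weight vectors contains `1` and is stable under left multiplication by the
generators. -/
lemma wtSpan_eq_top : wtSpan q = ⊤ := by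
  have hA : ∀ i j n, gen q .a * wtVec q i j n ∈ wtSpan q ∧ gen q .b * wtVec q i j n ∈ wtSpan q := by
    intro i j n
    refine mul_wtVec_mem dE_gen.1 (fun n => (dK_gen n).1) dE_gen.2.1 (fun n => (dK_gen n).2.1)
      i j ?_ (b_mul_lowVec_mem i j) n
    rw [lowVec, ← mul_assoc, ← pow_succ']
    exact wtVec_mem (i + 1) j 0
  have hC : ∀ i j n, gen q .c * wtVec q i j n ∈ wtSpan q ∧ gen q .d * wtVec q i j n ∈ wtSpan q := by
    intro i j n
    refine mul_wtVec_mem dE_gen.2.2.1 (fun n => (dK_gen n).2.2.1) dE_gen.2.2.2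
      (fun n => (dK_gen n).2.2.2) i j ?_ (d_mul_lowVec_mem i j) n
    rw [lowVec, ← mul_assoc, mul_pow_of_qcomm (ca_comm q), smul_mul_assoc, mul_assoc, ← pow_succ']
    exact Submodule.smul_mem _ _ (wtVec_mem i (j + 1) 0)
  refine eq_top_of_gen_mul_mem _ (by rw [← lowVec_zero]; exact wtVec_mem 0 0 0) ?_
  intro s x hx
  induction hx using Submodule.span_induction with
  | mem x hx =>
    obtain ⟨⟨i, j, n⟩, rfl⟩ := hx
    cases s
    · exact (hA i j n).1
    · exact (hA i j n).2
    · exact (hC i j n).1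
    · exact (hC i j n).2
  | zero => simp
  | add x y _ _ hx hy => rw [mul_add]; exact Submodule.add_mem _ hx hy
  | smul r x _ hx => rw [mul_smul_comm]; exact Submodule.smul_mem _ _ hx

lemma dE_iterate_bd_mul {y : SUq2 q} (h0 : dE q y = 0) (hk : ∀ n : ℤ, dK q n y = rt q ^ n • y)
    (x : SUq2 q) (n : ℕ) : (dE q)^[n] (y * x) = (rt q)⁻¹ ^ n • (y * (dE q)^[n] x) := by
  induction n with
  | zero => simp
  | succ n ih =>
    rw [Function.iterate_succ_apply', ih, map_smul, dE_bd_mul h0 hk, smul_smul, ← pow_succ,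
      Function.iterate_succ_apply']

lemma dK_dE_iterate (m : ℤ) (x : SUq2 q) (n : ℕ) :
    dK q m ((dE q)^[n] x) = (rt q ^ (2 * m)) ^ n • (dE q)^[n] (dK q m x) := by
  induction n with
  | zero => simp
  | succ n ih =>
    rw [Function.iterate_succ_apply', dK_dE, ih, map_smul, smul_smul, ← pow_succ',
      Function.iterate_succ_apply']

lemma dE_iterate_add (x y : SUq2 q) (n : ℕ) :
    (dE q)^[n] (x + y) = (dE q)^[n] x + (dE q)^[n] y := by
  induction n generalizing x y with
  | zero => rfl
  | succ n ih => simp only [Function.iterate_succ_apply, map_add, ih]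

lemma dE_iterate_smul (r : ℂ) (x : SUq2 q) (n : ℕ) :
    (dE q)^[n] (r • x) = r • (dE q)^[n] x := by
  induction n generalizing x with
  | zero => rfl
  | succ n ih => simp only [Function.iterate_succ_apply, map_smul, ih]

/-- Multiplication by `a` or `c` raises the order of nilpotency of `e ▷` by at most one. -/
lemma dE_iterate_mul_eq_zero {y z : SUq2 q} (hy0 : dE q y = z)
    (hyk : ∀ n : ℤ, dK q n y = rt q ^ (-n) • y)
    (hz0 : dE q z = 0) (hzk : ∀ n : ℤ, dK q n z = rt q ^ n • z) (m : ℕ) :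
    ∀ x : SUq2 q, (dE q)^[m] x = 0 → (dE q)^[m + 1] (y * x) = 0 := by
  induction m with
  | zero => intro x hx; rw [Function.iterate_zero, id] at hx; simp [hx]
  | succ m ih =>
    intro x hx
    have h1 : (dE q)^[m + 1] (dK q 1 x) = 0 := by
      have := dK_dE_iterate 1 x (m + 1)
      rw [hx, map_zero, eq_comm, smul_eq_zero_iff_right (pow_ne_zero _ (zpow_ne_zero _ (rt_ne q)))]
        at this
      exact this
    rw [Function.iterate_succ_apply, dE_ac_mul hy0 hyk, dE_iterate_add, dE_iterate_bd_mul hz0 hzk,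
      h1, dE_iterate_smul, ih (dE q x) hx]
    simp

lemma wtVec_eq_zero (i j : ℕ) : wtVec q i j (i + j + 1) = 0 := by
  unfold wtVec
  induction i with
  | zero =>
    induction j with
    | zero => simp [lowVec, dE_one]
    | succ j ih =>
      have := dE_iterate_mul_eq_zero dE_gen.2.2.1 (fun n => (dK_gen n).2.2.1) dE_gen.2.2.2
        (fun n => (dK_gen n).2.2.2) _ _ ih
      rw [lowVec, pow_zero, one_mul] at this ⊢
      rwa [← pow_succ', show 0 + j + 1 + 1 = 0 + (j + 1) + 1 by ring] at this
  | succ i ih =>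
    have := dE_iterate_mul_eq_zero dE_gen.1 (fun n => (dK_gen n).1) dE_gen.2.1
      (fun n => (dK_gen n).2.1) _ _ ih
    rwa [lowVec, ← mul_assoc, ← pow_succ', show i + j + 1 + 1 = i + 1 + j + 1 by ring] at this

lemma wtVec_eq_zero_of_lt {i j n : ℕ} (h : i + j < n) : wtVec q i j n = 0 := by
  obtain ⟨k, rfl⟩ := Nat.exists_eq_add_of_lt h
  induction k with
  | zero => exact wtVec_eq_zero i j
  | succ k ih => rw [← add_assoc, add_right_comm, wtVec_succ, ih (by omega), map_zero]

/-! ### Monomials -/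

/-- The monomials `aⁱ bʲ cᵏ` and `dⁱ bʲ cᵏ`. -/
def monomials (q : Set.Ioo (0 : ℝ) 1) : Set (SUq2 q) :=
  (Set.range fun p : ℕ × ℕ × ℕ => gen q .a ^ p.1 * (gen q .b ^ p.2.1 * gen q .c ^ p.2.2)) ∪
    Set.range fun p : ℕ × ℕ × ℕ => gen q .d ^ p.1 * (gen q .b ^ p.2.1 * gen q .c ^ p.2.2)

lemma span_monomials : Submodule.span ℂ (monomials q) = ⊤ := by
  have H := gen_rel q
  have hq := q_ne_zero q
  have hA : ∀ i j k : ℕ, gen q .a ^ i * (gen q .b ^ j * gen q .c ^ k) ∈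
      Submodule.span ℂ (monomials q) :=
    fun i j k => Submodule.subset_span (Or.inl ⟨(i, j, k), rfl⟩)
  have hD : ∀ i j k : ℕ, gen q .d ^ i * (gen q .b ^ j * gen q .c ^ k) ∈
      Submodule.span ℂ (monomials q) :=
    fun i j k => Submodule.subset_span (Or.inr ⟨(i, j, k), rfl⟩)
  have cb : ∀ j : ℕ, gen q .c * gen q .b ^ j = gen q .b ^ j * gen q .c := fun j =>
    ((show Commute (gen q .c) (gen q .b) from H.bc.symm).pow_right j).eq
  have bd : ∀ i : ℕ, gen q .b * gen q .d ^ i = ((q : ℝ) : ℂ) ^ i • (gen q .d ^ i * gen q .b) :=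
    mul_pow_of_qcomm H.bd
  have cd : ∀ i : ℕ, gen q .c * gen q .d ^ i = ((q : ℝ) : ℂ) ^ i • (gen q .d ^ i * gen q .c) :=
    mul_pow_of_qcomm H.cd
  have hb : ∀ x ∈ monomials q, gen q .b * x ∈ Submodule.span ℂ (monomials q) := by
    rintro _ (⟨⟨i, j, k⟩, rfl⟩ | ⟨⟨i, j, k⟩, rfl⟩)
    · dsimp only
      rw [← mul_assoc, mul_pow_of_qcomm (ba_comm q), smul_mul_assoc, mul_assoc, ← mul_assoc _ _
        (gen q .c ^ k), ← pow_succ']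
      exact Submodule.smul_mem _ _ (hA _ _ _)
    · dsimp only
      rw [← mul_assoc, bd, smul_mul_assoc, mul_assoc, ← mul_assoc _ _
        (gen q .c ^ k), ← pow_succ']
      exact Submodule.smul_mem _ _ (hD _ _ _)
  have hc : ∀ x ∈ monomials q, gen q .c * x ∈ Submodule.span ℂ (monomials q) := by
    rintro _ (⟨⟨i, j, k⟩, rfl⟩ | ⟨⟨i, j, k⟩, rfl⟩)
    · dsimp only
      rw [← mul_assoc, mul_pow_of_qcomm (ca_comm q), smul_mul_assoc, mul_assoc, ← mul_assoc _ _
        (gen q .c ^ k), cb, mul_assoc, ← pow_succ']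
      exact Submodule.smul_mem _ _ (hA _ _ _)
    · dsimp only
      rw [← mul_assoc, cd, smul_mul_assoc, mul_assoc, ← mul_assoc _ _
        (gen q .c ^ k), cb, mul_assoc, ← pow_succ']
      exact Submodule.smul_mem _ _ (hD _ _ _)
  have lin : ∀ y, (∀ x ∈ monomials q, y * x ∈ Submodule.span ℂ (monomials q)) →
      ∀ x ∈ Submodule.span ℂ (monomials q), y * x ∈ Submodule.span ℂ (monomials q) := by
    intro y hy x hx
    induction hx using Submodule.span_induction with
    | mem x hx => exact hy x hx
    | zero => simp
    | add x y _ _ hx hy => rw [mul_add]; exact Submodule.add_mem _ hx hy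
    | smul r x _ hx => rw [mul_smul_comm]; exact Submodule.smul_mem _ _ hx
  refine eq_top_of_gen_mul_mem _ (by simpa using hA 0 0 0) fun s => lin _ ?_
  cases s
  · rintro _ (⟨⟨i, j, k⟩, rfl⟩ | ⟨⟨i, j, k⟩, rfl⟩)
    · dsimp only
      rw [← mul_assoc, ← pow_succ']
      exact hA _ _ _
    · cases i with
      | zero => simpa using hA 1 j k
      | succ i =>
        dsimp only
        rw [pow_succ', ← mul_assoc, ← mul_assoc (gen q .a) (gen q .d), H.ad, add_mul, one_mul,
          add_mul, smul_mul_assoc, smul_mul_assoc, mul_assoc (gen q .c * gen q .b),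
          mul_assoc (gen q .c)]
        exact Submodule.add_mem _ (hD _ _ _) (Submodule.smul_mem _ _
          (lin _ hc _ (hb _ (Or.inr ⟨(i, j, k), rfl⟩))))
  · exact hb
  · exact hc
  · rintro _ (⟨⟨i, j, k⟩, rfl⟩ | ⟨⟨i, j, k⟩, rfl⟩)
    · cases i with
      | zero => simpa using hD 1 j k
      | succ i =>
        dsimp only
        rw [pow_succ', ← mul_assoc, ← mul_assoc (gen q .d) (gen q .a), H.da, add_mul, one_mul,
          add_mul, smul_mul_assoc, smul_mul_assoc, mul_assoc (gen q .b * gen q .c),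
          mul_assoc (gen q .b)]
        exact Submodule.add_mem _ (hA _ _ _) (Submodule.smul_mem _ _
          (lin _ hb _ (hc _ (Or.inl ⟨(i, j, k), rfl⟩))))
    · dsimp only
      rw [← mul_assoc, ← pow_succ']
      exact hD _ _ _

/-! ### The regular representation on `ℕ × ℤ` -/

/-- The weighted shift `e_p ↦ w(p) e_{σ(p)}`. -/
def shiftOp (w : ℕ × ℤ → ℂ) (σ : ℕ × ℤ → ℕ × ℤ) : Module.End ℂ (ℕ × ℤ →₀ ℂ) :=
  Finsupp.linearCombination ℂ fun p => Finsupp.single (σ p) (w p)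

lemma shiftOp_single (w : ℕ × ℤ → ℂ) (σ : ℕ × ℤ → ℕ × ℤ) (p : ℕ × ℤ) (r : ℂ) :
    shiftOp w σ (Finsupp.single p r) = Finsupp.single (σ p) (r * w p) := by
  rw [shiftOp, Finsupp.linearCombination_single, Finsupp.smul_single, smul_eq_mul]

/-- `√(1 - q^{2n})`. -/
def rootWt (q : Set.Ioo (0 : ℝ) 1) (n : ℕ) : ℝ := Real.sqrt (1 - (q : ℝ) ^ (2 * n))

lemma rootWt_zero : rootWt q 0 = 0 := by simp [rootWt]

lemma rootWt_sq (n : ℕ) : (rootWt q n : ℂ) * rootWt q n = 1 - ((q : ℝ) : ℂ) ^ (2 * n) := by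
  have : rootWt q n * rootWt q n = 1 - (q : ℝ) ^ (2 * n) :=
    Real.mul_self_sqrt (sub_nonneg.2 (pow_le_one₀ q.2.1.le q.2.2.le))
  exact_mod_cast this

lemma rootWt_pos {n : ℕ} (hn : n ≠ 0) : 0 < rootWt q n :=
  Real.sqrt_pos.2 (sub_pos.2 (pow_lt_one₀ q.2.1.le q.2.2 (by omega)))

/-- The operators of the generators on the basis vectors `e_{n,k}`. The truncated subtraction for
`a` does no harm, since the weight `rootWt q 0` is zero. -/
def repGen (q : Set.Ioo (0 : ℝ) 1) : SUq2Gen → Module.End ℂ (ℕ × ℤ →₀ ℂ)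
  | .a => shiftOp (fun p => rootWt q p.1) fun p => (p.1 - 1, p.2)
  | .b => shiftOp (fun p => -((q : ℝ) : ℂ) * ((q : ℝ) : ℂ) ^ p.1) fun p => (p.1, p.2 - 1)
  | .c => shiftOp (fun p => ((q : ℝ) : ℂ) ^ p.1) fun p => (p.1, p.2 + 1)
  | .d => shiftOp (fun p => rootWt q (p.1 + 1)) fun p => (p.1 + 1, p.2)

/-- The representation of `O(SU_q(2))` by weighted shifts on the finitely supported functions on
`ℕ × ℤ`: `a e_{n,k} = √(1 - q^{2n}) e_{n-1,k}` and `c e_{n,k} = qⁿ e_{n,k+1}`. -/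
def rep (q : Set.Ioo (0 : ℝ) 1) : SUq2 q →ₐ[ℂ] Module.End ℂ (ℕ × ℤ →₀ ℂ) :=
  lift (repGen q) (by
    have hq := q_ne_zero q
    have h2 := fun n => rootWt_sq (q := q) n
    constructor <;> refine Finsupp.lhom_ext fun p r => ?_ <;> obtain ⟨n, k⟩ := p <;>
      cases n <;>
      simp [repGen, shiftOp_single, mul_assoc, rootWt_zero, h2, Module.End.mul_apply,
        Finsupp.smul_single, ← Finsupp.single_add, -Finsupp.single_mul,
        -Finsupp.single_neg]
    all_goals first
      | (congr 1; ring1)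
      | (congr 1; field_simp; ring1)
      | (field_simp; simp))

lemma rep_gen (s : SUq2Gen) : rep q (gen q s) = repGen q s := by
  rw [rep, lift_gen]

/-- The matrix coefficients of `rep`. -/
def coef (x : SUq2 q) (p r : ℕ × ℤ) : ℂ := rep q x (Finsupp.single r 1) p

lemma coef_add (x y : SUq2 q) (p r : ℕ × ℤ) : coef (x + y) p r = coef x p r + coef y p r := by
  simp [coef]

lemma coef_smul (c : ℂ) (x : SUq2 q) (p r : ℕ × ℤ) : coef (c • x) p r = c * coef x p r := by
  simp [coef]

lemma coef_one (p r : ℕ × ℤ) : coef (1 : SUq2 q) p r = Finsupp.single r 1 p := by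
  simp [coef]

lemma coef_mul' (x y : SUq2 q) (p r : ℕ × ℤ) : coef (x * y) p r =
    ∑ t ∈ (rep q y (Finsupp.single r 1)).support, coef x p t * coef y t r := by
  have : rep q (x * y) (Finsupp.single r 1) = rep q x (rep q y (Finsupp.single r 1)) := by
    rw [map_mul]; rfl
  rw [coef, this]
  conv_lhs => rw [← Finsupp.sum_single (rep q y (Finsupp.single r 1)), Finsupp.sum, map_sum,
    Finsupp.finsetSum_apply]
  refine Finset.sum_congr rfl fun t _ => ?_
  rw [coef, coef, ← mul_one ((rep q y (Finsupp.single r 1)) t), ← smul_eq_mul,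
    ← Finsupp.smul_single, map_smul, Finsupp.smul_apply, smul_eq_mul, smul_eq_mul, mul_one, mul_comm]

lemma coef_support_finite (y : SUq2 q) (r : ℕ × ℤ) : {t | coef y t r ≠ 0}.Finite :=
  (rep q y (Finsupp.single r 1)).hasFiniteSupport

lemma coef_mul (x y : SUq2 q) (p r : ℕ × ℤ) :
    coef (x * y) p r = ∑ᶠ t, coef x p t * coef y t r := by
  rw [coef_mul', finsum_eq_sum_of_support_subset]
  intro t ht
  simp only [Function.mem_support, Finset.mem_coe, Finsupp.mem_support_iff] at ht ⊢
  exact right_ne_zero_of_mul ht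

/-- `rep` is a `*`-representation for the standard inner product on the finitely supported
functions. -/
lemma coef_star (x : SUq2 q) (p r : ℕ × ℤ) : coef (star x) p r = (starRingEnd ℂ) (coef x r p) := by
  have hq := q_ne_zero q
  induction x using gen_induction generalizing p r with
  | hs c =>
    rw [star_smul, star_one, coef_smul, coef_smul, coef_one, coef_one, map_mul]
    congr 1
    simp only [Finsupp.single_apply, eq_comm (a := p)]
    split_ifs <;> simp
  | hg s =>
    obtain ⟨n, k⟩ := p
    obtain ⟨m, l⟩ := r
    cases s <;> rw [star_gen, starGen]
    · simp only [coef, rep_gen, repGen, shiftOp_single, Finsupp.single_apply, Prod.mk.injEq]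
      rcases n with _ | n
      · simp [rootWt_zero]
      · by_cases h : n = m ∧ k = l
        · obtain ⟨rfl, rfl⟩ := h; simp
        · rw [if_neg, if_neg, map_zero] <;> rintro ⟨h1, h2⟩ <;> exact h ⟨by omega, by omega⟩
    · rw [coef_smul]
      simp only [coef, rep_gen, repGen, shiftOp_single, Finsupp.single_apply,
        Prod.mk.injEq]
      by_cases h : n = m ∧ k = l + 1
      · obtain ⟨rfl, rfl⟩ := h; simp
      · rw [if_neg, if_neg, map_zero, mul_zero] <;> rintro ⟨h1, h2⟩ <;>
          exact h ⟨by omega, by omega⟩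
    · rw [coef_smul]
      simp only [coef, rep_gen, repGen, shiftOp_single, Finsupp.single_apply,
        Prod.mk.injEq]
      by_cases h : n = m ∧ k = l - 1
      · obtain ⟨rfl, rfl⟩ := h; simp [hq]
      · rw [if_neg, if_neg, map_zero, mul_zero] <;> rintro ⟨h1, h2⟩ <;>
          exact h ⟨by omega, by omega⟩
    · simp only [coef, rep_gen, repGen, shiftOp_single, Finsupp.single_apply, Prod.mk.injEq]
      rcases m with _ | m
      · simp [rootWt_zero]
      · by_cases h : n = m ∧ k = l
        · obtain ⟨rfl, rfl⟩ := h; simp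
        · rw [if_neg, if_neg, map_zero] <;> rintro ⟨h1, h2⟩ <;> exact h ⟨by omega, by omega⟩
  | ha x y hx hy => rw [star_add, coef_add, coef_add, hx, hy, map_add]
  | hm x y hx hy =>
    rw [star_mul, coef_mul, coef_mul]
    have hfin : (Function.support fun t => coef x r t * coef y t p).Finite :=
      (coef_support_finite y p).subset fun t ht => right_ne_zero_of_mul ht
    have := (starRingEnd ℂ : ℂ →+* ℂ).toAddMonoidHom.map_finsum hfin
    refine Eq.trans ?_ this.symm
    refine finsum_congr fun t => ?_
    rw [hx, hy, mul_comm]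
    exact (map_mul (starRingEnd ℂ) _ _).symm

/-- The squared norm of the column `x e_r`. -/
def colNorm (x : SUq2 q) (r : ℕ × ℤ) : ℝ :=
  ∑ t ∈ (rep q x (Finsupp.single r 1)).support, ‖coef x t r‖ ^ 2

lemma coef_star_mul_self (x : SUq2 q) (r : ℕ × ℤ) : coef (star x * x) r r = (colNorm x r : ℂ) := by
  rw [coef_mul', colNorm]
  push_cast
  refine Finset.sum_congr rfl fun t _ => ?_
  rw [coef_star, Complex.conj_mul']

lemma colNorm_nonneg (x : SUq2 q) (r : ℕ × ℤ) : 0 ≤ colNorm x r :=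
  Finset.sum_nonneg fun _ _ => by positivity

lemma colNorm_pos {x : SUq2 q} {t r : ℕ × ℤ} (h : coef x t r ≠ 0) : 0 < colNorm x r :=
  Finset.sum_pos' (fun _ _ => by positivity) ⟨t, Finsupp.mem_support_iff.2 h, by positivity⟩

/-! ### Bidegrees in the regular representation -/

/-- `x` shifts the basis vectors of `ℕ × ℤ` by `(r, s)`. -/
def HasDeg (x : SUq2 q) (r s : ℤ) : Prop :=
  ∀ p p' : ℕ × ℤ, coef x p' p ≠ 0 → (p'.1 : ℤ) = p.1 + r ∧ p'.2 = p.2 + s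

lemma HasDeg.mul {x y : SUq2 q} {r s r' s' : ℤ} (hx : HasDeg x r s) (hy : HasDeg y r' s') :
    HasDeg (x * y) (r + r') (s + s') := by
  intro p p' h
  rw [coef_mul'] at h
  obtain ⟨t, -, ht⟩ := Finset.exists_ne_zero_of_sum_ne_zero h
  have h1 := hx _ _ (left_ne_zero_of_mul ht)
  have h2 := hy _ _ (right_ne_zero_of_mul ht)
  constructor
  · rw [h1.1, h2.1]; ring
  · rw [h1.2, h2.2]; ring

lemma HasDeg.add {x y : SUq2 q} {r s : ℤ} (hx : HasDeg x r s) (hy : HasDeg y r s) :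
    HasDeg (x + y) r s := by
  intro p p' h
  rw [coef_add] at h
  by_cases h1 : coef x p' p = 0
  · rw [h1, zero_add] at h; exact hy _ _ h
  · exact hx _ _ h1

lemma HasDeg.smul {x : SUq2 q} {r s : ℤ} (hx : HasDeg x r s) (c : ℂ) : HasDeg (c • x) r s := by
  intro p p' h
  rw [coef_smul] at h
  exact hx _ _ (right_ne_zero_of_mul h)

lemma HasDeg.zero (r s : ℤ) : HasDeg (0 : SUq2 q) r s := by
  intro p p' h; simp [coef] at h

lemma HasDeg.one : HasDeg (1 : SUq2 q) 0 0 := by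
  intro p p' h
  rw [coef_one, Finsupp.single_apply] at h
  split_ifs at h with h1
  · subst h1; simp
  · exact absurd rfl h

lemma hasDeg_gen : HasDeg (gen q .a) (-1) 0 ∧ HasDeg (gen q .b) 0 (-1) ∧
    HasDeg (gen q .c) 0 1 ∧ HasDeg (gen q .d) 1 0 := by
  refine ⟨?_, ?_, ?_, ?_⟩ <;> rintro ⟨n, k⟩ ⟨m, l⟩ h <;>
    simp only [coef, rep_gen, repGen, shiftOp_single, Finsupp.single_apply, Prod.mk.injEq] at h <;>
    split_ifs at h with h1
  any_goals exact absurd rfl h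
  · cases n with
    | zero => simp [rootWt_zero] at h
    | succ n => obtain ⟨rfl, rfl⟩ := h1; simp
  all_goals obtain ⟨rfl, rfl⟩ := h1; simp [sub_eq_add_neg]

/-- `x` and `e ▷ x` are homogeneous of the bidegrees `(r, s)` and `(r + 1, s - 1)`, and `x` has the
weight of `(r, s)` for `k`. -/
structure IsHomog (x : SUq2 q) (r s : ℤ) : Prop where
  deg : HasDeg x r s
  deg_dE : HasDeg (dE q x) (r + 1) (s - 1)
  wt : ∀ n : ℤ, dK q n x = rt q ^ (n * (r - s)) • x

lemma IsHomog.mul {x y : SUq2 q} {r s r' s' : ℤ} (hx : IsHomog x r s) (hy : IsHomog y r' s') :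
    IsHomog (x * y) (r + r') (s + s') where
  deg := hx.deg.mul hy.deg
  deg_dE := by
    rw [dE_mul, hy.wt, hx.wt]
    refine HasDeg.add ?_ ?_
    · convert (hx.deg_dE.mul (hy.deg.smul _)) using 1 <;> ring
    · convert ((hx.deg.smul _).mul hy.deg_dE) using 1 <;> ring
  wt n := by
    rw [dK_mul, hx.wt, hy.wt, smul_mul_smul_comm, ← zpow_add₀ (rt_ne q)]
    congr 2; ring

lemma IsHomog.pow {x : SUq2 q} {r s : ℤ} (hx : IsHomog x r s) (n : ℕ) :
    IsHomog (x ^ n) (n * r) (n * s) := by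
  induction n with
  | zero =>
    refine ⟨by simpa using HasDeg.one, by rw [pow_zero, dE_one]; exact HasDeg.zero _ _, ?_⟩
    intro n; simp [dK_one]
  | succ n ih =>
    rw [pow_succ]
    convert ih.mul hx using 1 <;> push_cast <;> ring

lemma isHomog_gen : IsHomog (gen q .a) (-1) 0 ∧ IsHomog (gen q .b) 0 (-1) ∧
    IsHomog (gen q .c) 0 1 ∧ IsHomog (gen q .d) 1 0 := by
  have h := hasDeg_gen (q := q)
  refine ⟨⟨h.1, ?_, ?_⟩, ⟨h.2.1, ?_, ?_⟩, ⟨h.2.2.1, ?_, ?_⟩, ⟨h.2.2.2, ?_, ?_⟩⟩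
  · rw [dE_gen.1]; exact h.2.1
  · intro n; rw [(dK_gen n).1]; congr 2; ring
  · rw [dE_gen.2.1]; exact HasDeg.zero _ _
  · intro n; rw [(dK_gen n).2.1]; congr 2; ring
  · rw [dE_gen.2.2.1]; exact h.2.2.2
  · intro n; rw [(dK_gen n).2.2.1]; congr 2; ring
  · rw [dE_gen.2.2.2]; exact HasDeg.zero _ _
  · intro n; rw [(dK_gen n).2.2.2]; congr 2; ring

lemma isHomog_a_monomial (i j k : ℕ) :
    IsHomog (gen q .a ^ i * (gen q .b ^ j * gen q .c ^ k)) (-i) (k - j) := by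
  convert (isHomog_gen.1.pow i).mul ((isHomog_gen.2.1.pow j).mul (isHomog_gen.2.2.1.pow k)) using 1
    <;> ring

lemma isHomog_d_monomial (i j k : ℕ) :
    IsHomog (gen q .d ^ i * (gen q .b ^ j * gen q .c ^ k)) i (k - j) := by
  convert (isHomog_gen.2.2.2.pow i).mul
    ((isHomog_gen.2.1.pow j).mul (isHomog_gen.2.2.1.pow k)) using 1 <;> ring

/-! ### The Haar functional -/

/-- The `n`-th diagonal term of the Haar functional. -/
def haarTerm (x : SUq2 q) (n : ℕ) : ℂ := ((q : ℝ) : ℂ) ^ (2 * n) * coef x (n, 0) (n, 0)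

lemma haarTerm_eq_zero {x : SUq2 q} {r s : ℤ} (hx : HasDeg x r s) (h : r ≠ 0 ∨ s ≠ 0) :
    haarTerm x = 0 := by
  ext n
  rw [haarTerm]
  by_cases h0 : coef x (n, 0) (n, 0) = 0
  · rw [h0, mul_zero]; rfl
  · have := hx _ _ h0
    simp only at this
    omega

lemma coef_bc_pow (j : ℕ) (n : ℕ) :
    coef ((gen q .b * gen q .c) ^ j) (n, 0) (n, 0) =
      (-((q : ℝ) : ℂ) * ((q : ℝ) : ℂ) ^ (2 * n)) ^ j := by
  have h : rep q (gen q .b * gen q .c) (Finsupp.single (n, 0) 1) =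
      (-((q : ℝ) : ℂ) * ((q : ℝ) : ℂ) ^ (2 * n)) • Finsupp.single (n, 0) 1 := by
    rw [map_mul, Module.End.mul_apply, rep_gen, rep_gen, repGen, repGen, shiftOp_single,
      shiftOp_single, Finsupp.smul_single]
    simp only [smul_eq_mul, zero_add]
    congr 1; ring
  rw [coef, map_pow]
  have h2 : ∀ j : ℕ, ((rep q (gen q .b * gen q .c)) ^ j) (Finsupp.single ((n : ℕ), (0 : ℤ)) 1) =
      (-((q : ℝ) : ℂ) * ((q : ℝ) : ℂ) ^ (2 * n)) ^ j • Finsupp.single (n, 0) 1 := by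
    intro j
    induction j with
    | zero => simp
    | succ j ih => rw [pow_succ', Module.End.mul_apply, ih, map_smul, h, smul_smul, ← pow_succ]
  rw [h2]; simp

lemma norm_q_pow_lt_one (j : ℕ) : ‖((q : ℝ) : ℂ) ^ (2 * (j + 1))‖ < 1 := by
  rw [norm_pow, Complex.norm_real, Real.norm_of_nonneg q.2.1.le]
  exact pow_lt_one₀ q.2.1.le q.2.2 (by omega)

lemma hasSum_haarTerm_bc (j : ℕ) : HasSum (haarTerm ((gen q .b * gen q .c) ^ j))
    ((-((q : ℝ) : ℂ)) ^ j * (1 - ((q : ℝ) : ℂ) ^ (2 * (j + 1)))⁻¹) := by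
  refine ((hasSum_geometric_of_norm_lt_one (norm_q_pow_lt_one (q := q) j)).mul_left
    ((-((q : ℝ) : ℂ)) ^ j)).congr_fun ?_
  intro n
  rw [haarTerm, coef_bc_pow, mul_pow, ← pow_mul, ← pow_mul]
  ring

lemma bc_pow (j : ℕ) : gen q .b ^ j * gen q .c ^ j = (gen q .b * gen q .c) ^ j :=
  ((show Commute (gen q .b) (gen q .c) from (gen_rel q).bc).mul_pow j).symm

lemma summable_haarTerm (x : SUq2 q) : Summable (haarTerm x) := by
  have hx : x ∈ Submodule.span ℂ (monomials q) := by rw [span_monomials]; trivial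
  induction hx using Submodule.span_induction with
  | mem x hx =>
    have key : ∀ {y : SUq2 q} {i j k : ℕ} {r : ℤ}, HasDeg y r (k - j) → (r = 0 → i = 0) →
        (i = 0 → y = gen q .b ^ j * gen q .c ^ k) → Summable (haarTerm y) := by
      intro y i j k r hy hr h0
      by_cases h : r ≠ 0 ∨ (k : ℤ) - j ≠ 0
      · rw [haarTerm_eq_zero hy h]; exact summable_zero
      · push Not at h
        obtain rfl : k = j := by omega
        rw [h0 (hr h.1), bc_pow]
        exact (hasSum_haarTerm_bc k).summable
    obtain ⟨⟨i, j, k⟩, rfl⟩ | ⟨⟨i, j, k⟩, rfl⟩ := hx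
    · exact key (isHomog_a_monomial i j k).deg (i := i) (by omega) (by rintro rfl; simp)
    · exact key (isHomog_d_monomial i j k).deg (i := i) (by omega) (by rintro rfl; simp)
  | zero => exact summable_zero.congr fun n => by simp [haarTerm, coef]
  | add x y _ _ hx hy => exact (hx.add hy).congr fun n => by simp only [haarTerm, coef_add]; ring
  | smul c x _ hx => exact (hx.mul_left c).congr fun n => by simp only [haarTerm, coef_smul]; ring

/-- The Haar functional `x ↦ (1 - q²) ∑ₙ q²ⁿ ⟨e_{n,0}, x e_{n,0}⟩`. -/
def haar (q : Set.Ioo (0 : ℝ) 1) : SUq2 q →ₗ[ℂ] ℂ where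
  toFun x := (1 - ((q : ℝ) : ℂ) ^ 2) * ∑' n, haarTerm x n
  map_add' x y := by
    rw [← mul_add, ← (summable_haarTerm x).tsum_add (summable_haarTerm y)]
    congr 2; ext n; simp only [haarTerm, coef_add]; ring
  map_smul' c x := by
    rw [RingHom.id_apply, smul_eq_mul, mul_left_comm, ← tsum_mul_left (a := c)]
    congr 1; refine tsum_congr fun n => ?_; simp only [haarTerm, coef_smul]; ring

lemma haar_apply (x : SUq2 q) : haar q x = (1 - ((q : ℝ) : ℂ) ^ 2) * ∑' n, haarTerm x n := rfl

lemma haar_eq_zero {x : SUq2 q} {r s : ℤ} (hx : HasDeg x r s) (h : r ≠ 0 ∨ s ≠ 0) :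
    haar q x = 0 := by
  rw [haar_apply, haarTerm_eq_zero hx h]; simp

lemma haar_bc_pow (j : ℕ) : haar q ((gen q .b * gen q .c) ^ j) =
    (1 - ((q : ℝ) : ℂ) ^ 2) * ((-((q : ℝ) : ℂ)) ^ j * (1 - ((q : ℝ) : ℂ) ^ (2 * (j + 1)))⁻¹) := by
  rw [haar_apply, (hasSum_haarTerm_bc j).tsum_eq]

lemma one_sub_q_pow_ne (j : ℕ) : 1 - ((q : ℝ) : ℂ) ^ (2 * (j + 1)) ≠ 0 := by
  intro h
  have := norm_q_pow_lt_one (q := q) j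
  rw [← sub_eq_zero.1 h, norm_one] at this
  exact lt_irrefl _ this

lemma haar_one : haar q 1 = 1 := by
  have := haar_bc_pow (q := q) 0
  rw [pow_zero, pow_zero, one_mul] at this
  rw [this]
  exact mul_inv_cancel₀ (one_sub_q_pow_ne 0)

lemma haar_dK (n : ℤ) (x : SUq2 q) : haar q (dK q n x) = haar q x := by
  suffices H : haar q ∘ₗ dK q n = haar q from DFunLike.congr_fun H x
  refine LinearMap.ext_on span_monomials ?_
  have key : ∀ {y : SUq2 q} {r s : ℤ}, IsHomog y r s → (haar q ∘ₗ dK q n) y = haar q y := by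
    intro y r s hy
    rw [LinearMap.comp_apply, hy.wt, map_smul]
    by_cases h : r ≠ 0 ∨ s ≠ 0
    · rw [haar_eq_zero hy.deg h, smul_zero]
    · push Not at h
      rw [h.1, h.2]; simp
  rintro _ (⟨⟨i, j, k⟩, rfl⟩ | ⟨⟨i, j, k⟩, rfl⟩)
  · exact key (isHomog_a_monomial i j k)
  · exact key (isHomog_d_monomial i j k)

lemma eCoef_eq (i : ℕ) : (eCoef q i : ℂ) =
    (rt q ^ (3 * i))⁻¹ * (1 - ((q : ℝ) : ℂ) ^ (2 * (i + 1))) / (1 - ((q : ℝ) : ℂ) ^ 2) := by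
  have h1 := one_sub_q_pow_ne (q := q) 0
  have hs := rt_ne q
  rw [zero_add, mul_one] at h1
  induction i with
  | zero => simp [eCoef, h1]
  | succ i ih =>
    rw [eCoef]
    push_cast
    rw [ih, ← rt, show 3 * (i + 1) = 3 * i + 3 by ring, show 2 * (i + 1 + 1) = 2 * i + 4 by ring,
      show 2 * (i + 1) = 2 * i + 2 by ring]
    rw [q_eq_rt, ← pow_mul] at h1
    rw [q_eq_rt]
    field_simp
    ring

/-- The Haar functional kills `e ▷ (a bʲ cʲ⁺¹)`. -/
lemma haar_dE_abc (j : ℕ) : haar q (dE q (gen q .a * (gen q .b ^ j * gen q .c ^ (j + 1)))) = 0 := by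
  have H := gen_rel q
  have hs := rt_ne q
  have hq := q_ne_zero q
  have hb : dE q (gen q .b ^ j) = 0 := by
    induction j with
    | zero => simp [dE_one]
    | succ j ih => rw [pow_succ', dE_mul, ih, dE_gen.2.1]; simp
  have bcb : gen q .b * (gen q .b ^ j * gen q .c ^ (j + 1)) = (gen q .b * gen q .c) ^ (j + 1) := by
    rw [← mul_assoc, ← pow_succ', bc_pow]
  have cd : gen q .c ^ j * gen q .d = ((q : ℝ) : ℂ) ^ j • (gen q .d * gen q .c ^ j) := by
    rw [mul_pow_of_qcomm (dc_comm q), smul_smul, ← mul_pow, mul_inv_cancel₀ hq, one_pow, one_smul]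
  have db : gen q .d * gen q .b = ((q : ℝ) : ℂ)⁻¹ • (gen q .b * gen q .d) := by
    rw [H.bd, smul_smul, inv_mul_cancel₀ hq, one_smul]
  have bd : gen q .b ^ j * gen q .d = ((q : ℝ) : ℂ) ^ j • (gen q .d * gen q .b ^ j) := by
    rw [mul_pow_of_qcomm db, smul_smul, ← mul_pow, mul_inv_cancel₀ hq, one_pow, one_smul]
  have abcd : gen q .a * (gen q .b ^ j * (gen q .c ^ j * gen q .d)) =
      ((q : ℝ) : ℂ) ^ (2 * j) • ((gen q .b * gen q .c) ^ j +
        ((q : ℝ) : ℂ) • (gen q .b * gen q .c) ^ (j + 1)) := by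
    rw [cd, mul_smul_comm, mul_smul_comm, ← mul_assoc (gen q .b ^ j), bd, smul_mul_assoc,
      mul_smul_comm, smul_smul, mul_assoc, ← mul_assoc (gen q .a), H.ad, bc_pow, add_mul, one_mul,
      smul_mul_assoc, ← H.bc, ← pow_succ']
    congr 1; ring
  have e1 : dE q (gen q .a * (gen q .b ^ j * gen q .c ^ (j + 1))) =
      (rt q)⁻¹ • (gen q .b * gen q .c) ^ (j + 1) +
      (rt q * (rt q ^ j)⁻¹ * (eCoef q j : ℂ) * ((q : ℝ) : ℂ) ^ (2 * j)) •
        ((gen q .b * gen q .c) ^ j + ((q : ℝ) : ℂ) • (gen q .b * gen q .c) ^ (j + 1)) := by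
    rw [dE_ac_mul dE_gen.1 (fun n => (dK_gen n).1), dE_mul, hb, zero_mul, zero_add, dE_pow_c,
      dK_mul, dK_pow, dK_pow, dK_pow, (dK_gen _).2.1, (dK_gen _).2.1, (dK_gen _).2.2.1,
      smul_pow, smul_pow, smul_pow, smul_mul_smul_comm, smul_mul_smul_comm, mul_smul_comm,
      mul_smul_comm, abcd, bcb, smul_smul, smul_smul]
    congr 2
    · rw [zpow_one, zpow_neg_one, pow_succ, ← mul_assoc, ← mul_pow, mul_inv_cancel₀ hs, one_pow,
        one_mul]
    · rw [zpow_neg_one, inv_pow]; ring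
  have h1 := one_sub_q_pow_ne (q := q) 0
  have h2 := one_sub_q_pow_ne (q := q) j
  have h3 := one_sub_q_pow_ne (q := q) (j + 1)
  rw [e1, map_add, map_smul, map_smul, map_add, map_smul, haar_bc_pow, haar_bc_pow, eCoef_eq]
  simp only [smul_eq_mul]
  rw [show 2 * (j + 1 + 1) = 2 * j + 4 by ring] at h3 ⊢
  rw [show 2 * (j + 1) = 2 * j + 2 by ring] at h2 ⊢
  rw [zero_add, mul_one] at h1
  rw [q_eq_rt] at h1 h2 h3 ⊢
  field_simp
  ring

/-- By bidegree only the monomials `a bʲ cʲ⁺¹` can contribute. -/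
lemma haar_dE (x : SUq2 q) : haar q (dE q x) = 0 := by
  suffices H : haar q ∘ₗ dE q = 0 from DFunLike.congr_fun H x
  refine LinearMap.ext_on span_monomials ?_
  rintro _ (⟨⟨i, j, k⟩, rfl⟩ | ⟨⟨i, j, k⟩, rfl⟩)
  · by_cases h : (-i + 1 : ℤ) ≠ 0 ∨ ((k : ℤ) - j - 1) ≠ 0
    · exact haar_eq_zero (isHomog_a_monomial i j k).deg_dE h
    · push Not at h
      obtain rfl : i = 1 := by omega
      obtain rfl : k = j + 1 := by omega
      change haar q (dE q (gen q .a ^ 1 * (gen q .b ^ j * gen q .c ^ (j + 1)))) = 0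
      rw [pow_one]
      exact haar_dE_abc j
  · exact haar_eq_zero (isHomog_d_monomial i j k).deg_dE (by omega)

/-- Both sides vanish on `eⁿ ▷ (aⁱ cʲ)` unless `i = j = n = 0`. -/
lemma haar_left_inv (x : SUq2 q) : leftAct (haar q) x = haar q x • (1 : SUq2 q) := by
  suffices H : leftAct (haar q) = LinearMap.smulRight (haar q) 1 from DFunLike.congr_fun H x
  refine LinearMap.ext_on wtSpan_eq_top ?_
  rintro _ ⟨⟨i, j, n⟩, rfl⟩
  dsimp only
  rw [LinearMap.smulRight_apply]
  cases n with
  | zero =>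
    rw [wtVec_zero]
    by_cases h : i + j = 0
    · obtain ⟨rfl, rfl⟩ : i = 0 ∧ j = 0 := by omega
      rw [lowVec_zero, leftAct_one]
    · -- the weight of `aⁱ cʲ` under `k` is `q^{-(i+j)/2} ≠ 1`
      have hne : rt q ^ (-1 * (i + j) : ℤ) ≠ 1 := by
        have h0 : 0 < (Real.sqrt q) := Real.sqrt_pos.2 q.2.1
        have h1 : (Real.sqrt q) < 1 := by
          rw [Real.sqrt_lt' one_pos]; simpa using q.2.2
        have h2 : (Real.sqrt q) ^ (i + j) < 1 := pow_lt_one₀ h0.le h1 h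
        rw [neg_one_mul, zpow_neg, Ne, inv_eq_one]
        have h3 : rt q ^ ((i : ℤ) + j) = ((Real.sqrt q ^ (i + j) : ℝ) : ℂ) := by
          rw [rt]; push_cast; norm_cast
        rw [h3]
        exact_mod_cast h2.ne
      have e1 : haar q (lowVec q i j) = 0 := by
        have := haar_dK 1 (lowVec q i j)
        rw [dK_lowVec, map_smul, smul_eq_mul] at this
        by_contra h0
        exact hne (mul_right_cancel₀ h0 (this.trans (one_mul _).symm))
      have e2 : leftAct (haar q) (lowVec q i j) = 0 := by
        have := leftAct_leftAct (haar q) (pairK q 1).toLinearMap (lowVec q i j)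
        rw [show haar q ∘ₗ leftAct (pairK q 1).toLinearMap = haar q from
          LinearMap.ext (haar_dK 1)] at this
        change leftAct (haar q) (dK q 1 _) = _ at this
        rw [dK_lowVec, map_smul] at this
        by_contra h0
        have h1 : (rt q ^ (-1 * (i + j) : ℤ) - 1) • leftAct (haar q) (lowVec q i j) = 0 := by
          rw [sub_smul, this, one_smul, sub_self]
        rcases smul_eq_zero.1 h1 with h2 | h2
        · exact hne (sub_eq_zero.1 h2)
        · exact h0 h2
      rw [e1, e2, zero_smul]
  | succ n =>
    rw [wtVec_succ, haar_dE, zero_smul]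
    have := leftAct_leftAct (haar q) (pairE q) (wtVec q i j n)
    rw [show haar q ∘ₗ leftAct (pairE q) = 0 from LinearMap.ext haar_dE] at this
    refine this.trans ?_
    rw [leftAct]; simp

/-- A left invariant and a right invariant functional agree once they are normalized. -/
lemma eq_of_left_right_inv {u v : SUq2 q →ₗ[ℂ] ℂ} (hu : u 1 = 1) (hv : v 1 = 1)
    (hl : ∀ x, leftAct u x = u x • (1 : SUq2 q)) (hr : ∀ x, rightAct v x = v x • (1 : SUq2 q)) :
    u = v := by
  ext x
  have := apply_leftAct v u x
  rwa [hl, hr, map_smul, map_smul, hu, hv, smul_eq_mul, smul_eq_mul, mul_one, mul_one] at this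

/-- The composition with the flip is right invariant, hence equal to the Haar functional. -/
lemma haar_right_inv (x : SUq2 q) : rightAct (haar q) x = haar q x • (1 : SUq2 q) := by
  have hr : ∀ x, rightAct (haar q ∘ₗ (flip q).toLinearMap) x =
      (haar q ∘ₗ (flip q).toLinearMap) x • (1 : SUq2 q) := by
    intro x
    have := flip_leftAct (haar q) (flip q x)
    rw [flip_flip, haar_left_inv, map_smul, map_one] at this
    exact this.symm
  have h1 : (haar q ∘ₗ (flip q).toLinearMap) 1 = 1 := by simp [haar_one]
  have := eq_of_left_right_inv haar_one h1 haar_left_inv hr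
  rw [this]
  exact hr x

lemma haar_star_mul_self (x : SUq2 q) : haar q (star x * x) =
    (((1 - (q : ℝ) ^ 2) * ∑' n : ℕ, (q : ℝ) ^ (2 * n) * colNorm x (n, 0) : ℝ) : ℂ) := by
  rw [haar_apply]
  push_cast
  congr 2; ext n
  rw [haarTerm, coef_star_mul_self]

lemma one_sub_sq_pos (q : Set.Ioo (0 : ℝ) 1) : 0 < 1 - (q : ℝ) ^ 2 :=
  sub_pos.2 (pow_lt_one₀ q.2.1.le q.2.2 two_ne_zero)

lemma isHaarState_haar : IsHaarState q (haar q) where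
  map_one := haar_one
  left_inv := haar_left_inv
  right_inv := haar_right_inv
  nonneg x := by
    rw [haar_star_mul_self, Complex.zero_le_real]
    refine mul_nonneg (one_sub_sq_pos q).le (tsum_nonneg fun n => ?_)
    exact mul_nonneg (pow_nonneg q.2.1.le _) (colNorm_nonneg _ _)

lemma haar_star_mul_self_ne {x : SUq2 q} {t : ℕ × ℤ} {n : ℕ} (h : coef x t (n, 0) ≠ 0) :
    haar q (star x * x) ≠ 0 := by
  rw [haar_star_mul_self]
  have hs : Summable fun n : ℕ => (q : ℝ) ^ (2 * n) * colNorm x (n, 0) := by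
    have := summable_haarTerm (star x * x)
    have h2 : haarTerm (star x * x) =
        fun n : ℕ => (((q : ℝ) ^ (2 * n) * colNorm x (n, 0) : ℝ) : ℂ) := by
      ext n; rw [haarTerm, coef_star_mul_self]; push_cast; rfl
    rw [h2] at this
    exact Complex.summable_ofReal.1 this
  have := hs.tsum_pos (fun n => mul_nonneg (pow_nonneg q.2.1.le _) (colNorm_nonneg _ _)) n
    (mul_pos (pow_pos q.2.1 _) (colNorm_pos h))
  exact_mod_cast (mul_pos (one_sub_sq_pos q) this).ne'

/-- `aⁱ cʲ` maps `e_{i,0}` to a nonzero multiple of `e_{0,j}`. -/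
lemma haar_lowVec_ne (i j : ℕ) : haar q (star (lowVec q i j) * lowVec q i j) ≠ 0 := by
  have hq := q_ne_zero q
  have hc : ∀ (j n : ℕ) (k : ℤ), ∃ r : ℂ, r ≠ 0 ∧
      rep q (gen q .c ^ j) (Finsupp.single (n, k) 1) = r • Finsupp.single (n, k + j) 1 := by
    intro j n
    induction j with
    | zero => intro k; exact ⟨1, one_ne_zero, by simp⟩
    | succ j ih =>
      intro k
      obtain ⟨r, hr, h⟩ := ih (k + 1)
      refine ⟨((q : ℝ) : ℂ) ^ n * r, mul_ne_zero (pow_ne_zero _ hq) hr, ?_⟩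
      rw [pow_succ, map_mul, Module.End.mul_apply, rep_gen, repGen, shiftOp_single, one_mul,
        ← mul_one (((q : ℝ) : ℂ) ^ n), ← smul_eq_mul, ← Finsupp.smul_single, map_smul, h, smul_smul,
        smul_eq_mul, mul_one]
      congr 3; push_cast; ring
  have ha : ∀ (i : ℕ) (k : ℤ), ∃ r : ℂ, r ≠ 0 ∧
      rep q (gen q .a ^ i) (Finsupp.single (i, k) 1) = r • Finsupp.single (0, k) 1 := by
    intro i k
    induction i with
    | zero => exact ⟨1, one_ne_zero, by simp⟩
    | succ i ih =>
      obtain ⟨r, hr, h⟩ := ih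
      have hp : (rootWt q (i + 1) : ℂ) ≠ 0 := by exact_mod_cast (rootWt_pos (by omega)).ne'
      refine ⟨rootWt q (i + 1) * r, mul_ne_zero hp hr, ?_⟩
      rw [pow_succ, map_mul, Module.End.mul_apply, rep_gen, repGen, shiftOp_single, one_mul,
        ← mul_one ((rootWt q (i + 1) : ℝ) : ℂ), ← smul_eq_mul, ← Finsupp.smul_single, map_smul]
      simp only [Nat.add_sub_cancel]
      rw [h, smul_smul, smul_eq_mul, mul_one]
  obtain ⟨r, hr, h1⟩ := hc j i 0
  obtain ⟨r', hr', h2⟩ := ha i (0 + j)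
  refine haar_star_mul_self_ne (t := (0, 0 + j)) (n := i) ?_
  rw [coef, lowVec, map_mul, Module.End.mul_apply, h1, map_smul, h2]
  simp [hr, hr']

end SUq2

/-- There is only one Haar state. -/
lemma IsHaarState.eq_haar {q : Set.Ioo (0 : ℝ) 1} {h : SUq2 q →ₗ[ℂ] ℂ} (hh : IsHaarState q h) :
    h = SUq2.haar q :=
  SUq2.eq_of_left_right_inv hh.map_one SUq2.haar_one hh.left_inv SUq2.haar_right_inv

namespace SUq2

variable {q : Set.Ioo (0 : ℝ) 1}

/-! ### Functionals that are invariant under `◁ f` and `◁ k` -/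

lemma flip_dE (x : SUq2 q) : flip q (dE q x) = rF q (flip q x) := by
  have := flip_leftAct (pairE q) x
  rwa [pairE_flip] at this

lemma flip_dK (n : ℤ) (x : SUq2 q) : flip q (dK q n x) = rK q n (flip q x) := by
  have := flip_leftAct (pairK q n).toLinearMap x
  rwa [pairK_flip] at this

lemma star_rK (n : ℤ) (x : SUq2 q) : star (rK q n x) = rK q (-n) (star x) := by
  have hr : ∀ m : ℤ, (starRingEnd ℂ) (rt q ^ m) = rt q ^ m := by
    intro m; rw [map_zpow₀, rt, Complex.conj_ofReal]
  induction x using gen_induction with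
  | hs r => simp [rK_one]
  | hg s => cases s <;> simp only [rK_gen, star_gen, starGen, star_smul', hr, map_smul, map_neg,
      neg_smul, smul_neg, neg_neg, smul_comm (_ : ℂ) (_ : ℂ) (_ : SUq2 q)]
  | ha x y hx hy => simp [hx, hy]
  | hm x y hx hy => simp only [rK_mul, star_mul, hx, hy]

lemma conj_rt_zpow (m : ℤ) : (starRingEnd ℂ) (rt q ^ m) = rt q ^ m := by
  rw [map_zpow₀, rt, Complex.conj_ofReal]

lemma sqrt_q_pos (q : Set.Ioo (0 : ℝ) 1) : 0 < Real.sqrt q := Real.sqrt_pos.2 q.2.1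

lemma sqrt_q_lt_one (q : Set.Ioo (0 : ℝ) 1) : Real.sqrt q < 1 := by
  rw [Real.sqrt_lt' one_pos]; simpa using q.2.2

lemma rt_zpow_injective : Function.Injective fun m : ℤ => rt q ^ m := by
  intro m n h
  have h' : ((Real.sqrt q ^ m : ℝ) : ℂ) = ((Real.sqrt q ^ n : ℝ) : ℂ) := by
    push_cast; exact h
  exact zpow_right_injective₀ (sqrt_q_pos q) (sqrt_q_lt_one q).ne (Complex.ofReal_injective h')

lemma span_flip_wtVec : Submodule.span ℂ (Set.range fun p : ℕ × ℕ × ℕ =>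
    flip q (wtVec q p.1 p.2.1 p.2.2)) = ⊤ := by
  have h := congrArg (Submodule.map (flip q).toLinearMap) (wtSpan_eq_top (q := q))
  rw [wtSpan, Submodule.map_span, ← Set.range_comp, Submodule.map_top, LinearMap.range_eq_top.2]
    at h
  · exact h
  · exact fun x => ⟨flip q x, flip_flip x⟩

/-- Up to a constant there is only one functional that is invariant under `◁ f` and `◁ k`: it is
zero on the flips of the weight vectors other than `1`. -/
lemma eq_mul_of_rF_inv {u v : SUq2 q →ₗ[ℂ] ℂ} (hu : ∀ x, u (rF q x) = 0)
    (hu' : ∀ x, u (rK q 1 x) = u x) (hv : ∀ x, v (rF q x) = 0) (hv' : ∀ x, v (rK q 1 x) = v x)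
    (hv1 : v 1 = 1) (x : SUq2 q) : u x = u 1 * v x := by
  suffices H : u = u 1 • v from DFunLike.congr_fun H x
  have key : ∀ {w : SUq2 q →ₗ[ℂ] ℂ}, (∀ x, w (rF q x) = 0) → (∀ x, w (rK q 1 x) = w x) →
      ∀ i j n : ℕ, w (flip q (wtVec q i j n)) = if i = 0 ∧ j = 0 ∧ n = 0 then w 1 else 0 := by
    intro w hw hw' i j n
    cases n with
    | succ n => rw [wtVec_succ, flip_dE, hw, if_neg (by omega)]
    | zero =>
      split_ifs with h
      · obtain ⟨rfl, rfl, -⟩ := h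
        rw [wtVec_zero, lowVec_zero, map_one]
      · have h1 := hw' (flip q (wtVec q i j 0))
        rw [← flip_dK, wtVec_zero, dK_lowVec, map_smul, map_smul, smul_eq_mul] at h1
        by_contra h0
        have h2 := mul_right_cancel₀ h0 (h1.trans (one_mul _).symm)
        have h3 := rt_zpow_injective (q := q) (h2.trans (zpow_zero _).symm)
        omega
  refine LinearMap.ext_on span_flip_wtVec ?_
  rintro _ ⟨⟨i, j, n⟩, rfl⟩
  dsimp only
  rw [LinearMap.smul_apply, key hu hu', key hv hv', hv1]
  split_ifs <;> simp

lemma rF_lowVec_zero (j : ℕ) : rF q (lowVec q 0 j) = 0 := by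
  have : ∀ j, rF q (gen q .c ^ j) = 0 := by
    intro j
    induction j with
    | zero => simp [rF_one]
    | succ j ih => rw [pow_succ, rF_mul, ih, rF_gen.2.2.1]; simp
  rw [lowVec, pow_zero, one_mul, this]

lemma exists_rF_lowVec_succ (i j : ℕ) :
    ∃ r : ℂ, rF q (lowVec q (i + 1) j) = r • lowVec q i (j + 1) := by
  have hc : rF q (gen q .c ^ j) = 0 := by
    have := rF_lowVec_zero (q := q) j
    rwa [lowVec, pow_zero, one_mul] at this
  have ha : ∀ i : ℕ, ∃ r : ℂ, rF q (gen q .a ^ (i + 1)) = r • (gen q .a ^ i * gen q .c) := by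
    intro i
    induction i with
    | zero => exact ⟨1, by simp [rF_gen]⟩
    | succ i ih =>
      obtain ⟨r, hr⟩ := ih
      have e := rF_mul (gen q .a) (gen q .a ^ (i + 1))
      rw [← pow_succ', rF_gen.1, rK_pow, (rK_gen _).1, (rK_gen _).1, hr, smul_pow,
        mul_smul_comm, smul_mul_smul_comm, mul_pow_of_qcomm (ca_comm q), smul_smul, ← mul_assoc,
        ← pow_succ', ← add_smul] at e
      exact ⟨_, e⟩
  obtain ⟨r, hr⟩ := ha i
  have e := rF_mul (gen q .a ^ (i + 1)) (gen q .c ^ j)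
  rw [← lowVec, hc, mul_zero, add_zero, hr, rK_pow, (rK_gen _).2.2.1, smul_pow,
    smul_mul_smul_comm, mul_assoc, ← pow_succ', ← lowVec] at e
  exact ⟨_, e⟩

lemma rF_wtVec_zero (j n : ℕ) : rF q (wtVec q 0 j n) = 0 := by
  induction n with
  | zero => exact rF_lowVec_zero j
  | succ n ih => rw [wtVec_succ, ← dE_rF, ih, map_zero]

variable (q) in
/-- The coefficient in `(aⁱ⁺¹ cʲ) ◁ f = fCoef i j • aⁱ cʲ⁺¹`. -/
def fCoef (i j : ℕ) : ℂ := (exists_rF_lowVec_succ (q := q) i j).choose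

lemma rF_wtVec_succ (i j n : ℕ) :
    rF q (wtVec q (i + 1) j n) = fCoef q i j • wtVec q i (j + 1) n := by
  induction n with
  | zero => exact (exists_rF_lowVec_succ (q := q) i j).choose_spec
  | succ n ih => rw [wtVec_succ, ← dE_rF, ih, map_smul, wtVec_succ]

end SUq2

namespace IsHaarState

open SUq2

variable {q : Set.Ioo (0 : ℝ) 1} {h : SUq2 q →ₗ[ℂ] ℂ}

/-! ### The inner product on the core -/

lemma apply_leftAct' (hh : IsHaarState q h) (u : SUq2 q →ₗ[ℂ] ℂ) (x : SUq2 q) :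
    h (leftAct u x) = u 1 * h x := by
  rw [apply_leftAct, hh.right_inv, map_smul, smul_eq_mul, mul_comm]

lemma apply_rightAct' (hh : IsHaarState q h) (u : SUq2 q →ₗ[ℂ] ℂ) (x : SUq2 q) :
    h (rightAct u x) = u 1 * h x := by
  rw [← apply_leftAct, hh.left_inv, map_smul, smul_eq_mul, mul_comm]

lemma apply_dK (hh : IsHaarState q h) (n : ℤ) (x : SUq2 q) : h (dK q n x) = h x := by
  rw [dK, hh.apply_leftAct']; simp

lemma apply_rK (hh : IsHaarState q h) (n : ℤ) (x : SUq2 q) : h (rK q n x) = h x := by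
  rw [rK, hh.apply_rightAct']; simp

lemma apply_dE (hh : IsHaarState q h) (x : SUq2 q) : h (dE q x) = 0 := by
  rw [dE, hh.apply_leftAct']; simp [pairE]

lemma apply_rF (hh : IsHaarState q h) (x : SUq2 q) : h (rF q x) = 0 := by
  rw [rF, hh.apply_rightAct']; simp [pairF]

lemma ip_dK (hh : IsHaarState q h) (n : ℤ) (x y : SUq2 q) :
    h (star (dK q n x) * y) = h (star x * dK q n y) := by
  rw [← hh.apply_dK n (star (dK q n x) * y), dK_mul, star_dK, dK_dK, add_neg_cancel, dK_zero]

lemma ip_rK (hh : IsHaarState q h) (n : ℤ) (x y : SUq2 q) :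
    h (star (rK q n x) * y) = h (star x * rK q n y) := by
  rw [← hh.apply_rK n (star (rK q n x) * y), rK_mul, star_rK, rK_rK, add_neg_cancel, rK_zero]

/-- `e` and `f` are adjoint to each other. -/
lemma ip_dE (hh : IsHaarState q h) (x y : SUq2 q) :
    h (star x * dE q y) = h (star (dF q x) * y) := by
  have hq := q_ne_zero q
  -- apply `h (e ▷ ·) = 0` to the product of `k ▷ x*` and `y`
  have h1 := hh.apply_dE (dK q 1 (star x) * y)
  have h2 : dE q (star (dK q (-1) x)) = (-((q : ℝ) : ℂ)) • star (dF q (dK q (-1) x)) := by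
    rw [← star_star (dE q _), star_dE, star_star, star_smul']
    simp
  have h3 : dK q 1 (star x) = star (dK q (-1) x) := by rw [star_dK, neg_neg]
  have h4 : dF q (dK q (-1) x) = ((q : ℝ) : ℂ)⁻¹ • dK q (-1) (dF q x) := by
    rw [dK_dF, smul_smul, q_eq_rt]
    rw [show (-(2 * -1) : ℤ) = 2 by norm_num, show rt q ^ (2 : ℤ) = rt q ^ 2 from rfl,
      inv_mul_cancel₀ (pow_ne_zero _ (rt_ne q)), one_smul]
  rw [dE_mul, dK_dK, neg_add_cancel, dK_zero, h3, h2, h4, star_smul', map_add, smul_mul_assoc,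
    smul_mul_assoc, map_smul, map_smul, hh.ip_dK, dK_dK, neg_add_cancel, dK_zero, smul_smul] at h1
  rw [map_inv₀, Complex.conj_ofReal, neg_mul, mul_inv_cancel₀ hq, neg_one_smul] at h1
  linear_combination h1

lemma ip_dE' (hh : IsHaarState q h) (x y : SUq2 q) :
    h (star (dE q x) * y) = h (star x * dF q y) := by
  rw [← hh.conj_symm (dE q x) y, hh.ip_dE, hh.conj_symm]

lemma ip_wtVec_succ (hh : IsHaarState q h) (i j n i' j' n' : ℕ) :
    h (star (wtVec q i j (n + 1)) * wtVec q i' j' (n' + 1)) =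
      ((qnum q (n' + 1) * qnum q (i' + j' - n') : ℝ) : ℂ) *
        h (star (wtVec q i j n) * wtVec q i' j' n') := by
  rw [wtVec_succ, hh.ip_dE', dF_wtVec_succ, mul_smul_comm, map_smul, smul_eq_mul]

/-- The weight vectors are orthogonal: `f` lowers both entries until one of them is a lowest weight
vector, and the lowest weight vectors are separated by their weights for `k ▷` and `◁ k`. -/
lemma ip_wtVec (hh : IsHaarState q h) {i j n i' j' n' : ℕ} (hne : (i, j, n) ≠ (i', j', n')) :
    h (star (wtVec q i j n) * wtVec q i' j' n') = 0 := by
  induction n generalizing n' with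
  | zero =>
    cases n' with
    | zero =>
      by_contra h0
      have h1 := hh.ip_dK 1 (wtVec q i j 0) (wtVec q i' j' 0)
      have h2 := hh.ip_rK 1 (wtVec q i j 0) (wtVec q i' j' 0)
      rw [dK_wtVec, dK_wtVec, star_smul', smul_mul_assoc, mul_smul_comm, map_smul, map_smul,
        conj_rt_zpow] at h1
      rw [rK_wtVec, rK_wtVec, star_smul', smul_mul_assoc, mul_smul_comm, map_smul, map_smul,
        conj_rt_zpow] at h2
      -- equal weights `i + j = i' + j'` and `j - i = j' - i'`
      have h3 := rt_zpow_injective (q := q) (mul_right_cancel₀ h0 h1)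
      have h4 := rt_zpow_injective (q := q) (mul_right_cancel₀ h0 h2)
      apply hne
      simp only [Prod.mk.injEq, and_true]
      push_cast at h3 h4
      constructor <;> omega
    | succ n' => rw [wtVec_succ, hh.ip_dE, wtVec_zero, dF_lowVec]; simp
  | succ n ih =>
    cases n' with
    | zero => rw [wtVec_succ, hh.ip_dE', wtVec_zero, dF_lowVec]; simp
    | succ n' =>
      rw [hh.ip_wtVec_succ, ih, mul_zero]
      intro h0
      apply hne
      simp only [Prod.mk.injEq] at h0 ⊢
      omega

lemma ip_wtVec_self_ne (hh : IsHaarState q h) {i j n : ℕ} (hn : n ≤ i + j) :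
    h (star (wtVec q i j n) * wtVec q i j n) ≠ 0 := by
  induction n with
  | zero => rw [hh.eq_haar]; exact haar_lowVec_ne i j
  | succ n ih =>
    rw [hh.ip_wtVec_succ]
    refine mul_ne_zero ?_ (ih (by omega))
    have h1 : 0 < qnum q (n + 1) := qnum_pos (by omega)
    have h2 : 0 < qnum q (i + j - n) := qnum_pos (by omega)
    exact_mod_cast (mul_pos h1 h2).ne'

/-! ### The quantum trace -/

variable (h) in
/-- The coefficient of `eⁿ ▷ (aⁱ cʲ)` in the expansion of an element in weight vectors. -/
def wtCoef (i j n : ℕ) : SUq2 q →ₗ[ℂ] ℂ :=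
  (h (star (wtVec q i j n) * wtVec q i j n))⁻¹ • (h ∘ₗ LinearMap.mulLeft ℂ (star (wtVec q i j n)))

lemma wtCoef_apply (i j n : ℕ) (x : SUq2 q) : wtCoef h i j n x =
    (h (star (wtVec q i j n) * wtVec q i j n))⁻¹ * h (star (wtVec q i j n) * x) := rfl

lemma wtCoef_self (hh : IsHaarState q h) {i j n : ℕ} (hn : n ≤ i + j) :
    wtCoef h i j n (wtVec q i j n) = 1 := inv_mul_cancel₀ (hh.ip_wtVec_self_ne hn)

lemma wtCoef_ne (hh : IsHaarState q h) {i j n i' j' n' : ℕ} (hne : (i, j, n) ≠ (i', j', n')) :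
    wtCoef h i j n (wtVec q i' j' n') = 0 := by
  rw [wtCoef_apply, hh.ip_wtVec hne, mul_zero]

lemma wtCoef_rK (hh : IsHaarState q h) (m : ℤ) (i j n : ℕ) (x : SUq2 q) :
    wtCoef h i j n (rK q m x) = rt q ^ (m * (j - i)) * wtCoef h i j n x := by
  rw [wtCoef_apply, ← hh.ip_rK, rK_wtVec, star_smul', conj_rt_zpow, smul_mul_assoc, map_smul,
    wtCoef_apply, smul_eq_mul, mul_left_comm]

lemma wtCoef_rF_zero (hh : IsHaarState q h) (i n : ℕ) (x : SUq2 q) :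
    wtCoef h i 0 n (rF q x) = 0 := by
  suffices H : wtCoef h i 0 n ∘ₗ rF q = 0 from DFunLike.congr_fun H x
  refine LinearMap.ext_on wtSpan_eq_top ?_
  rintro _ ⟨⟨i', j', n'⟩, rfl⟩
  dsimp only
  rw [LinearMap.comp_apply]
  cases i' with
  | zero => rw [rF_wtVec_zero]; simp
  | succ i' => rw [rF_wtVec_succ, map_smul, hh.wtCoef_ne (by simp)]; simp

lemma wtCoef_rF_succ (hh : IsHaarState q h) {i j n : ℕ} (hn : n ≤ i + j + 1) (x : SUq2 q) :
    wtCoef h i (j + 1) n (rF q x) = fCoef q i j * wtCoef h (i + 1) j n x := by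
  suffices H : wtCoef h i (j + 1) n ∘ₗ rF q = fCoef q i j • wtCoef h (i + 1) j n from
    DFunLike.congr_fun H x
  refine LinearMap.ext_on wtSpan_eq_top ?_
  rintro _ ⟨⟨i', j', n'⟩, rfl⟩
  dsimp only
  rw [LinearMap.comp_apply, LinearMap.smul_apply, smul_eq_mul]
  cases i' with
  | zero => rw [rF_wtVec_zero, map_zero, hh.wtCoef_ne (by simp), mul_zero]
  | succ i' =>
    rw [rF_wtVec_succ, map_smul, smul_eq_mul]
    by_cases he : (i, j, n) = (i', j', n')
    · simp only [Prod.mk.injEq] at he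
      obtain ⟨rfl, rfl, rfl⟩ := he
      rw [hh.wtCoef_self (by omega), hh.wtCoef_self (by omega)]
    · simp only [Prod.mk.injEq] at he
      rw [hh.wtCoef_ne (by simp only [ne_eq, Prod.mk.injEq]; omega),
        hh.wtCoef_ne (by simp only [ne_eq, Prod.mk.injEq]; omega), mul_zero, mul_zero]

variable (h) in
/-- The quantum trace `x ↦ Tr(Δ_R x)` over the span of the weight vectors of spin `N / 2` with the
left weight given by `n`. -/
def qTrace (N n : ℕ) : SUq2 q →ₗ[ℂ] ℂ :=
  ∑ i ∈ Finset.range (N + 1), rt q ^ (2 * (N - 2 * i) : ℤ) •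
    (wtCoef h i (N - i) n ∘ₗ LinearMap.mulRight ℂ (wtVec q i (N - i) n))

lemma qTrace_apply (N n : ℕ) (x : SUq2 q) : qTrace h N n x = ∑ i ∈ Finset.range (N + 1),
    rt q ^ (2 * (N - 2 * i) : ℤ) * wtCoef h i (N - i) n (x * wtVec q i (N - i) n) := by
  simp [qTrace]

lemma wtCoef_rK_mul (hh : IsHaarState q h) (m : ℤ) (i j i' j' n : ℕ) (x : SUq2 q) :
    wtCoef h i j n (rK q m x * wtVec q i' j' n) =
      rt q ^ (m * ((j - i) - (j' - i'))) * wtCoef h i j n (x * wtVec q i' j' n) := by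
  have e : rK q m x * wtVec q i' j' n =
      rt q ^ (-m * (j' - i')) • rK q m (x * wtVec q i' j' n) := by
    rw [rK_mul, rK_wtVec, mul_smul_comm, smul_smul, ← zpow_add₀ (rt_ne q)]
    rw [show -m * ((j' : ℤ) - i') + m * (j' - i') = 0 by ring, zpow_zero, one_smul]
  rw [e, map_smul, hh.wtCoef_rK, smul_eq_mul, ← mul_assoc, ← zpow_add₀ (rt_ne q)]
  congr 2; ring

lemma qTrace_rK (hh : IsHaarState q h) (N n : ℕ) (m : ℤ) (x : SUq2 q) :
    qTrace h N n (rK q m x) = qTrace h N n x := by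
  rw [qTrace_apply, qTrace_apply]
  refine Finset.sum_congr rfl fun i _ => ?_
  rw [hh.wtCoef_rK_mul, sub_self, mul_zero, zpow_zero, one_mul]

/-- The quantum trace is invariant under `◁ f`: with `(x y) ◁ f = (x ◁ f)(y ◁ k) + (x ◁ k⁻¹)(y ◁ f)`
the sum telescopes. -/
lemma qTrace_rF (hh : IsHaarState q h) {N n : ℕ} (hn : n ≤ N) (x : SUq2 q) :
    qTrace h N n (rF q x) = 0 := by
  have hs := rt_ne q
  have e : ∀ i j : ℕ, rF q x * wtVec q i j n = rt q ^ (i - j : ℤ) •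
      (rF q (x * wtVec q i j n) - rK q (-1) x * rF q (wtVec q i j n)) := by
    intro i j
    rw [rF_mul, add_sub_cancel_right, rK_wtVec, mul_smul_comm, smul_smul, ← zpow_add₀ hs,
      show (i - j + 1 * (j - i) : ℤ) = 0 by ring, zpow_zero, one_smul]
  let A : ℕ → ℂ := fun i => rt q ^ (N - 2 * i : ℤ) *
    (fCoef q i (N - (i + 1)) * wtCoef h (i + 1) (N - (i + 1)) n (x * wtVec q i (N - i) n))
  -- `A i` couples the weight vectors of index `i` and `i + 1`, and occurs twice with opposite signs
  have h1 : ∀ i ∈ Finset.range (N + 1),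
      rt q ^ (2 * (N - 2 * i) : ℤ) * wtCoef h i (N - i) n (rF q x * wtVec q i (N - i) n) =
      (if i < N then A i else 0) - (if 0 < i then A (i - 1) else 0) := by
    intro i hi
    rw [Finset.mem_range] at hi
    rw [e, map_smul, map_sub, smul_eq_mul, ← mul_assoc, ← zpow_add₀ hs, mul_sub]
    have hexp : (2 * (N - 2 * i) + (i - (N - i : ℕ)) : ℤ) = N - 2 * i := by
      rw [Nat.cast_sub (by omega)]; ring
    rw [hexp]
    congr 1
    · split_ifs with h2
      · obtain ⟨j, rfl⟩ : ∃ j, N = i + j + 1 := Nat.exists_eq_add_of_lt h2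
        have hj : i + j + 1 - i = j + 1 := by omega
        have hj' : i + j + 1 - (i + 1) = j := by omega
        simp only [A, hj, hj']
        rw [hh.wtCoef_rF_succ (by omega)]
      · obtain rfl : i = N := by omega
        rw [Nat.sub_self, hh.wtCoef_rF_zero, mul_zero]
    · split_ifs with h2
      · obtain ⟨i, rfl⟩ : ∃ k, i = k + 1 := ⟨i - 1, by omega⟩
        have hj : N - (i + 1) + 1 = N - i := by omega
        rw [rF_wtVec_succ, mul_smul_comm, map_smul, hj, hh.wtCoef_rK_mul, smul_eq_mul,
          Nat.add_sub_cancel]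
        simp only [A]
        rw [mul_left_comm, ← mul_assoc (rt q ^ _), ← zpow_add₀ hs, mul_left_comm (fCoef q _ _)]
        congr 2
        rw [Nat.cast_sub (by omega), Nat.cast_sub (by omega)]
        push_cast; ring
      · obtain rfl : i = 0 := by omega
        rw [rF_wtVec_zero]; simp
  rw [qTrace_apply, Finset.sum_congr rfl h1, Finset.sum_sub_distrib, Finset.sum_range_succ,
    Finset.sum_range_succ']
  simp only [lt_irrefl, if_false, add_zero, Nat.succ_pos', if_true, Nat.add_sub_cancel]
  rw [sub_eq_zero]
  refine Finset.sum_congr rfl fun i hi => ?_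
  rw [if_pos (Finset.mem_range.1 hi)]

/-- The quantum trace of left multiplication by `x` is a multiple of the Haar state. -/
lemma qTrace_eq (hh : IsHaarState q h) {N n : ℕ} (hn : n ≤ N) (x : SUq2 q) :
    qTrace h N n x = (∑ i ∈ Finset.range (N + 1), rt q ^ (2 * (N - 2 * i) : ℤ)) * h x := by
  rw [eq_mul_of_rF_inv (hh.qTrace_rF hn) (hh.qTrace_rK N n 1) hh.apply_rF (hh.apply_rK 1)
    hh.map_one x, qTrace_apply]
  congr 1
  refine Finset.sum_congr rfl fun i hi => ?_
  rw [Finset.mem_range] at hi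
  rw [one_mul, hh.wtCoef_self (by omega), mul_one]

end IsHaarState

/-! ### Traces -/

section Trace

variable {H : Type*} [NormedAddCommGroup H] [InnerProductSpace ℂ H]

/-- For a trace class operator `∑ ⟪u n, ·⟫ v n` and any Hilbert basis, the diagonal is absolutely
summable, with sum `∑ ⟪u n, v n⟫`. -/
lemma HilbertBasis.hasSum_inner_of_hasSum {κ : Type*} (e : HilbertBasis κ ℂ H) {T : H →L[ℂ] H}
    {u v : ℕ → H} (huv : Summable fun n => ‖u n‖ * ‖v n‖)
    (hT : ∀ x, HasSum (fun n => ⟪u n, x⟫_ℂ • v n) (T x)) :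
    Summable (fun i => ‖⟪e i, T (e i)⟫_ℂ‖) ∧
      HasSum (fun i => ⟪e i, T (e i)⟫_ℂ) (∑' n, ⟪u n, v n⟫_ℂ) := by
  -- Fubini for the double series `F`, which is absolutely summable by Cauchy–Schwarz and Parseval
  let F : ℕ × κ → ℂ := fun p => ⟪u p.1, e p.2⟫_ℂ * ⟪e p.2, v p.1⟫_ℂ
  have hsq : ∀ x : H, HasSum (fun i => ‖⟪e i, x⟫_ℂ‖ ^ 2) (‖x‖ ^ 2) := by
    intro x
    have h1 := e.hasSum_inner_mul_inner x x
    have h2 : HasSum (fun i => ((‖⟪e i, x⟫_ℂ‖ ^ 2 : ℝ) : ℂ)) ((‖x‖ ^ 2 : ℝ) : ℂ) := by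
      have h3 : ((‖x‖ ^ 2 : ℝ) : ℂ) = ⟪x, x⟫_ℂ := by
        rw [inner_self_eq_norm_sq_to_K]; push_cast; rfl
      rw [h3]
      refine h1.congr_fun fun i => ?_
      rw [← inner_conj_symm x (e i), Complex.conj_mul']
      push_cast; rfl
    exact_mod_cast h2
  have hrow : ∀ n, HasSum (fun i => F (n, i)) ⟪u n, v n⟫_ℂ := fun n =>
    e.hasSum_inner_mul_inner (u n) (v n)
  have hrown : ∀ n, Summable (fun i => ‖F (n, i)‖) ∧ ∑' i, ‖F (n, i)‖ ≤ ‖u n‖ * ‖v n‖ := by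
    intro n
    have := Real.summable_and_inner_le_Lp_mul_Lq_tsum_of_nonneg (p := 2) (q := 2)
      Real.HolderConjugate.two_two
      (f := fun i => ‖⟪e i, u n⟫_ℂ‖) (g := fun i => ‖⟪e i, v n⟫_ℂ‖)
      (fun i => norm_nonneg _) (fun i => norm_nonneg _)
      (by simpa using (hsq (u n)).summable) (by simpa using (hsq (v n)).summable)
    have hF : ∀ i, ‖F (n, i)‖ = ‖⟪e i, u n⟫_ℂ‖ * ‖⟪e i, v n⟫_ℂ‖ := by
      intro i
      rw [norm_mul, norm_inner_symm]
    simp only [hF]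
    refine ⟨this.1, this.2.trans (le_of_eq ?_)⟩
    simp only [Real.rpow_two, (hsq _).tsum_eq]
    rw [← Real.sqrt_eq_rpow, ← Real.sqrt_eq_rpow, Real.sqrt_sq (norm_nonneg _),
      Real.sqrt_sq (norm_nonneg _)]
  have hFn : Summable fun p => ‖F p‖ := by
    rw [summable_prod_of_nonneg fun p => norm_nonneg _]
    exact ⟨fun n => (hrown n).1, huv.of_nonneg_of_le (fun n => tsum_nonneg fun i => norm_nonneg _)
      fun n => (hrown n).2⟩
  have hcol : ∀ i, HasSum (fun n => F (n, i)) ⟪e i, T (e i)⟫_ℂ := by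
    intro i
    have := (hT (e i)).mapL (innerSL ℂ (e i))
    simpa only [innerSL_apply_apply, inner_smul_right] using this
  have hFs : Summable fun p : κ × ℕ => F p.swap := by
    rw [← (Equiv.prodComm ℕ κ).summable_iff]
    exact hFn.of_norm
  have hFns : Summable fun p : κ × ℕ => ‖F p.swap‖ := by
    rw [← (Equiv.prodComm ℕ κ).summable_iff]
    exact hFn
  constructor
  · refine Summable.of_nonneg_of_le (fun i => norm_nonneg _) (fun i => ?_) hFns.prod
    rw [← (hcol i).tsum_eq]
    exact norm_tsum_le_tsum_norm (hFns.prod_factor i)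
  · have h1 : HasSum (fun i => ⟪e i, T (e i)⟫_ℂ) (∑' p : κ × ℕ, F p.swap) :=
      hFs.hasSum.prod_fiberwise hcol
    have h2 : HasSum (fun n => ⟪u n, v n⟫_ℂ) (∑' p, F p) :=
      hFn.of_norm.hasSum.prod_fiberwise hrow
    rw [h2.tsum_eq]
    rwa [show ∑' p : κ × ℕ, F p.swap = ∑' p, F p from (Equiv.prodComm κ ℕ).tsum_eq F] at h1

variable [CompleteSpace H] {V κ : Type*} [AddCommGroup V] [Module ℂ V]

/-- The trace of a trace class extension can be computed in any basis of the core that is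
orthonormal in the Hilbert space. -/
lemma IsTraceClassExt.hasSum_opTrace {ι : V →ₗ[ℂ] H} {A : V →ₗ[ℂ] V} {T : H →L[ℂ] H}
    (hT : IsTraceClassExt ι A T) (b : Module.Basis κ ℂ V) (ho : Orthonormal ℂ fun i => ι (b i))
    (hd : DenseRange ι) :
    Summable (fun i => ‖⟪ι (b i), ι (A (b i))⟫_ℂ‖) ∧
      HasSum (fun i => ⟪ι (b i), ι (A (b i))⟫_ℂ) (opTrace T) := by
  obtain ⟨⟨u, v, huv, hs⟩, hA⟩ := hT
  have hsp : ⊤ ≤ (Submodule.span ℂ (Set.range fun i => ι (b i))).topologicalClosure := by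
    have h1 : Submodule.span ℂ (Set.range fun i => ι (b i)) = LinearMap.range ι := by
      rw [show (fun i => ι (b i)) = ι ∘ b from rfl, Set.range_comp, ← Submodule.map_span,
        b.span_eq, Submodule.map_top]
    rw [h1, top_le_iff, ← Submodule.dense_iff_topologicalClosure_eq_top]
    exact hd
  let e := HilbertBasis.mk ho hsp
  have he : ∀ i, e i = ι (b i) := fun i => by simp [e]
  have h1 := e.hasSum_inner_of_hasSum huv hs
  simp only [he, hA] at h1
  have h2 : opTrace T = ∑' n, ⟪u n, v n⟫_ℂ := by
    obtain ⟨b', hb'⟩ := (exists_hilbertBasis ℂ H).choose_spec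
    have h3 := (b'.hasSum_inner_of_hasSum huv hs).2
    rw [opTrace, ← h3.tsum_eq]
    simp only [hb']
  rw [h2]
  exact h1

/-- An operator on the core is trace class if the norms of the images of an orthonormal basis are
summable. -/
lemma exists_isTraceClassExt [Countable κ] [Infinite κ] {ι : V →ₗ[ℂ] H} {A : V →ₗ[ℂ] V}
    (b : Module.Basis κ ℂ V) (ho : Orthonormal ℂ fun i => ι (b i))
    (hs : Summable fun i => ‖ι (A (b i))‖) : ∃ T : H →L[ℂ] H, IsTraceClassExt ι A T := by
  obtain ⟨φ⟩ : Nonempty (ℕ ≃ κ) := by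
    obtain ⟨_⟩ := nonempty_denumerable κ
    exact ⟨(Denumerable.eqv κ).symm⟩
  have hs' : Summable fun n => ‖ι (A (b (φ n)))‖ := (φ.summable_iff (f := fun i =>
    ‖ι (A (b i))‖)).2 hs
  have hop : Summable fun n => (innerSL ℂ (ι (b (φ n)))).smulRight (ι (A (b (φ n)))) := by
    refine Summable.of_norm (hs'.congr fun n => ?_)
    rw [ContinuousLinearMap.norm_smulRight_apply, innerSL_apply_norm, ho.1, one_mul]
  let T : H →L[ℂ] H := ∑' n, (innerSL ℂ (ι (b (φ n)))).smulRight (ι (A (b (φ n))))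
  have hT : ∀ x, HasSum (fun n => ⟪ι (b (φ n)), x⟫_ℂ • ι (A (b (φ n)))) (T x) := by
    intro x
    have := hop.hasSum.mapL (ContinuousLinearMap.apply ℂ H x)
    simpa using this
  refine ⟨T, ⟨fun n => ι (b (φ n)), fun n => ι (A (b (φ n))), ?_, hT⟩, ?_⟩
  · simpa [ho.1] using hs'
  · have : (T : H →ₗ[ℂ] H) ∘ₗ ι = ι ∘ₗ A := by
      refine b.ext fun i => ?_
      obtain ⟨m, rfl⟩ := φ.surjective i
      have h1 := hT (ι (b (φ m)))
      have h2 : HasSum (fun n => ⟪ι (b (φ n)), ι (b (φ m))⟫_ℂ • ι (A (b (φ n))))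
          (⟪ι (b (φ m)), ι (b (φ m))⟫_ℂ • ι (A (b (φ m)))) := by
        refine hasSum_single m fun n hn => ?_
        have h0 : ⟪ι (b (φ n)), ι (b (φ m))⟫_ℂ = 0 := ho.2 (φ.injective.ne hn)
        rw [h0, zero_smul]
      have h3 := h1.unique h2
      rw [inner_self_eq_norm_sq_to_K, ho.1] at h3
      simpa using h3
    exact fun v => DFunLike.congr_fun this v

lemma coreTrace_eq_tsum {ι : V →ₗ[ℂ] H} {A : V →ₗ[ℂ] V} (b : Module.Basis κ ℂ V)
    (ho : Orthonormal ℂ fun i => ι (b i)) (hd : DenseRange ι)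
    (hT : ∃ T : H →L[ℂ] H, IsTraceClassExt ι A T) :
    coreTrace ι A = ∑' i, ⟪ι (b i), ι (A (b i))⟫_ℂ := by
  rw [coreTrace, dif_pos hT]
  exact (hT.choose_spec.hasSum_opTrace b ho hd).2.tsum_eq.symm

/-- The function `f` of an operator that is diagonal in a basis. -/
lemma isDiagFun_diagFun (b : Module.Basis κ ℂ V) {T : V →ₗ[ℂ] V} {μ : κ → ℂ}
    (hT : ∀ i, T (b i) = μ i • b i) (f : ℂ → ℂ) : IsDiagFun T f (diagFun T f) := by
  refine Classical.epsilon_spec (p := IsDiagFun T f)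
    ⟨b.constr ℂ fun i => f (μ i) • b i, fun ν v hv => ?_⟩
  have coord : ∀ (S : V →ₗ[ℂ] V) (g : κ → ℂ), (∀ i, S (b i) = g i • b i) →
      ∀ (i : κ) (w : V), b.repr (S w) i = g i * b.repr w i := by
    intro S g hS i w
    have : (Finsupp.lapply i ∘ₗ b.repr.toLinearMap) ∘ₗ S =
        g i • (Finsupp.lapply i ∘ₗ b.repr.toLinearMap) := by
      refine b.ext fun j => ?_
      simp only [LinearMap.comp_apply, LinearEquiv.coe_coe, hS, map_smul, Module.Basis.repr_self,
        LinearMap.smul_apply, Finsupp.lapply_apply, smul_eq_mul]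
      by_cases hij : j = i
      · rw [hij]
      · rw [Finsupp.single_eq_of_ne (Ne.symm hij), mul_zero, mul_zero]
    exact DFunLike.congr_fun this w
  refine b.ext_elem fun i => ?_
  rw [coord _ (fun i => f (μ i)) (fun i => by simp) i v]
  have h1 := coord T μ hT i v
  rw [hv] at h1
  simp only [map_smul, Finsupp.smul_apply, smul_eq_mul] at h1 ⊢
  by_cases h0 : b.repr v i = 0
  · simp [h0]
  · rw [mul_right_cancel₀ h0 h1]

end Trace

namespace SUq2

variable {q : Set.Ioo (0 : ℝ) 1}

/-! ### The eigenvalues of the modular operators and of the square of the Dirac operator -/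

/-- The eigenvalue of `Δ_L` on `eⁿ ▷ (aⁱ cʲ)`. -/
def lWt (q : Set.Ioo (0 : ℝ) 1) (i j n : ℕ) : ℝ := (q : ℝ) ^ (2 * n - (i + j) : ℤ)

/-- The eigenvalue of `Δ_R` on `eⁿ ▷ (aⁱ cʲ)`. -/
def rWt (q : Set.Ioo (0 : ℝ) 1) (i j : ℕ) : ℝ := (q : ℝ) ^ (j - i : ℤ)

lemma lWt_pos (i j n : ℕ) : 0 < lWt q i j n := zpow_pos q.2.1 _
lemma rWt_pos (i j : ℕ) : 0 < rWt q i j := zpow_pos q.2.1 _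

lemma rt_zpow_two_mul (m : ℤ) : rt q ^ (2 * m) = (((q : ℝ) ^ m : ℝ) : ℂ) := by
  rw [zpow_mul, show rt q ^ (2 : ℤ) = rt q ^ 2 from rfl, ← q_eq_rt]; push_cast; rfl

lemma modL_wtVec (i j n : ℕ) : modL q (wtVec q i j n) = (lWt q i j n : ℂ) • wtVec q i j n := by
  rw [modL, dK_wtVec, rt_zpow_two_mul]; rfl

lemma modR_wtVec (i j n : ℕ) : modR q (wtVec q i j n) = (rWt q i j : ℂ) • wtVec q i j n := by
  have := rK_wtVec (q := q) 2 i j n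
  rwa [rt_zpow_two_mul] at this

/-- The positive square root of the eigenvalue of `D_q²` on `(eⁿ ▷ (aⁱ cʲ), 0)`, `i + j = N`: the
eigenvalue of `|D_q|`. -/
def absEig (q : Set.Ioo (0 : ℝ) 1) (N n : ℕ) : ℝ :=
  ((q : ℝ) ^ n)⁻¹ * ((1 - (q : ℝ) ^ (N + 1)) / ((q : ℝ)⁻¹ - q))

lemma absEig_pos (N n : ℕ) : 0 < absEig q N n := by
  have h1 := inv_sub_pos q
  have h2 : 0 < 1 - (q : ℝ) ^ (N + 1) := sub_pos.2 (pow_lt_one₀ q.2.1.le q.2.2 (by omega))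
  have h3 : 0 < (q : ℝ) ^ n := pow_pos q.2.1 n
  unfold absEig
  positivity

lemma dE_dF_wtVec (i j n : ℕ) : dE q (dF q (wtVec q i j n)) =
    ((qnum q n * qnum q (i + j - n + 1) : ℝ) : ℂ) • wtVec q i j n := by
  cases n with
  | zero => rw [wtVec_zero, dF_lowVec]; simp [qnum]
  | succ n =>
    rw [dF_wtVec_succ, map_smul, ← wtVec_succ]
    congr 4
    push_cast; ring

lemma dirac_inl (x : SUq2 q) : dirac q (x, 0) =
    ((((q : ℝ) : ℂ)⁻¹ - ((q : ℝ) : ℂ))⁻¹ • (((q : ℝ) : ℂ) • dK q (-2) x - x),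
      rt q • dF q (dK q (-1) x)) := by
  simp [dirac, rt]

lemma dirac_inr (x : SUq2 q) : dirac q (0, x) =
    ((rt q)⁻¹ • dE q (dK q (-1) x),
      (((q : ℝ) : ℂ)⁻¹ - ((q : ℝ) : ℂ))⁻¹ • (x - ((q : ℝ) : ℂ)⁻¹ • dK q (-2) x)) := by
  simp [dirac, rt]

lemma dirac_pair (x y : SUq2 q) : dirac q (x, y) = dirac q (x, 0) + dirac q (0, y) := by
  rw [← map_add]; simp

lemma inv_sub_ne (q : Set.Ioo (0 : ℝ) 1) : ((q : ℝ) : ℂ)⁻¹ - ((q : ℝ) : ℂ) ≠ 0 := by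
  have := (inv_sub_pos q).ne'
  exact_mod_cast this

/-- The off-diagonal entries of `D_q²` cancel, and `(e f) ▷` is scalar on the weight vectors. -/
lemma dirac_sq_inl (i j n : ℕ) : (dirac q ∘ₗ dirac q) (wtVec q i j n, 0) =
    ((absEig q (i + j) n ^ 2 : ℝ) : ℂ) • (wtVec q i j n, (0 : SUq2 q)) := by
  have hs := rt_ne q
  have hq := q_ne_zero q
  have hl := inv_sub_ne q
  set x := wtVec q i j n with hx
  set m : ℤ := 2 * n - (i + j) with hm
  have k1 : dK q (-1) x = rt q ^ (-m) • x := by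
    rw [hx, dK_wtVec]; congr 2; rw [hm]; ring
  have k2 : dK q (-2) x = (rt q ^ (-m) * rt q ^ (-m)) • x := by
    rw [hx, dK_wtVec, ← zpow_add₀ hs]; congr 2; rw [hm]; ring
  have kF1 : dK q (-1) (dF q x) = (rt q ^ 2 * rt q ^ (-m)) • dF q x := by
    rw [dK_dF, k1, map_smul, smul_smul]; rfl
  have kF2 : dK q (-2) (dF q x) = (rt q ^ 4 * (rt q ^ (-m) * rt q ^ (-m))) • dF q x := by
    rw [dK_dF, k2, map_smul, smul_smul]; rfl
  have hEF := dE_dF_wtVec (q := q) i j n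
  rw [← hx] at hEF
  have hval : ((((q : ℝ) : ℂ)⁻¹ - ((q : ℝ) : ℂ))⁻¹ *
      (((q : ℝ) : ℂ) * (rt q ^ (-m) * rt q ^ (-m)) - 1)) ^ 2 +
      rt q ^ 2 * (rt q ^ (-m) * rt q ^ (-m)) * ((qnum q n * qnum q (i + j - n + 1) : ℝ) : ℂ) =
      ((absEig q (i + j) n ^ 2 : ℝ) : ℂ) := by
    have e0 : rt q ^ (-m) * rt q ^ (-m) = ((q : ℝ) : ℂ) ^ (i + j) * (((q : ℝ) : ℂ) ^ n)⁻¹ ^ 2 := by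
      rw [← zpow_add₀ hs, ← two_mul, rt_zpow_two_mul]
      push_cast
      rw [← zpow_natCast, ← zpow_natCast, ← zpow_natCast, ← zpow_neg, ← zpow_mul, ← zpow_add₀ hq]
      congr 1; push_cast; rw [hm]; ring
    have e1 : ((qnum q n : ℝ) : ℂ) = ((((q : ℝ) : ℂ) ^ n)⁻¹ - ((q : ℝ) : ℂ) ^ n) *
        (((q : ℝ) : ℂ)⁻¹ - ((q : ℝ) : ℂ))⁻¹ := by
      rw [qnum]; push_cast; rw [zpow_neg, zpow_natCast]; ring
    have e2 : ((qnum q (i + j - n + 1) : ℝ) : ℂ) =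
        (((q : ℝ) : ℂ) ^ n * (((q : ℝ) : ℂ) ^ (i + j))⁻¹ *
        ((q : ℝ) : ℂ)⁻¹ - (((q : ℝ) : ℂ) ^ n)⁻¹ * ((q : ℝ) : ℂ) ^ (i + j) * ((q : ℝ) : ℂ)) *
        (((q : ℝ) : ℂ)⁻¹ - ((q : ℝ) : ℂ))⁻¹ := by
      rw [qnum]; push_cast
      have f1 : ((q : ℝ) : ℂ) ^ ((i : ℤ) + j - n + 1) =
          (((q : ℝ) : ℂ) ^ n)⁻¹ * ((q : ℝ) : ℂ) ^ (i + j) * ((q : ℝ) : ℂ) := by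
        rw [zpow_add₀ hq, zpow_sub₀ hq, zpow_natCast, zpow_one, ← Nat.cast_add, zpow_natCast]
        ring
      rw [zpow_neg, f1]
      field_simp
    rw [e0, absEig]
    push_cast
    rw [e1, e2, ← q_eq_rt, pow_succ _ (i + j)]
    have hA : ((q : ℝ) : ℂ) ^ n ≠ 0 := pow_ne_zero _ hq
    have hB : ((q : ℝ) : ℂ) ^ (i + j) ≠ 0 := pow_ne_zero _ hq
    generalize ((q : ℝ) : ℂ) ^ n = A at *
    generalize ((q : ℝ) : ℂ) ^ (i + j) = B at *
    generalize hL : ((q : ℝ) : ℂ)⁻¹ - ((q : ℝ) : ℂ) = L at *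
    field_simp
    ring
  rw [LinearMap.comp_apply, dirac_inl, dirac_pair, dirac_inl, dirac_inr]
  simp only [k1, k2, map_smul, map_sub, kF1, kF2, hEF, smul_smul, Prod.mk_add_mk, Prod.smul_mk,
    smul_zero, Prod.mk.injEq, smul_sub]
  constructor
  · rw [← hval]
    match_scalars
    field_simp
  · rw [q_eq_rt] at *
    match_scalars
    field_simp
    ring

lemma dirac_sq_inr (i j n : ℕ) : (dirac q ∘ₗ dirac q) (0, wtVec q i j n) =
    (((absEig q (i + j) n * (q : ℝ)⁻¹) ^ 2 : ℝ) : ℂ) • ((0 : SUq2 q), wtVec q i j n) := by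
  have hs := rt_ne q
  have hq := q_ne_zero q
  have hl := inv_sub_ne q
  set x := wtVec q i j n with hx
  set m : ℤ := 2 * n - (i + j) with hm
  have k1 : dK q (-1) x = rt q ^ (-m) • x := by
    rw [hx, dK_wtVec]; congr 2; rw [hm]; ring
  have k2 : dK q (-2) x = (rt q ^ (-m) * rt q ^ (-m)) • x := by
    rw [hx, dK_wtVec, ← zpow_add₀ hs]; congr 2; rw [hm]; ring
  have kE1 : dK q (-1) (dE q x) = ((rt q ^ 2)⁻¹ * rt q ^ (-m)) • dE q x := by
    rw [dK_dE, k1, map_smul, smul_smul]; rfl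
  have kE2 : dK q (-2) (dE q x) = ((rt q ^ 4)⁻¹ * (rt q ^ (-m) * rt q ^ (-m))) • dE q x := by
    rw [dK_dE, k2, map_smul, smul_smul]; rfl
  have hFE := dF_wtVec_succ (q := q) i j n
  rw [wtVec_succ, ← hx] at hFE
  have hval : ((((q : ℝ) : ℂ)⁻¹ - ((q : ℝ) : ℂ))⁻¹ *
      (1 - ((q : ℝ) : ℂ)⁻¹ * (rt q ^ (-m) * rt q ^ (-m)))) ^ 2 +
      (rt q ^ 2)⁻¹ * (rt q ^ (-m) * rt q ^ (-m)) *
        ((qnum q (n + 1) * qnum q (i + j - n) : ℝ) : ℂ) =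
      (((absEig q (i + j) n * (q : ℝ)⁻¹) ^ 2 : ℝ) : ℂ) := by
    have e0 : rt q ^ (-m) * rt q ^ (-m) = ((q : ℝ) : ℂ) ^ (i + j) * (((q : ℝ) : ℂ) ^ n)⁻¹ ^ 2 := by
      rw [← zpow_add₀ hs, ← two_mul, rt_zpow_two_mul]
      push_cast
      rw [← zpow_natCast, ← zpow_natCast, ← zpow_natCast, ← zpow_neg, ← zpow_mul, ← zpow_add₀ hq]
      congr 1; push_cast; rw [hm]; ring
    have e1 : ((qnum q (n + 1) : ℝ) : ℂ) = ((((q : ℝ) : ℂ) ^ n)⁻¹ * ((q : ℝ) : ℂ)⁻¹ -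
        ((q : ℝ) : ℂ) ^ n * ((q : ℝ) : ℂ)) * (((q : ℝ) : ℂ)⁻¹ - ((q : ℝ) : ℂ))⁻¹ := by
      rw [qnum]; push_cast
      rw [zpow_neg, zpow_add₀ hq, zpow_natCast, zpow_one, mul_inv]; ring
    have e2 : ((qnum q (i + j - n) : ℝ) : ℂ) = (((q : ℝ) : ℂ) ^ n * (((q : ℝ) : ℂ) ^ (i + j))⁻¹ -
        (((q : ℝ) : ℂ) ^ n)⁻¹ * ((q : ℝ) : ℂ) ^ (i + j)) *
        (((q : ℝ) : ℂ)⁻¹ - ((q : ℝ) : ℂ))⁻¹ := by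
      rw [qnum]; push_cast
      have f1 : ((q : ℝ) : ℂ) ^ ((i : ℤ) + j - n) =
          (((q : ℝ) : ℂ) ^ n)⁻¹ * ((q : ℝ) : ℂ) ^ (i + j) := by
        rw [zpow_sub₀ hq, zpow_natCast, ← Nat.cast_add, zpow_natCast]
        ring
      rw [zpow_neg, f1]
      field_simp
    rw [e0, absEig]
    push_cast
    rw [e1, e2, ← q_eq_rt, pow_succ _ (i + j)]
    have hA : ((q : ℝ) : ℂ) ^ n ≠ 0 := pow_ne_zero _ hq
    have hB : ((q : ℝ) : ℂ) ^ (i + j) ≠ 0 := pow_ne_zero _ hq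
    generalize ((q : ℝ) : ℂ) ^ n = A at *
    generalize ((q : ℝ) : ℂ) ^ (i + j) = B at *
    generalize hL : ((q : ℝ) : ℂ)⁻¹ - ((q : ℝ) : ℂ) = L at *
    field_simp
    ring
  rw [LinearMap.comp_apply, dirac_inr, dirac_pair, dirac_inl, dirac_inr]
  simp only [k1, k2, map_smul, map_sub, kE1, kE2, hFE, smul_smul, Prod.mk_add_mk, Prod.smul_mk,
    smul_zero, Prod.mk.injEq, smul_sub]
  constructor
  · rw [q_eq_rt] at *
    match_scalars
    field_simp
    ring
  · rw [← hval]
    match_scalars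
    field_simp
    ring

end SUq2

namespace IsHaarState

open SUq2

variable {q : Set.Ioo (0 : ℝ) 1} {h : SUq2 q →ₗ[ℂ] ℂ} (hh : IsHaarState q h)

/-! ### The GNS space -/

lemma inner_toGNS (x y : SUq2 q) : ⟪hh.toGNS x, hh.toGNS y⟫_ℂ = h (star x * y) :=
  UniformSpace.Completion.inner_coe (𝕜 := ℂ) (hh.toPreGNS x) (hh.toPreGNS y)

lemma norm_toGNS_sq (x : SUq2 q) : ((‖hh.toGNS x‖ ^ 2 : ℝ) : ℂ) = h (star x * x) := by
  rw [← hh.inner_toGNS, inner_self_eq_norm_sq_to_K]; push_cast; rfl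

lemma denseRange_toGNS : DenseRange hh.toGNS :=
  UniformSpace.Completion.denseRange_coe.comp hh.toPreGNS.surjective.denseRange
    (UniformSpace.Completion.continuous_coe _)

lemma core_apply (x y : SUq2 q) : hh.core (x, y) = WithLp.toLp 2 (hh.toGNS x, hh.toGNS y) := rfl

lemma denseRange_core : DenseRange hh.core := by
  have h1 : DenseRange (Prod.map hh.toGNS hh.toGNS) :=
    hh.denseRange_toGNS.prodMap hh.denseRange_toGNS
  have h2 : DenseRange (WithLp.toLp 2 : hh.GNS × hh.GNS → hh.Space) :=
    (WithLp.toLp_surjective 2).denseRange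
  exact h2.comp h1 (WithLp.prod_continuous_toLp 2 _ _)

lemma inner_core (x y x' y' : SUq2 q) :
    ⟪hh.core (x, y), hh.core (x', y')⟫_ℂ = h (star x * x') + h (star y * y') := by
  rw [core_apply, core_apply, WithLp.prod_inner_apply, ← hh.inner_toGNS, ← hh.inner_toGNS]

lemma norm_core_inl (x : SUq2 q) : ‖hh.core (x, 0)‖ = ‖hh.toGNS x‖ := by
  rw [core_apply, map_zero]
  simp

lemma norm_core_inr (x : SUq2 q) : ‖hh.core (0, x)‖ = ‖hh.toGNS x‖ := by
  rw [core_apply, map_zero]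
  simp

/-- Left multiplication is bounded, because `a* a + c* c = 1` and `b* b + d* d = 1`. -/
lemma exists_norm_mul_le (x : SUq2 q) :
    ∃ C : ℝ, 0 ≤ C ∧ ∀ y, ‖hh.toGNS (x * y)‖ ≤ C * ‖hh.toGNS y‖ := by
  have pair : ∀ s t : SUq2 q, star s * s + star t * t = 1 → ∀ y,
      ‖hh.toGNS (s * y)‖ ≤ 1 * ‖hh.toGNS y‖ ∧ ‖hh.toGNS (t * y)‖ ≤ 1 * ‖hh.toGNS y‖ := by
    intro s t hst y
    have h1 : ‖hh.toGNS (s * y)‖ ^ 2 + ‖hh.toGNS (t * y)‖ ^ 2 = ‖hh.toGNS y‖ ^ 2 := by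
      have : ((‖hh.toGNS (s * y)‖ ^ 2 : ℝ) : ℂ) + ((‖hh.toGNS (t * y)‖ ^ 2 : ℝ) : ℂ) =
          ((‖hh.toGNS y‖ ^ 2 : ℝ) : ℂ) := by
        rw [hh.norm_toGNS_sq, hh.norm_toGNS_sq, hh.norm_toGNS_sq, ← map_add]
        congr 1
        calc star (s * y) * (s * y) + star (t * y) * (t * y)
            = star y * (star s * s + star t * t) * y := by
              simp only [star_mul]; noncomm_ring
          _ = star y * y := by rw [hst, mul_one]
      exact_mod_cast this
    have h2 := sq_nonneg ‖hh.toGNS (s * y)‖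
    have h3 := sq_nonneg ‖hh.toGNS (t * y)‖
    rw [one_mul]
    exact ⟨(sq_le_sq₀ (norm_nonneg _) (norm_nonneg _)).1 (by linarith),
      (sq_le_sq₀ (norm_nonneg _) (norm_nonneg _)).1 (by linarith)⟩
  have H := gen_rel q
  have hac : star (gen q .a) * gen q .a + star (gen q .c) * gen q .c = 1 := by
    rw [star_gen, star_gen, starGen, starGen, H.da, smul_mul_assoc, neg_smul]
    abel
  have hdb : star (gen q .d) * gen q .d + star (gen q .b) * gen q .b = 1 := by
    rw [star_gen, star_gen, starGen, starGen, H.ad, smul_mul_assoc, neg_smul]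
    abel
  induction x using gen_induction with
  | hs r =>
    refine ⟨‖r‖, norm_nonneg _, fun y => ?_⟩
    rw [smul_mul_assoc, one_mul, map_smul, norm_smul]
  | hg s =>
    refine ⟨1, zero_le_one, fun y => ?_⟩
    cases s
    · exact (pair _ _ hac y).1
    · exact (pair _ _ hdb y).2
    · exact (pair _ _ hac y).2
    · exact (pair _ _ hdb y).1
  | ha x y hx hy =>
    obtain ⟨C, hC, h1⟩ := hx
    obtain ⟨C', hC', h2⟩ := hy
    refine ⟨C + C', add_nonneg hC hC', fun z => ?_⟩
    rw [add_mul, map_add, add_mul]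
    exact (norm_add_le _ _).trans (add_le_add (h1 z) (h2 z))
  | hm x y hx hy =>
    obtain ⟨C, hC, h1⟩ := hx
    obtain ⟨C', hC', h2⟩ := hy
    refine ⟨C * C', mul_nonneg hC hC', fun z => ?_⟩
    rw [mul_assoc, mul_assoc]
    exact (h1 _).trans (mul_le_mul_of_nonneg_left (h2 z) hC)

end IsHaarState

/-! ### The orthonormal basis of weight vectors -/

/-- The indices `(N, i, n)`, `i, n ≤ N`, of the weight vectors `eⁿ ▷ (aⁱ c^{N-i})` of
spin `N / 2`. -/
abbrev SpinIdx : Type := Σ N : ℕ, Fin (N + 1) × Fin (N + 1)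

namespace SUq2

/-- The weight vector with a given index. -/
def idxVec (q : Set.Ioo (0 : ℝ) 1) (p : SpinIdx) : SUq2 q :=
  wtVec q p.2.1 (p.1 - p.2.1) p.2.2

end SUq2

namespace IsHaarState

open SUq2

variable {q : Set.Ioo (0 : ℝ) 1} {h : SUq2 q →ₗ[ℂ] ℂ} (hh : IsHaarState q h)

lemma idx_le (p : SpinIdx) : (p.2.2 : ℕ) ≤ p.2.1 + (p.1 - p.2.1) := by
  have h1 := p.2.1.2
  have h2 := p.2.2.2
  omega

/-- The normalized weight vectors. -/
def unitVec (p : SpinIdx) : SUq2 q := ((‖hh.toGNS (idxVec q p)‖⁻¹ : ℝ) : ℂ) • idxVec q p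

lemma norm_idxVec_ne (p : SpinIdx) : ‖hh.toGNS (idxVec q p)‖ ≠ 0 := by
  intro h0
  have h1 := hh.norm_toGNS_sq (idxVec q p)
  rw [h0] at h1
  refine hh.ip_wtVec_self_ne (idx_le p) (h1.symm.trans ?_)
  simp

lemma ip_idxVec (hh : IsHaarState q h) {p p' : SpinIdx} (hne : p ≠ p') :
    h (star (idxVec q p) * idxVec q p') = 0 := by
  refine hh.ip_wtVec fun h0 => hne ?_
  obtain ⟨N, ⟨i, hi⟩, ⟨n, hn⟩⟩ := p
  obtain ⟨N', ⟨i', hi'⟩, ⟨n', hn'⟩⟩ := p'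
  simp only [Prod.mk.injEq] at h0
  obtain ⟨h1, h2, h3⟩ := h0
  obtain rfl : N = N' := by omega
  subst h1 h3
  rfl

lemma orthonormal_unitVec : Orthonormal ℂ fun p => hh.toGNS (hh.unitVec p) := by
  constructor
  · intro p
    change ‖hh.toGNS (hh.unitVec p)‖ = 1
    rw [unitVec, map_smul, norm_smul, Complex.norm_real, norm_inv, norm_norm]
    exact inv_mul_cancel₀ (hh.norm_idxVec_ne p)
  · intro p p' hne
    change ⟪hh.toGNS (hh.unitVec p), hh.toGNS (hh.unitVec p')⟫_ℂ = 0
    rw [unitVec, unitVec, map_smul, map_smul, inner_smul_left, inner_smul_right, hh.inner_toGNS,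
      hh.ip_idxVec hne, mul_zero, mul_zero]

lemma span_unitVec : ⊤ ≤ Submodule.span ℂ (Set.range hh.unitVec) := by
  rw [← wtSpan_eq_top, wtSpan, Submodule.span_le]
  rintro _ ⟨⟨i, j, n⟩, rfl⟩
  dsimp only
  by_cases hn : n ≤ i + j
  · let p : SpinIdx := ⟨i + j, ⟨i, by omega⟩, ⟨n, by omega⟩⟩
    have h1 : idxVec q p = wtVec q i j n := by
      simp only [idxVec, p, Nat.add_sub_cancel_left]
    have h2 : wtVec q i j n = ((‖hh.toGNS (idxVec q p)‖ : ℝ) : ℂ) • hh.unitVec p := by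
      rw [unitVec, smul_smul, ← Complex.ofReal_mul, mul_inv_cancel₀ (hh.norm_idxVec_ne p),
        Complex.ofReal_one, one_smul, h1]
    rw [h2]
    exact Submodule.smul_mem _ _ (Submodule.subset_span ⟨p, rfl⟩)
  · rw [wtVec_eq_zero_of_lt (not_le.1 hn)]
    exact Submodule.zero_mem _

/-- The basis of the core by the normalized weight vectors. -/
def unitBasis : Module.Basis SpinIdx ℂ (SUq2 q) :=
  Module.Basis.mk (LinearIndependent.of_comp hh.toGNS hh.orthonormal_unitVec.linearIndependent)
    hh.span_unitVec

lemma unitBasis_apply (p : SpinIdx) : hh.unitBasis p = hh.unitVec p := by simp [unitBasis]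

/-- The basis of the core of `𝓗 = H_h ⊕ H_h` that has the normalized weight vectors in each
summand. -/
def pairBasis : Module.Basis (SpinIdx ⊕ SpinIdx) ℂ (SUq2 q × SUq2 q) :=
  hh.unitBasis.prod hh.unitBasis

lemma pairBasis_inl (p : SpinIdx) : hh.pairBasis (Sum.inl p) = (hh.unitVec p, 0) := by
  simp [pairBasis, unitBasis_apply]

lemma pairBasis_inr (p : SpinIdx) : hh.pairBasis (Sum.inr p) = (0, hh.unitVec p) := by
  simp [pairBasis, unitBasis_apply]

lemma orthonormal_pairBasis : Orthonormal ℂ fun p => hh.core (hh.pairBasis p) := by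
  have h1 := hh.orthonormal_unitVec
  constructor
  · rintro (p | p)
    · dsimp only
      rw [pairBasis_inl, norm_core_inl, h1.1]
    · dsimp only
      rw [pairBasis_inr, norm_core_inr, h1.1]
  · rintro (p | p) (p' | p') hne
    · have h2 : ⟪hh.toGNS (hh.unitVec p), hh.toGNS (hh.unitVec p')⟫_ℂ = 0 :=
        h1.2 fun h0 => hne (by rw [h0])
      dsimp only
      rw [pairBasis_inl, pairBasis_inl, inner_core, ← hh.inner_toGNS, h2]
      simp
    · dsimp only
      rw [pairBasis_inl, pairBasis_inr, inner_core]
      simp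
    · dsimp only
      rw [pairBasis_inl, pairBasis_inr, inner_core]
      simp
    · have h2 : ⟪hh.toGNS (hh.unitVec p), hh.toGNS (hh.unitVec p')⟫_ℂ = 0 :=
        h1.2 fun h0 => hne (by rw [h0])
      dsimp only
      rw [pairBasis_inr, pairBasis_inr, inner_core, ← hh.inner_toGNS,
        ← hh.inner_toGNS (hh.unitVec p), h2]
      simp

end IsHaarState

namespace SUq2

variable {q : Set.Ioo (0 : ℝ) 1}

/-! ### The diagonal form of the zeta operators -/

/-- The eigenvalue of the weight operator `Δ_L^{-a} Δ_R` on `eⁿ ▷ (aⁱ cʲ)`. -/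
def wtEig (q : Set.Ioo (0 : ℝ) 1) (a : ℝ) (i j n : ℕ) : ℝ := lWt q i j n ^ (-a) * rWt q i j

lemma wtEig_pos (a : ℝ) (i j n : ℕ) : 0 < wtEig q a i j n :=
  mul_pos (Real.rpow_pos_of_pos (lWt_pos i j n) _) (rWt_pos i j)

lemma ofReal_sq_cpow {A : ℝ} (hA : 0 < A) (z : ℂ) :
    ((A ^ 2 : ℝ) : ℂ) ^ (-z / 2) = (A : ℂ) ^ (-z) := by
  have h1 : ((A ^ 2 : ℝ) : ℂ) ≠ 0 := by exact_mod_cast (pow_pos hA 2).ne'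
  have h2 : (A : ℂ) ≠ 0 := by exact_mod_cast hA.ne'
  rw [Complex.cpow_def_of_ne_zero h1, Complex.cpow_def_of_ne_zero h2,
    ← Complex.ofReal_log (pow_pos hA 2).le, ← Complex.ofReal_log hA.le, Real.log_pow]
  congr 1; push_cast; ring

/-- The factor of the eigenvalue `q^{-n} (1 - q^{N+1}) / (q⁻¹ - q)` of `|D_q|` that depends on the
spin only. -/
def spinFactor (q : Set.Ioo (0 : ℝ) 1) (N : ℕ) : ℝ := (1 - (q : ℝ) ^ (N + 1)) / ((q : ℝ)⁻¹ - q)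

lemma spinFactor_pos (N : ℕ) : 0 < spinFactor q N :=
  div_pos (sub_pos.2 (pow_lt_one₀ q.2.1.le q.2.2 (by omega))) (inv_sub_pos q)

lemma spinFactor_ge (N : ℕ) : spinFactor q 0 ≤ spinFactor q N := by
  unfold spinFactor
  have := inv_sub_pos q
  have h1 : (q : ℝ) ^ (N + 1) ≤ (q : ℝ) ^ (0 + 1) :=
    pow_le_pow_of_le_one q.2.1.le q.2.2.le (by omega)
  gcongr

lemma spinFactor_le (N : ℕ) : spinFactor q N ≤ 1 / ((q : ℝ)⁻¹ - q) := by
  unfold spinFactor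
  have := inv_sub_pos q
  have h1 : 0 < (q : ℝ) ^ (N + 1) := pow_pos q.2.1 _
  gcongr
  linarith

lemma absEig_eq (N n : ℕ) : absEig q N n = ((q : ℝ) ^ n)⁻¹ * spinFactor q N := rfl

lemma lWt_rpow (a : ℝ) {i N n : ℕ} (hi : i ≤ N) :
    lWt q i (N - i) n ^ (-a) = (q : ℝ) ^ (a * N - 2 * a * n) := by
  rw [lWt, ← Real.rpow_intCast, ← Real.rpow_mul q.2.1.le]
  congr 1
  push_cast [hi]
  ring

lemma eig_eq (a σ : ℝ) {i N n : ℕ} (hi : i ≤ N) :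
    absEig q N n ^ (-σ) * wtEig q a i (N - i) n = spinFactor q N ^ (-σ) *
      (q : ℝ) ^ (n * σ - 2 * a * n + a * N + N - 2 * i) := by
  have hq := q.2.1
  have h1 : (((q : ℝ) ^ n)⁻¹) ^ (-σ) = (q : ℝ) ^ (n * σ) := by
    rw [Real.inv_rpow (pow_pos hq n).le, ← Real.rpow_neg (pow_pos hq n).le, neg_neg,
      ← Real.rpow_natCast, ← Real.rpow_mul hq.le]
  have h2 : rWt q i (N - i) = (q : ℝ) ^ ((N : ℝ) - 2 * i) := by
    rw [rWt, ← Real.rpow_intCast]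
    congr 1
    push_cast [hi]
    ring
  rw [absEig_eq, Real.mul_rpow (inv_pos.2 (pow_pos hq n)).le (spinFactor_pos N).le, h1, wtEig,
    lWt_rpow a hi, h2, mul_comm _ (spinFactor q N ^ (-σ)), mul_assoc, ← Real.rpow_add hq,
    ← Real.rpow_add hq]
  congr 2; ring

/-- The eigenvalues of `Δ_L^{-a} Δ_R |D_q|^{-σ}` decay geometrically in the spin for `σ > a + 1`;
this uses `a > 1`. -/
lemma eig_le {a σ : ℝ} (ha : 1 < a) (hσ : a + 1 < σ) {i N n : ℕ} (hi : i ≤ N) (hn : n ≤ N) :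
    absEig q N n ^ (-σ) * wtEig q a i (N - i) n ≤
      spinFactor q 0 ^ (-σ) * ((q : ℝ) ^ (min a (σ - a) - 1)) ^ N := by
  have hq := q.2.1
  rw [eig_eq a σ hi]
  have h1 : spinFactor q N ^ (-σ) ≤ spinFactor q 0 ^ (-σ) :=
    Real.rpow_le_rpow_of_nonpos (spinFactor_pos 0) (spinFactor_ge N) (by linarith)
  have h2 : (q : ℝ) ^ (n * σ - 2 * a * n + a * N + N - 2 * i) ≤
      ((q : ℝ) ^ (min a (σ - a) - 1)) ^ N := by
    rw [← Real.rpow_natCast, ← Real.rpow_mul hq.le]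
    -- for `i ≤ N` the exponent is at least `n (σ - 2a) + (a - 1) N`, which is affine in `n`, with
    -- the values `(a - 1) N` and `(σ - a - 1) N` at the ends
    refine Real.rpow_le_rpow_of_exponent_ge hq q.2.2.le ?_
    have hi' : (i : ℝ) ≤ N := by exact_mod_cast hi
    have hn' : (n : ℝ) ≤ N := by exact_mod_cast hn
    have hn0 : (0 : ℝ) ≤ n := Nat.cast_nonneg n
    have m1 := min_le_left a (σ - a)
    have m2 := min_le_right a (σ - a)
    nlinarith
  exact mul_le_mul h1 h2 (Real.rpow_nonneg hq.le _) (Real.rpow_nonneg (spinFactor_pos 0).le _)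

lemma summable_eig {a σ : ℝ} (ha : 1 < a) (hσ : a + 1 < σ) : Summable fun p : SpinIdx =>
    absEig q p.1 p.2.2 ^ (-σ) * wtEig q a p.2.1 (p.1 - p.2.1) p.2.2 := by
  have hq := q.2.1
  set r : ℝ := (q : ℝ) ^ (min a (σ - a) - 1) with hr
  have hr0 : 0 < r := Real.rpow_pos_of_pos hq _
  have hr1 : r < 1 := by
    refine Real.rpow_lt_one hq.le q.2.2 ?_
    have : 1 < min a (σ - a) := lt_min ha (by linarith)
    linarith
  have hpos : ∀ p : SpinIdx,
      0 ≤ absEig q p.1 p.2.2 ^ (-σ) * wtEig q a p.2.1 (p.1 - p.2.1) p.2.2 := fun p =>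
    mul_nonneg (Real.rpow_nonneg (absEig_pos _ _).le _) (wtEig_pos _ _ _ _).le
  rw [summable_sigma_of_nonneg hpos]
  refine ⟨fun N => Summable.of_finite, ?_⟩
  have hs : Summable fun N : ℕ => spinFactor q 0 ^ (-σ) *
      (((N : ℝ) ^ 2 * r ^ N) + 2 * ((N : ℝ) ^ 1 * r ^ N) + r ^ N) := by
    have hn : ‖r‖ < 1 := by rwa [Real.norm_of_nonneg hr0.le]
    refine Summable.mul_left _ ((Summable.add (summable_pow_mul_geometric_of_norm_lt_one 2 hn)
      ((summable_pow_mul_geometric_of_norm_lt_one 1 hn).mul_left 2)).add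
      (summable_geometric_of_norm_lt_one hn))
  refine hs.of_nonneg_of_le (fun N => tsum_nonneg fun c => hpos ⟨N, c⟩) fun N => ?_
  rw [tsum_fintype]
  refine (Finset.sum_le_sum fun c _ => eig_le ha hσ (Nat.lt_succ_iff.1 c.1.2)
    (Nat.lt_succ_iff.1 c.2.2)).trans (le_of_eq ?_)
  dsimp only
  rw [Finset.sum_const, Finset.card_univ, Fintype.card_prod, Fintype.card_fin, nsmul_eq_mul]
  push_cast
  ring

variable (q) in
/-- The trace of `Δ_L^{-a} Δ_R |D_q|^{-z}` over the first copy of the GNS space, as a sum over the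
spins. Over the second copy `|D_q|` is larger by the factor `q⁻¹`. -/
def zetaSum (a : ℝ) (z : ℂ) : ℂ := ∑' N : ℕ,
  (∑ i ∈ Finset.range (N + 1), rt q ^ (2 * (N - 2 * i) : ℤ)) *
    ∑ n ∈ Finset.range (N + 1),
      (absEig q N n : ℂ) ^ (-z) * (((q : ℝ) ^ (a * N - 2 * a * n) : ℝ) : ℂ)

end SUq2

namespace IsHaarState

open SUq2

variable {q : Set.Ioo (0 : ℝ) 1} {h : SUq2 q →ₗ[ℂ] ℂ}

lemma modL_unitVec (hh : IsHaarState q h) (p : SpinIdx) : modL q (hh.unitVec p) =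
    (lWt q p.2.1 (p.1 - p.2.1) p.2.2 : ℂ) • hh.unitVec p := by
  rw [unitVec, map_smul, idxVec, modL_wtVec, smul_comm]

lemma modR_unitVec (hh : IsHaarState q h) (p : SpinIdx) : modR q (hh.unitVec p) =
    (rWt q p.2.1 (p.1 - p.2.1) : ℂ) • hh.unitVec p := by
  rw [unitVec, map_smul, idxVec, modR_wtVec, smul_comm]

lemma weightOp_of_eig (hh : IsHaarState q h) (a : ℝ) {x : SUq2 q} {l r : ℝ} (hl : 0 < l)
    (hxl : modL q x = (l : ℂ) • x) (hxr : modR q x = (r : ℂ) • x) :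
    weightOp q a 1 x = ((l ^ (-a) * r : ℝ) : ℂ) • x := by
  have h1 := isDiagFun_diagFun hh.unitBasis (T := modR q)
    (fun p => by rw [unitBasis_apply]; exact hh.modR_unitVec p)
    (fun μ => μ ^ ((1 : ℝ) : ℂ)) _ _ hxr
  have h2 := isDiagFun_diagFun hh.unitBasis (T := modL q)
    (fun p => by rw [unitBasis_apply]; exact hh.modL_unitVec p)
    (fun μ => μ ^ (-(a : ℂ))) _ _ hxl
  rw [weightOp, LinearMap.comp_apply, h1, map_smul, h2, smul_smul]
  congr 1
  dsimp only
  rw [Complex.ofReal_one, Complex.cpow_one, Complex.ofReal_mul, Complex.ofReal_cpow hl.le,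
    Complex.ofReal_neg, mul_comm]

lemma weightOp_wtVec (hh : IsHaarState q h) (a : ℝ) (i j n : ℕ) :
    weightOp q a 1 (wtVec q i j n) = (wtEig q a i j n : ℂ) • wtVec q i j n :=
  hh.weightOp_of_eig a (lWt_pos i j n) (modL_wtVec i j n) (modR_wtVec i j n)

lemma weightOp_wtVec_mul (hh : IsHaarState q h) (a : ℝ) (i j n i' j' n' : ℕ) :
    weightOp q a 1 (wtVec q i j n * wtVec q i' j' n') =
      ((wtEig q a i j n * wtEig q a i' j' n' : ℝ) : ℂ) • (wtVec q i j n * wtVec q i' j' n') := by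
  have h1 : modL q (wtVec q i j n * wtVec q i' j' n') =
      ((lWt q i j n * lWt q i' j' n' : ℝ) : ℂ) • (wtVec q i j n * wtVec q i' j' n') := by
    have e1 := modL_wtVec (q := q) i j n
    have e2 := modL_wtVec (q := q) i' j' n'
    rw [modL] at *
    rw [dK_mul, e1, e2, smul_mul_smul_comm, Complex.ofReal_mul]
  have h2 : modR q (wtVec q i j n * wtVec q i' j' n') =
      ((rWt q i j * rWt q i' j' : ℝ) : ℂ) • (wtVec q i j n * wtVec q i' j' n') := by
    have e1 := modR_wtVec (q := q) i j n
    have e2 := modR_wtVec (q := q) i' j' n'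
    change rK q 2 _ = _ at e1 e2
    change rK q 2 _ = _
    rw [rK_mul, e1, e2, smul_mul_smul_comm, Complex.ofReal_mul]
  rw [hh.weightOp_of_eig a (mul_pos (lWt_pos _ _ _) (lWt_pos _ _ _)) h1 h2,
    Real.mul_rpow (lWt_pos _ _ _).le (lWt_pos _ _ _).le, wtEig, wtEig, mul_mul_mul_comm]

/-- The weight operator is symmetric. -/
lemma ip_weightOp (hh : IsHaarState q h) (a : ℝ) (i j n : ℕ) (x : SUq2 q) :
    h (star (wtVec q i j n) * weightOp q a 1 x) =
      (wtEig q a i j n : ℂ) * h (star (wtVec q i j n) * x) := by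
  suffices H : (h ∘ₗ LinearMap.mulLeft ℂ (star (wtVec q i j n))) ∘ₗ weightOp q a 1 =
      (wtEig q a i j n : ℂ) • (h ∘ₗ LinearMap.mulLeft ℂ (star (wtVec q i j n))) from
    DFunLike.congr_fun H x
  refine LinearMap.ext_on wtSpan_eq_top ?_
  rintro _ ⟨⟨i', j', n'⟩, rfl⟩
  simp only [LinearMap.comp_apply, LinearMap.smul_apply, LinearMap.mulLeft_apply,
    hh.weightOp_wtVec, map_smul, smul_eq_mul]
  by_cases he : (i, j, n) = (i', j', n')
  · simp only [Prod.mk.injEq] at he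
    obtain ⟨rfl, rfl, rfl⟩ := he
    rfl
  · rw [hh.ip_wtVec he, mul_zero, mul_zero]

lemma absDiracPow_pairBasis (hh : IsHaarState q h) (z : ℂ) (p : SpinIdx) :
    absDiracPow q z (hh.unitVec p, 0) = (absEig q p.1 p.2.2 : ℂ) ^ (-z) • (hh.unitVec p, 0) ∧
    absDiracPow q z (0, hh.unitVec p) =
      (((q : ℝ) : ℂ) ^ z * (absEig q p.1 p.2.2 : ℂ) ^ (-z)) • (0, hh.unitVec p) := by
  have hN : ∀ p : SpinIdx, (p.2.1 : ℕ) + (p.1 - p.2.1) = p.1 := fun p => by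
    have := p.2.1.2; omega
  have hl : ∀ p, (dirac q ∘ₗ dirac q) (hh.unitVec p, 0) =
      ((absEig q p.1 p.2.2 ^ 2 : ℝ) : ℂ) • (hh.unitVec p, (0 : SUq2 q)) := by
    intro p
    have := dirac_sq_inl (q := q) p.2.1 (p.1 - p.2.1) p.2.2
    rw [hN] at this
    have e : (hh.unitVec p, (0 : SUq2 q)) =
        ((‖hh.toGNS (idxVec q p)‖⁻¹ : ℝ) : ℂ) • (idxVec q p, 0) := by
      rw [Prod.smul_mk, smul_zero]; rfl
    rw [e, map_smul, idxVec, this, smul_comm]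
  have hr : ∀ p, (dirac q ∘ₗ dirac q) (0, hh.unitVec p) =
      (((absEig q p.1 p.2.2 * (q : ℝ)⁻¹) ^ 2 : ℝ) : ℂ) • ((0 : SUq2 q), hh.unitVec p) := by
    intro p
    have := dirac_sq_inr (q := q) p.2.1 (p.1 - p.2.1) p.2.2
    rw [hN] at this
    have e : ((0 : SUq2 q), hh.unitVec p) =
        ((‖hh.toGNS (idxVec q p)‖⁻¹ : ℝ) : ℂ) • (0, idxVec q p) := by
      rw [Prod.smul_mk, smul_zero]; rfl
    rw [e, map_smul, idxVec, this, smul_comm]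
  let μ : SpinIdx ⊕ SpinIdx → ℂ := Sum.elim (fun p => ((absEig q p.1 p.2.2 ^ 2 : ℝ) : ℂ))
    fun p => (((absEig q p.1 p.2.2 * (q : ℝ)⁻¹) ^ 2 : ℝ) : ℂ)
  have hdiag := isDiagFun_diagFun hh.pairBasis (T := dirac q ∘ₗ dirac q) (μ := μ) (by
    rintro (p | p)
    · rw [pairBasis_inl]; exact hl p
    · rw [pairBasis_inr]; exact hr p) (fun μ => μ ^ (-z / 2))
  have hA := absEig_pos (q := q) p.1 p.2.2
  constructor
  · rw [absDiracPow, hdiag _ _ (hl p)]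
    dsimp only
    rw [ofReal_sq_cpow hA]
  · rw [absDiracPow, hdiag _ _ (hr p)]
    dsimp only
    rw [ofReal_sq_cpow (mul_pos hA (inv_pos.2 q.2.1)),
      Complex.ofReal_mul, Complex.mul_cpow_ofReal_nonneg hA.le (inv_pos.2 q.2.1).le, mul_comm,
      Complex.ofReal_inv, Complex.cpow_neg _ z, Complex.inv_cpow, inv_inv]
    rw [Complex.arg_ofReal_of_nonneg q.2.1.le]
    exact Real.pi_pos.ne

lemma zetaOp_inl (hh : IsHaarState q h) (a : ℝ) (x : SUq2 q) (z : ℂ) (p : SpinIdx) :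
    zetaOp a 1 x z (hh.unitVec p, 0) =
      ((absEig q p.1 p.2.2 : ℂ) ^ (-z) • weightOp q a 1 (x * hh.unitVec p), 0) := by
  simp [zetaOp, (hh.absDiracPow_pairBasis z p).1]

lemma zetaOp_inr (hh : IsHaarState q h) (a : ℝ) (x : SUq2 q) (z : ℂ) (p : SpinIdx) :
    zetaOp a 1 x z (0, hh.unitVec p) = (0, (((q : ℝ) : ℂ) ^ z *
      (absEig q p.1 p.2.2 : ℂ) ^ (-z)) • weightOp q a 1 (x * hh.unitVec p)) := by
  simp [zetaOp, (hh.absDiracPow_pairBasis z p).2]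

lemma ip_unitVec_weightOp (hh : IsHaarState q h) (a : ℝ) (x : SUq2 q) (p : SpinIdx) :
    h (star (hh.unitVec p) * weightOp q a 1 (x * hh.unitVec p)) =
      (wtEig q a p.2.1 (p.1 - p.2.1) p.2.2 : ℂ) *
        wtCoef h p.2.1 (p.1 - p.2.1) p.2.2 (x * idxVec q p) := by
  have h1 := hh.norm_toGNS_sq (idxVec q p)
  rw [unitVec, mul_smul_comm, map_smul, mul_smul_comm, map_smul, star_smul', smul_mul_assoc,
    map_smul, Complex.conj_ofReal, smul_smul, smul_eq_mul, idxVec, hh.ip_weightOp, wtCoef_apply,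
    ← idxVec, ← h1]
  push_cast
  ring

lemma inner_zetaOp_inl (hh : IsHaarState q h) (a : ℝ) (x : SUq2 q) (z : ℂ) (p : SpinIdx) :
    ⟪hh.core (hh.pairBasis (Sum.inl p)), hh.core (zetaOp a 1 x z (hh.pairBasis (Sum.inl p)))⟫_ℂ =
      (absEig q p.1 p.2.2 : ℂ) ^ (-z) * (wtEig q a p.2.1 (p.1 - p.2.1) p.2.2 : ℂ) *
        wtCoef h p.2.1 (p.1 - p.2.1) p.2.2 (x * idxVec q p) := by
  rw [pairBasis_inl, zetaOp_inl, inner_core, mul_smul_comm, map_smul, hh.ip_unitVec_weightOp,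
    mul_zero, map_zero, add_zero, smul_eq_mul, mul_assoc]

lemma inner_zetaOp_inr (hh : IsHaarState q h) (a : ℝ) (x : SUq2 q) (z : ℂ) (p : SpinIdx) :
    ⟪hh.core (hh.pairBasis (Sum.inr p)), hh.core (zetaOp a 1 x z (hh.pairBasis (Sum.inr p)))⟫_ℂ =
      ((q : ℝ) : ℂ) ^ z *
      ((absEig q p.1 p.2.2 : ℂ) ^ (-z) * (wtEig q a p.2.1 (p.1 - p.2.1) p.2.2 : ℂ) *
        wtCoef h p.2.1 (p.1 - p.2.1) p.2.2 (x * idxVec q p)) := by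
  rw [pairBasis_inr, zetaOp_inr, inner_core, mul_smul_comm, map_smul, hh.ip_unitVec_weightOp,
    mul_zero, map_zero, zero_add, smul_eq_mul, mul_assoc, mul_assoc]

/-! ### Trace class -/

/-- The product of two weight vectors is an eigenvector of the weight operator, so that moving the
weight operator through `x` costs a constant. -/
lemma exists_norm_weightOp_le (hh : IsHaarState q h) (a : ℝ) (x : SUq2 q) :
    ∃ C : ℝ, ∀ p : SpinIdx, ‖hh.toGNS (weightOp q a 1 (x * hh.unitVec p))‖ ≤
      C * wtEig q a p.2.1 (p.1 - p.2.1) p.2.2 := by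
  have hx : x ∈ wtSpan q := by rw [wtSpan_eq_top]; trivial
  induction hx using Submodule.span_induction with
  | mem x hx =>
    obtain ⟨⟨i, j, n⟩, rfl⟩ := hx
    dsimp only
    obtain ⟨C, hC, hle⟩ := hh.exists_norm_mul_le (wtVec q i j n)
    refine ⟨wtEig q a i j n * C, fun p => ?_⟩
    have e : weightOp q a 1 (wtVec q i j n * hh.unitVec p) =
        ((wtEig q a i j n * wtEig q a p.2.1 (p.1 - p.2.1) p.2.2 : ℝ) : ℂ) •
          (wtVec q i j n * hh.unitVec p) := by
      rw [unitVec, mul_smul_comm, map_smul, idxVec, hh.weightOp_wtVec_mul, smul_comm]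
    have hp1 := wtEig_pos (q := q) a i j n
    have hp2 := wtEig_pos (q := q) a p.2.1 (p.1 - p.2.1) p.2.2
    rw [e, map_smul, norm_smul, Complex.norm_real, Real.norm_of_nonneg (mul_pos hp1 hp2).le]
    have h1 := hle (hh.unitVec p)
    rw [hh.orthonormal_unitVec.1, mul_one] at h1
    calc _ ≤ wtEig q a i j n * wtEig q a p.2.1 (p.1 - p.2.1) p.2.2 * C := by gcongr
      _ = _ := by ring
  | zero => exact ⟨0, fun p => by simp⟩
  | add x y _ _ hx hy =>
    obtain ⟨C, h1⟩ := hx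
    obtain ⟨C', h2⟩ := hy
    refine ⟨C + C', fun p => ?_⟩
    rw [add_mul, map_add, map_add, add_mul]
    exact (norm_add_le _ _).trans (add_le_add (h1 p) (h2 p))
  | smul r x _ hx =>
    obtain ⟨C, h1⟩ := hx
    refine ⟨‖r‖ * C, fun p => ?_⟩
    rw [smul_mul_assoc, map_smul, map_smul, norm_smul, mul_assoc]
    exact mul_le_mul_of_nonneg_left (h1 p) (norm_nonneg _)

lemma zetaTraceClass (hh : IsHaarState q h) {a : ℝ} (ha : 1 < a) (x : SUq2 q) {z : ℂ}
    (hz : a + 1 < z.re) : hh.ZetaTraceClass a 1 x z := by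
  refine exists_isTraceClassExt hh.pairBasis hh.orthonormal_pairBasis ?_
  obtain ⟨C, hC⟩ := hh.exists_norm_weightOp_le a x
  have hs := (summable_eig (q := q) ha hz).mul_left C
  have hle : ∀ p : SpinIdx, ‖(absEig q p.1 p.2.2 : ℂ) ^ (-z)‖ *
      ‖hh.toGNS (weightOp q a 1 (x * hh.unitVec p))‖ ≤
      C * (absEig q p.1 p.2.2 ^ (-z.re) * wtEig q a p.2.1 (p.1 - p.2.1) p.2.2) := by
    intro p
    rw [Complex.norm_cpow_eq_rpow_re_of_pos (absEig_pos _ _), Complex.neg_re]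
    calc _ ≤ absEig q p.1 p.2.2 ^ (-z.re) * (C * wtEig q a p.2.1 (p.1 - p.2.1) p.2.2) :=
          mul_le_mul_of_nonneg_left (hC p) (Real.rpow_nonneg (absEig_pos _ _).le _)
      _ = _ := by ring
  have hsum : Summable fun p : SpinIdx => ‖(absEig q p.1 p.2.2 : ℂ) ^ (-z)‖ *
      ‖hh.toGNS (weightOp q a 1 (x * hh.unitVec p))‖ :=
    hs.of_nonneg_of_le (fun p => by positivity) hle
  refine Summable.sum _ ?_ ?_
  · refine hsum.congr fun p => ?_
    simp only [Function.comp_apply]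
    rw [pairBasis_inl, zetaOp_inl, norm_core_inl, map_smul, norm_smul]
  · refine (hsum.mul_left ‖((q : ℝ) : ℂ) ^ z‖).congr fun p => ?_
    simp only [Function.comp_apply]
    rw [pairBasis_inr, zetaOp_inr, norm_core_inr, map_smul, norm_smul, norm_mul, mul_assoc]

/-- For `s ≤ a + 1` the diagonal entries at the highest weight corner do not tend to zero. -/
lemma not_zetaTraceClass (hh : IsHaarState q h) {a s : ℝ} (hs0 : 0 < s) (hs : s ≤ a + 1) :
    ¬ hh.ZetaTraceClass a 1 1 s := by
  rintro ⟨T, hT⟩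
  have h1 := (hT.hasSum_opTrace hh.pairBasis hh.orthonormal_pairBasis hh.denseRange_core).1
  let c : ℕ → SpinIdx := fun N => ⟨N, Fin.last N, Fin.last N⟩
  have hc : Function.Injective fun N => (Sum.inl (c N) : SpinIdx ⊕ SpinIdx) := by
    intro N M hNM
    exact congrArg Sigma.fst (Sum.inl_injective hNM)
  have h2 := (h1.comp_injective hc).tendsto_atTop_zero
  have hge : ∀ N : ℕ, (1 / ((q : ℝ)⁻¹ - q)) ^ (-s) ≤
      ‖⟪hh.core (hh.pairBasis (Sum.inl (c N))),
        hh.core (zetaOp a 1 1 s (hh.pairBasis (Sum.inl (c N))))⟫_ℂ‖ := by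
    intro N
    rw [hh.inner_zetaOp_inl, one_mul, idxVec, hh.wtCoef_self (idx_le _), mul_one, norm_mul,
      Complex.norm_cpow_eq_rpow_re_of_pos (absEig_pos _ _), Complex.norm_real,
      Real.norm_of_nonneg (wtEig_pos _ _ _ _).le, Complex.neg_re, Complex.ofReal_re,
      eig_eq a s (Nat.lt_succ_iff.1 (c N).2.1.2)]
    have e1 : (1 / ((q : ℝ)⁻¹ - q)) ^ (-s) ≤ spinFactor q N ^ (-s) :=
      Real.rpow_le_rpow_of_nonpos (spinFactor_pos N) (spinFactor_le N) (by linarith)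
    have e2 : 1 ≤ (q : ℝ) ^ ((N : ℝ) * s - 2 * a * N + a * N + N - 2 * N) := by
      refine Real.one_le_rpow_of_pos_of_le_one_of_nonpos q.2.1 q.2.2.le ?_
      have : (0 : ℝ) ≤ N := Nat.cast_nonneg N
      nlinarith
    calc _ ≤ spinFactor q N ^ (-s) * 1 := by rwa [mul_one]
      _ ≤ _ := mul_le_mul_of_nonneg_left e2 (Real.rpow_nonneg (spinFactor_pos N).le _)
  have h3 := ge_of_tendsto' h2 hge
  have h4 : 0 < (1 / ((q : ℝ)⁻¹ - q)) ^ (-s) :=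
    Real.rpow_pos_of_pos (one_div_pos.2 (inv_sub_pos q)) _
  linarith

lemma spectralDim_eq (hh : IsHaarState q h) {a : ℝ} (ha : 1 < a) :
    hh.spectralDim a 1 = a + 1 := by
  have : {s : ℝ | 0 < s ∧ hh.ZetaTraceClass a 1 1 s} = Set.Ioi (a + 1) := by
    ext s
    constructor
    · rintro ⟨h0, h1⟩
      by_contra h2
      exact hh.not_zetaTraceClass h0 (not_lt.1 h2) h1
    · intro hs
      have hs' : a + 1 < s := hs
      exact ⟨by linarith, hh.zetaTraceClass ha 1 (by simpa using hs')⟩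
  rw [spectralDim, this, csInf_Ioi]

/-! ### The zeta functions are multiples of each other -/

/-- The zeta function of `x` is `h x` times that of `1`: for each spin and each left weight the
trace over the weight vectors is a multiple of `qTrace`. -/
lemma zeta_eq (hh : IsHaarState q h) {a : ℝ} (ha : 1 < a) (x : SUq2 q) {z : ℂ}
    (hz : a + 1 < z.re) :
    hh.zeta a 1 x z = h x * ((1 + ((q : ℝ) : ℂ) ^ z) * zetaSum q a z) := by
  have htr := hh.zetaTraceClass ha x hz
  obtain ⟨T, hT⟩ := htr
  have h1 := (hT.hasSum_opTrace hh.pairBasis hh.orthonormal_pairBasis hh.denseRange_core).1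
  have hs := h1.of_norm
  rw [zeta, coreTrace_eq_tsum hh.pairBasis hh.orthonormal_pairBasis hh.denseRange_core ⟨T, hT⟩]
  let G : SpinIdx → ℂ := fun p =>
    (absEig q p.1 p.2.2 : ℂ) ^ (-z) * (wtEig q a p.2.1 (p.1 - p.2.1) p.2.2 : ℂ) *
        wtCoef h p.2.1 (p.1 - p.2.1) p.2.2 (x * idxVec q p)
  have hG : Summable G :=
    (hs.comp_injective Sum.inl_injective).congr fun p => (hh.inner_zetaOp_inl a x z p)
  have e1 : ∑' i, ⟪hh.core (hh.pairBasis i), hh.core (zetaOp a 1 x z (hh.pairBasis i))⟫_ℂ =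
      ∑' p, G p + ((q : ℝ) : ℂ) ^ z * ∑' p, G p := by
    refine HasSum.tsum_eq (HasSum.sum ?_ ?_)
    · refine hG.hasSum.congr_fun fun p => ?_
      exact (hh.inner_zetaOp_inl a x z p)
    · refine (hG.hasSum.mul_left (((q : ℝ) : ℂ) ^ z)).congr_fun fun p => ?_
      exact (hh.inner_zetaOp_inr a x z p)
  have e2 : ∑' p, G p = h x * zetaSum q a z := by
    rw [hG.tsum_sigma, zetaSum, ← tsum_mul_left]
    refine tsum_congr fun N => ?_
    rw [tsum_fintype, Fintype.sum_prod_type_right, Finset.mul_sum, Finset.mul_sum,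
      Finset.sum_range]
    refine Finset.sum_congr rfl fun n _ => ?_
    have e3 := hh.qTrace_eq (Nat.lt_succ_iff.1 n.2) x
    rw [← mul_assoc, mul_comm (h x), ← e3, qTrace_apply, Finset.sum_range, Finset.sum_mul]
    refine Finset.sum_congr rfl fun i _ => ?_
    have hi : (i : ℕ) ≤ N := Nat.lt_succ_iff.1 i.2
    have e4 : rWt q i (N - i) = (q : ℝ) ^ (N - 2 * i : ℤ) := by
      rw [rWt]; congr 1; push_cast [hi]; ring
    simp only [G, wtEig, lWt_rpow a hi, idxVec]
    rw [rt_zpow_two_mul, e4]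
    push_cast
    ring
  rw [e1, e2]
  ring

end IsHaarState

/-! ### Analytic continuation and the residue -/

lemma HasResidue.unique {f : ℂ → ℂ} {n : ℝ} {r s : ℂ} (hr : HasResidue f n r)
    (hs : HasResidue f n s) : r = s := by
  obtain ⟨F, -, hF, hFr⟩ := hr
  obtain ⟨G, -, hG, hGs⟩ := hs
  -- both extensions agree with `f` along `n + t`, `t ↓ 0`
  have hu : Filter.Tendsto (fun t : ℝ => (n : ℂ) + t) (𝓝[>] 0) (𝓝[≠] (n : ℂ)) := by
    refine tendsto_nhdsWithin_iff.2 ⟨?_, ?_⟩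
    · have : Filter.Tendsto (fun t : ℝ => (n : ℂ) + t) (𝓝 0) (𝓝 ((n : ℂ) + (0 : ℝ))) :=
        (continuous_const.add Complex.continuous_ofReal).tendsto 0
      rw [Complex.ofReal_zero, add_zero] at this
      exact this.mono_left nhdsWithin_le_nhds
    · filter_upwards [self_mem_nhdsWithin] with t ht
      have ht' : (0 : ℝ) < t := ht
      simpa using ht'.ne'
  have hu' := hu.mono_right nhdsWithin_le_nhds
  refine tendsto_nhds_unique (hFr.comp hu) ((hGs.comp hu).congr' ?_)
  filter_upwards [hu'.eventually hF, hu'.eventually hG, self_mem_nhdsWithin] with t h1 h2 ht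
  have ht' : (0 : ℝ) < t := ht
  have : n < ((n : ℂ) + t).re := by simpa using ht'
  simp only [Function.comp_apply]
  rw [h1 this, h2 this]

lemma HasResidue.residueAt_eq {f : ℂ → ℂ} {n : ℝ} {r : ℂ} (hr : HasResidue f n r) :
    residueAt f n = r := by
  have h : ∃ r, HasResidue f n r := ⟨r, hr⟩
  rw [residueAt, dif_pos h]
  exact h.choose_spec.unique hr

/-- The residue of `c (A / (1 - p) + B)` at a simple zero of `1 - p`. -/
lemma hasResidue_of_simple_zero {f c A B p : ℂ → ℂ} {n : ℝ} {p' : ℂ}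
    (hc : AnalyticAt ℂ c n) (hA : AnalyticAt ℂ A n) (hB : AnalyticAt ℂ B n)
    (hp : AnalyticAt ℂ p n) (hp1 : p n = 1) (hp' : HasDerivAt p p' n) (hp0 : p' ≠ 0)
    (hf : ∀ᶠ z in 𝓝 (n : ℂ), n < z.re → f z = c z * (A z / (1 - p z) + B z)) :
    HasResidue f n (c n * (A n / -p')) := by
  refine ⟨fun z => c z * (A z / (1 - p z) + B z), ?_, ?_, ?_⟩
  · exact hc.meromorphicAt.mul ((hA.meromorphicAt.div
      ((MeromorphicAt.const 1 _).sub hp.meromorphicAt)).add hB.meromorphicAt)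
  · filter_upwards [hf] with z hz h1 using (hz h1).symm
  · have hsub : Filter.Tendsto (fun z : ℂ => z - n) (𝓝[≠] (n : ℂ)) (𝓝 0) := by
      have : Filter.Tendsto (fun z : ℂ => z - n) (𝓝 (n : ℂ)) (𝓝 ((n : ℂ) - n)) :=
        (continuous_id.sub continuous_const).tendsto _
      rw [sub_self] at this
      exact this.mono_left nhdsWithin_le_nhds
    have hslope := (hasDerivAt_iff_tendsto_slope.1 hp').neg.inv₀ (neg_ne_zero.2 hp0)
    have h1 := (hc.continuousAt.tendsto.mono_left nhdsWithin_le_nhds).mul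
      (((hA.continuousAt.tendsto.mono_left nhdsWithin_le_nhds).mul hslope).add
        (hsub.mul (hB.continuousAt.tendsto.mono_left (nhdsWithin_le_nhds (s := {(n : ℂ)}ᶜ)))))
    rw [zero_mul, add_zero, ← div_eq_mul_inv] at h1
    refine h1.congr fun z => ?_
    rw [slope_def_field, hp1, ← neg_div, inv_div, neg_sub]
    dsimp only
    ring

lemma norm_ofReal_cpow_sub_one_le {x q : ℝ} (hx : 0 ≤ x) (hxq : x ≤ q) (hq : q < 1) (w : ℂ) :
    ‖((1 - x : ℝ) : ℂ) ^ w - 1‖ ≤ ‖w‖ / (1 - q) * Real.exp (‖w‖ / (1 - q)) * x := by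
  have h1 : 0 < 1 - x := by linarith
  have hq' : 0 < 1 - q := by linarith
  have hlog : |Real.log (1 - x)| ≤ x / (1 - q) := by
    rw [abs_of_nonpos (Real.log_nonpos h1.le (by linarith)), ← Real.log_inv]
    refine (Real.log_le_sub_one_of_pos (inv_pos.2 h1)).trans ?_
    have : (1 - x)⁻¹ - 1 = x / (1 - x) := by field_simp; ring
    rw [this]
    gcongr
  rw [Complex.cpow_def_of_ne_zero (by exact_mod_cast h1.ne'), ← Complex.ofReal_log h1.le]
  have h2 := Complex.norm_exp_sub_sum_le_norm_mul_exp ((Real.log (1 - x) : ℂ) * w) 1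
  rw [Finset.sum_range_one, pow_zero, Nat.factorial_zero, Nat.cast_one, div_one, pow_one,
    norm_mul, Complex.norm_real, Real.norm_eq_abs] at h2
  refine h2.trans ?_
  have h3 : |Real.log (1 - x)| * ‖w‖ ≤ ‖w‖ / (1 - q) * x := by
    calc _ ≤ x / (1 - q) * ‖w‖ := by gcongr
      _ = _ := by ring
  have h4 : |Real.log (1 - x)| * ‖w‖ ≤ ‖w‖ / (1 - q) := by
    refine h3.trans ?_
    have : 0 ≤ ‖w‖ / (1 - q) := by positivity
    exact mul_le_of_le_one_right this (by linarith)
  calc _ ≤ ‖w‖ / (1 - q) * x * Real.exp (‖w‖ / (1 - q)) := by gcongr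
    _ = _ := by ring

namespace SUq2

variable {q : Set.Ioo (0 : ℝ) 1}

variable (q) in
/-- The factor of the `N`-th term of the zeta function that tends to `1`. -/
def zetaUnit (N : ℕ) (z : ℂ) : ℂ :=
  (1 - ((q : ℝ) : ℂ) ^ (2 * (N + 1))) * ((1 - (q : ℝ) ^ (N + 1) : ℝ) : ℂ) ^ (-z)

lemma ofReal_q_ne : ((q : ℝ) : ℂ) ≠ 0 := by exact_mod_cast q.2.1.ne'

/-- Absorbing `1 - q^{N+1}` from `1 - q^{2(N+1)}` into the power makes the limit `1` visible. -/
lemma zetaUnit_eq (N : ℕ) (z : ℂ) : zetaUnit q N z =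
    (1 + ((q : ℝ) : ℂ) ^ (N + 1)) * ((1 - (q : ℝ) ^ (N + 1) : ℝ) : ℂ) ^ (1 - z) := by
  have h1 : (q : ℝ) ^ (N + 1) < 1 := pow_lt_one₀ q.2.1.le q.2.2 N.succ_ne_zero
  have h2 : ((1 - (q : ℝ) ^ (N + 1) : ℝ) : ℂ) ≠ 0 := by
    exact_mod_cast (sub_pos.2 h1).ne'
  rw [zetaUnit, sub_eq_add_neg 1 z, Complex.cpow_add _ _ h2, Complex.cpow_one]
  push_cast
  ring

lemma exists_norm_zetaUnit_sub_one_le (R : ℝ) :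
    ∃ C, 0 ≤ C ∧ ∀ (N : ℕ) (z : ℂ), ‖z‖ ≤ R → ‖zetaUnit q N z - 1‖ ≤ C * (q : ℝ) ^ N := by
  have hq := q.2.1
  have hq1 := q.2.2
  have hq' : 0 < 1 - (q : ℝ) := by linarith
  set K : ℝ := (1 + |R|) / (1 - q) * Real.exp ((1 + |R|) / (1 - q)) with hK
  have hK0 : 0 ≤ K := by positivity
  refine ⟨2 * K + 1, by positivity, fun N z hz => ?_⟩
  have hxq : (q : ℝ) ^ (N + 1) ≤ q := pow_le_of_le_one hq.le hq1.le N.succ_ne_zero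
  have hx0 : 0 ≤ (q : ℝ) ^ (N + 1) := by positivity
  have hw : ‖1 - z‖ ≤ 1 + |R| := by
    refine (norm_sub_le _ _).trans ?_
    rw [norm_one]
    linarith [le_abs_self R]
  have h1 : ‖((1 - (q : ℝ) ^ (N + 1) : ℝ) : ℂ) ^ (1 - z) - 1‖ ≤ K * (q : ℝ) ^ (N + 1) := by
    refine (norm_ofReal_cpow_sub_one_le hx0 hxq hq1 _).trans ?_
    rw [hK]
    gcongr
  have e : zetaUnit q N z - 1 = (1 + ((q : ℝ) : ℂ) ^ (N + 1)) *
      (((1 - (q : ℝ) ^ (N + 1) : ℝ) : ℂ) ^ (1 - z) - 1) + ((q : ℝ) : ℂ) ^ (N + 1) := by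
    rw [zetaUnit_eq]; ring
  have hn : ‖((q : ℝ) : ℂ) ^ (N + 1)‖ = (q : ℝ) ^ (N + 1) := by
    rw [norm_pow, Complex.norm_real, Real.norm_of_nonneg hq.le]
  have h2 : ‖1 + ((q : ℝ) : ℂ) ^ (N + 1)‖ ≤ 2 := by
    refine (norm_add_le _ _).trans ?_
    rw [hn, norm_one]; linarith
  have h3 : (q : ℝ) ^ (N + 1) ≤ (q : ℝ) ^ N := pow_le_pow_of_le_one hq.le hq1.le N.le_succ
  calc ‖zetaUnit q N z - 1‖ ≤ 2 * (K * (q : ℝ) ^ (N + 1)) + (q : ℝ) ^ (N + 1) := by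
        rw [e]
        refine (norm_add_le _ _).trans ?_
        rw [norm_mul, hn]
        gcongr
    _ = (2 * K + 1) * (q : ℝ) ^ (N + 1) := by ring
    _ ≤ _ := by gcongr

lemma differentiable_zetaUnit (N : ℕ) : Differentiable ℂ (zetaUnit q N) := by
  have h1 : (q : ℝ) ^ (N + 1) < 1 := pow_lt_one₀ q.2.1.le q.2.2 N.succ_ne_zero
  have h2 : ((1 - (q : ℝ) ^ (N + 1) : ℝ) : ℂ) ≠ 0 := by
    exact_mod_cast (sub_pos.2 h1).ne'
  unfold zetaUnit
  exact (differentiable_neg.const_cpow (Or.inl h2)).const_mul _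

lemma differentiable_q_cpow (c : ℂ) : Differentiable ℂ fun z => ((q : ℝ) : ℂ) ^ (z - c) :=
  (differentiable_id.sub_const c).const_cpow (Or.inl ofReal_q_ne)

lemma norm_q_cpow (z : ℂ) : ‖((q : ℝ) : ℂ) ^ z‖ = (q : ℝ) ^ z.re :=
  Complex.norm_cpow_eq_rpow_re_of_pos q.2.1 z

variable (q) in
/-- What is left of the leading series after its geometric part is removed. -/
def zetaRem (c z : ℂ) : ℂ := ∑' N : ℕ, (zetaUnit q N z - 1) * (((q : ℝ) : ℂ) ^ (z - c)) ^ N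

variable (q) in
/-- The series of subleading terms of the zeta function. -/
def zetaSub (t z : ℂ) : ℂ := ∑' N : ℕ, zetaUnit q N z * t ^ N

/-- On the disc of radius `1/2` about `n` the ratio `q^{z - n}` is at most `q^{-1/2}` in norm, which the
decay `O(q^N)` of the first factor outweighs. -/
lemma zetaRem_bound (n : ℂ) : ∃ u : ℕ → ℝ, Summable u ∧ ∀ N : ℕ, ∀ z ∈ Metric.ball n (1 / 2),
    ‖(zetaUnit q N z - 1) * (((q : ℝ) : ℂ) ^ (z - n)) ^ N‖ ≤ u N := by
  have hq := q.2.1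
  obtain ⟨C, hC0, hC⟩ := exists_norm_zetaUnit_sub_one_le (q := q) (‖n‖ + 1 / 2)
  refine ⟨fun N => C * ((q : ℝ) ^ (1 / 2 : ℝ)) ^ N, Summable.mul_left _
    (summable_geometric_of_lt_one (Real.rpow_nonneg hq.le _)
      (Real.rpow_lt_one hq.le q.2.2 (by norm_num))), fun N z hz => ?_⟩
  have hz' : ‖z - n‖ < 1 / 2 := by rwa [← dist_eq_norm]
  have hz1 : ‖z‖ ≤ ‖n‖ + 1 / 2 := by
    have := norm_add_le (z - n) n
    rw [sub_add_cancel] at this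
    linarith
  have hre : -(1 / 2) ≤ (z - n).re := by
    have := (abs_le.1 (Complex.abs_re_le_norm (z - n))).1
    linarith
  have hp : ‖((q : ℝ) : ℂ) ^ (z - n)‖ ≤ (q : ℝ) ^ (-(1 / 2) : ℝ) := by
    rw [norm_q_cpow]
    exact Real.rpow_le_rpow_of_exponent_ge hq q.2.2.le hre
  rw [norm_mul, norm_pow]
  calc _ ≤ C * (q : ℝ) ^ N * ((q : ℝ) ^ (-(1 / 2) : ℝ)) ^ N := by
        gcongr
        exact hC N z hz1
    _ = C * ((q : ℝ) ^ (1 / 2 : ℝ)) ^ N := by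
        rw [mul_assoc, ← mul_pow]
        congr 2
        nth_rewrite 1 [← Real.rpow_one (q : ℝ)]
        rw [← Real.rpow_add hq]
        norm_num

lemma zetaSub_bound (n : ℂ) {t : ℂ} (ht : ‖t‖ < 1) : ∃ u : ℕ → ℝ, Summable u ∧
    ∀ N : ℕ, ∀ z ∈ Metric.ball n (1 / 2), ‖zetaUnit q N z * t ^ N‖ ≤ u N := by
  have hq := q.2.1
  obtain ⟨C, hC0, hC⟩ := exists_norm_zetaUnit_sub_one_le (q := q) (‖n‖ + 1 / 2)
  refine ⟨fun N => (C + 1) * ‖t‖ ^ N, Summable.mul_left _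
    (summable_geometric_of_lt_one (norm_nonneg _) ht), fun N z hz => ?_⟩
  have hz' : ‖z - n‖ < 1 / 2 := by rwa [← dist_eq_norm]
  have hz1 : ‖z‖ ≤ ‖n‖ + 1 / 2 := by
    have := norm_add_le (z - n) n
    rw [sub_add_cancel] at this
    linarith
  have h1 : ‖zetaUnit q N z‖ ≤ C + 1 := by
    have := norm_add_le (zetaUnit q N z - 1) 1
    rw [sub_add_cancel, norm_one] at this
    have h2 : C * (q : ℝ) ^ N ≤ C :=
      mul_le_of_le_one_right hC0 (pow_le_one₀ hq.le q.2.2.le)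
    linarith [hC N z hz1]
  rw [norm_mul, norm_pow]
  exact mul_le_mul_of_nonneg_right h1 (by positivity)

lemma analyticAt_zetaRem (n : ℂ) : AnalyticAt ℂ (zetaRem q n) n := by
  obtain ⟨u, hu, hb⟩ := zetaRem_bound (q := q) n
  have : DifferentiableOn ℂ (zetaRem q n) (Metric.ball n (1 / 2)) :=
    Complex.differentiableOn_tsum_of_summable_norm hu
      (fun N => (((differentiable_zetaUnit N).sub_const 1).mul
        ((differentiable_q_cpow n).pow N)).differentiableOn) Metric.isOpen_ball hb
  exact this.analyticAt (Metric.ball_mem_nhds n (by norm_num))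

lemma analyticAt_zetaSub (n : ℂ) {t : ℂ} (ht : ‖t‖ < 1) : AnalyticAt ℂ (zetaSub q t) n := by
  obtain ⟨u, hu, hb⟩ := zetaSub_bound (q := q) n ht
  have : DifferentiableOn ℂ (zetaSub q t) (Metric.ball n (1 / 2)) :=
    Complex.differentiableOn_tsum_of_summable_norm hu
      (fun N => ((differentiable_zetaUnit N).mul_const _).differentiableOn) Metric.isOpen_ball hb
  exact this.analyticAt (Metric.ball_mem_nhds n (by norm_num))

lemma sum_rt_zpow (N : ℕ) :
    ∑ i ∈ Finset.range (N + 1), rt q ^ (2 * (N - 2 * i) : ℤ) =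
      (((q : ℝ) : ℂ) ^ N)⁻¹ * (1 - ((q : ℝ) : ℂ) ^ (2 * (N + 1))) / (1 - ((q : ℝ) : ℂ) ^ 2) := by
  have hQ := ofReal_q_ne (q := q)
  have h2 : 1 - ((q : ℝ) : ℂ) ^ 2 ≠ 0 := by
    have : (1 - (q : ℝ) ^ 2) ≠ 0 := by nlinarith [q.2.1, q.2.2]
    exact_mod_cast this
  have e : ∀ i ∈ Finset.range (N + 1), rt q ^ (2 * (N - 2 * i) : ℤ) =
      (((q : ℝ) : ℂ) ^ N)⁻¹ * (((q : ℝ) : ℂ) ^ 2) ^ (N - i) := by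
    intro i hi
    have hi' : i ≤ N := Nat.lt_succ_iff.1 (Finset.mem_range.1 hi)
    rw [rt_zpow_two_mul, Complex.ofReal_zpow, ← pow_mul, ← zpow_natCast, ← zpow_natCast,
      ← zpow_neg, ← zpow_add₀ hQ]
    congr 1
    push_cast [hi']
    ring
  have h3 := mul_neg_geom_sum (((q : ℝ) : ℂ) ^ 2) (N + 1)
  have h4 := Finset.sum_range_reflect (fun i => (((q : ℝ) : ℂ) ^ 2) ^ i) (N + 1)
  simp only [Nat.add_sub_cancel] at h4
  rw [Finset.sum_congr rfl e, ← Finset.mul_sum, h4, mul_div_assoc, pow_mul]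
  congr 1
  rw [eq_div_iff h2, mul_comm]
  exact h3

lemma absEig_cpow (N n : ℕ) (z : ℂ) : (absEig q N n : ℂ) ^ (-z) =
    (((q : ℝ) : ℂ) ^ z) ^ n * ((((q : ℝ)⁻¹ - q : ℝ) : ℂ) ^ z *
      ((1 - (q : ℝ) ^ (N + 1) : ℝ) : ℂ) ^ (-z)) := by
  have hq := q.2.1
  have hl : 0 < (q : ℝ)⁻¹ - q := inv_sub_pos q
  have h1 : 0 < 1 - (q : ℝ) ^ (N + 1) := sub_pos.2 (pow_lt_one₀ hq.le q.2.2 N.succ_ne_zero)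
  have key : ∀ {x : ℝ}, 0 < x → ((x⁻¹ : ℝ) : ℂ) ^ (-z) = (x : ℂ) ^ z := by
    intro x hx
    rw [Complex.ofReal_inv, Complex.inv_cpow _ _ (by
      rw [Complex.arg_ofReal_of_nonneg hx.le]; exact Real.pi_pos.ne), ← Complex.cpow_neg, neg_neg]
  have hpow : (((q : ℝ) ^ n : ℝ) : ℂ) ^ z = (((q : ℝ) : ℂ) ^ z) ^ n := by
    induction n with
    | zero => simp
    | succ n ih =>
      rw [pow_succ, Complex.ofReal_mul, Complex.mul_cpow_ofReal_nonneg (by positivity) hq.le, ih,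
        pow_succ]
  rw [absEig_eq, spinFactor, div_eq_mul_inv, Complex.ofReal_mul,
    Complex.mul_cpow_ofReal_nonneg (by positivity) (by positivity), Complex.ofReal_mul,
    Complex.mul_cpow_ofReal_nonneg h1.le (by positivity), key hl, key (pow_pos hq n), hpow,
    mul_comm (((1 - (q : ℝ) ^ (N + 1) : ℝ) : ℂ) ^ (-z))]

/-- The zeta function in closed form: after summing over the weights inside each spin, the
sum over the spins is a geometric series of ratio `q^{z - a - 1}` plus holomorphic corrections. -/
lemma zetaSum_eq {a : ℝ} {z : ℂ} (hz : z ∈ Metric.ball ((a : ℂ) + 1) (1 / 2))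
    (hz1 : a + 1 < z.re) (hz2 : z.re < 2 * a) :
    zetaSum q a z = (((q : ℝ)⁻¹ - q : ℝ) : ℂ) ^ z /
      ((1 - ((q : ℝ) : ℂ) ^ 2) * (((q : ℝ) : ℂ) ^ (z - 2 * a) - 1)) *
      (((q : ℝ) : ℂ) ^ (z - 2 * a) / (1 - ((q : ℝ) : ℂ) ^ (z - (a + 1))) +
        (((q : ℝ) : ℂ) ^ (z - 2 * a) * zetaRem q (a + 1) z -
          zetaSub q (((q : ℝ) : ℂ) ^ ((a : ℂ) - 1)) z)) := by
  have hq := q.2.1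
  have hQ := ofReal_q_ne (q := q)
  set Q : ℂ := ((q : ℝ) : ℂ) with hQdef
  set L : ℂ := (((q : ℝ)⁻¹ - q : ℝ) : ℂ) ^ z
  set r : ℂ := Q ^ (z - 2 * a) with hr
  set p : ℂ := Q ^ (z - (a + 1)) with hp
  set t : ℂ := Q ^ ((a : ℂ) - 1) with ht
  have hr1 : r - 1 ≠ 0 := by
    intro h0
    have h1 : ‖r‖ = 1 := by rw [sub_eq_zero.1 h0, norm_one]
    have h2 : 1 < ‖r‖ := by
      rw [hr, hQdef, norm_q_cpow]
      refine Real.one_lt_rpow_of_pos_of_lt_one_of_neg hq q.2.2 ?_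
      simp; linarith
    linarith
  -- `p` and `t` are the ratios of the two geometric series that the sums inside each spin leave
  have hp1 : ‖p‖ < 1 := by
    rw [hp, hQdef, norm_q_cpow]
    refine Real.rpow_lt_one hq.le q.2.2 ?_
    simp; linarith
  have ht1 : ‖t‖ < 1 := by
    rw [ht, hQdef, norm_q_cpow]
    refine Real.rpow_lt_one hq.le q.2.2 ?_
    simp; linarith
  obtain ⟨u, hu, hb⟩ := zetaRem_bound (q := q) ((a : ℂ) + 1)
  obtain ⟨v, hv, hb'⟩ := zetaSub_bound (q := q) ((a : ℂ) + 1) ht1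
  have s1 := (Summable.of_norm_bounded hu fun N => hb N z hz).hasSum
  have s2 := (Summable.of_norm_bounded hv fun N => hb' N z hz).hasSum
  have s3 := hasSum_geometric_of_norm_lt_one hp1
  have key := (((s3.add s1).mul_left r).sub s2).mul_left (L / ((1 - Q ^ 2) * (r - 1)))
  rw [zetaSum]
  refine (HasSum.tsum_eq (key.congr_fun fun N => ?_)).trans ?_
  · have e1 : ∀ n ∈ Finset.range (N + 1), (absEig q N n : ℂ) ^ (-z) *
        (((q : ℝ) ^ (a * N - 2 * a * n) : ℝ) : ℂ) =
        L * ((1 - (q : ℝ) ^ (N + 1) : ℝ) : ℂ) ^ (-z) * (Q ^ (a : ℂ)) ^ N * r ^ n := by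
      intro n _
      have e2 : r ^ n = (Q ^ z) ^ n * Q ^ (-(2 * a * n) : ℂ) := by
        rw [hr, ← Complex.cpow_nat_mul, ← Complex.cpow_nat_mul, ← Complex.cpow_add _ _ hQ]
        congr 1; ring
      have e3 : (((q : ℝ) ^ (a * N - 2 * a * n) : ℝ) : ℂ) =
          (Q ^ (a : ℂ)) ^ N * Q ^ (-(2 * a * n) : ℂ) := by
        rw [Complex.ofReal_cpow hq.le, ← Complex.cpow_nat_mul, ← Complex.cpow_add _ _ hQ]
        congr 1; push_cast; ring
      rw [absEig_cpow, e2, e3]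
      ring
    rw [Finset.sum_congr rfl e1, ← Finset.mul_sum, geom_sum_eq (sub_ne_zero.1 hr1), sum_rt_zpow,
      zetaUnit]
    have e4 : p ^ N = (Q ^ N)⁻¹ * (Q ^ (a : ℂ)) ^ N * r ^ N := by
      rw [← inv_pow, ← mul_pow, ← mul_pow, ← Complex.cpow_neg_one, ← Complex.cpow_add _ _ hQ, hr,
        ← Complex.cpow_add _ _ hQ, hp]
      congr 2; ring
    have e5 : t ^ N = (Q ^ N)⁻¹ * (Q ^ (a : ℂ)) ^ N := by
      rw [← inv_pow, ← mul_pow, ← Complex.cpow_neg_one, ← Complex.cpow_add _ _ hQ, ht]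
      congr 2; ring
    rw [e4, e5, pow_succ]
    simp only [← hQdef]
    have h2 : 1 - Q ^ 2 ≠ 0 := by
      have : (1 - (q : ℝ) ^ 2) ≠ 0 := by nlinarith [q.2.1, q.2.2]
      rw [hQdef]
      exact_mod_cast this
    field_simp
    ring
  · rw [← zetaRem, ← zetaSub]
    ring

variable (q) in
/-- The residue of `ζ_1` at `a + 1`. -/
def zetaRes (a : ℝ) : ℂ :=
  (1 + ((q : ℝ) : ℂ) ^ ((a : ℂ) + 1)) * ((((q : ℝ)⁻¹ - q : ℝ) : ℂ) ^ ((a : ℂ) + 1) /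
    ((1 - ((q : ℝ) : ℂ) ^ 2) * (((q : ℝ) : ℂ) ^ ((a : ℂ) + 1 - 2 * a) - 1))) *
    (((q : ℝ) : ℂ) ^ ((a : ℂ) + 1 - 2 * a) / -Complex.log ((q : ℝ) : ℂ))

lemma q_cpow_sub_one_ne {a : ℝ} (ha : 1 < a) :
    ((q : ℝ) : ℂ) ^ ((a : ℂ) + 1 - 2 * a) - 1 ≠ 0 := by
  intro h0
  have h1 : ‖((q : ℝ) : ℂ) ^ ((a : ℂ) + 1 - 2 * a)‖ = 1 := by rw [sub_eq_zero.1 h0, norm_one]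
  rw [norm_q_cpow] at h1
  have h2 := Real.one_lt_rpow_of_pos_of_lt_one_of_neg q.2.1 q.2.2
    (z := ((a : ℂ) + 1 - 2 * a).re) (by simp; linarith)
  linarith

lemma log_q_ne : Complex.log ((q : ℝ) : ℂ) ≠ 0 := by
  rw [← Complex.ofReal_log q.2.1.le]
  exact_mod_cast (Real.log_neg q.2.1 q.2.2).ne

lemma one_sub_q_sq_ne : 1 - ((q : ℝ) : ℂ) ^ 2 ≠ 0 := by
  have : (1 - (q : ℝ) ^ 2) ≠ 0 := by nlinarith [q.2.1, q.2.2]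
  exact_mod_cast this

lemma zetaRes_ne_zero {a : ℝ} (ha : 1 < a) : zetaRes q a ≠ 0 := by
  have hl : (((q : ℝ)⁻¹ - q : ℝ) : ℂ) ≠ 0 := by exact_mod_cast (inv_sub_pos q).ne'
  have h1 : 1 + ((q : ℝ) : ℂ) ^ ((a : ℂ) + 1) ≠ 0 := by
    intro h0
    have h1 : ‖((q : ℝ) : ℂ) ^ ((a : ℂ) + 1)‖ = 1 := by
      rw [← neg_eq_of_add_eq_zero_right h0, norm_neg, norm_one]
    rw [norm_q_cpow] at h1
    have h2 := Real.rpow_lt_one q.2.1.le q.2.2 (z := ((a : ℂ) + 1).re) (by simp; linarith)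
    linarith
  have hc : ∀ {b : ℂ} (w : ℂ), b ≠ 0 → b ^ w ≠ 0 := fun w hb =>
    (Complex.cpow_ne_zero_iff.2 (Or.inl hb))
  exact mul_ne_zero (mul_ne_zero h1 (div_ne_zero (hc _ hl)
    (mul_ne_zero one_sub_q_sq_ne (q_cpow_sub_one_ne ha))))
    (div_ne_zero (hc _ ofReal_q_ne) (neg_ne_zero.2 log_q_ne))

end SUq2

namespace IsHaarState

open SUq2

variable {q : Set.Ioo (0 : ℝ) 1} {h : SUq2 q →ₗ[ℂ] ℂ}

lemma hasResidue_zeta (hh : IsHaarState q h) {a : ℝ} (ha : 1 < a) (x : SUq2 q) :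
    HasResidue (hh.zeta a 1 x) (a + 1) (h x * zetaRes q a) := by
  have hball : ∀ᶠ z : ℂ in 𝓝 ((a : ℂ) + 1), z ∈ Metric.ball ((a : ℂ) + 1) (1 / 2) :=
    Metric.ball_mem_nhds _ (by norm_num)
  have hre : ∀ᶠ z : ℂ in 𝓝 ((a : ℂ) + 1), z.re < 2 * a :=
    (isOpen_lt Complex.continuous_re continuous_const).mem_nhds (by simp; linarith)
  have hden := mul_ne_zero (one_sub_q_sq_ne (q := q)) (q_cpow_sub_one_ne (q := q) ha)
  have hl : (((q : ℝ)⁻¹ - q : ℝ) : ℂ) ≠ 0 := by exact_mod_cast (inv_sub_pos q).ne'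
  have ht1 : ‖((q : ℝ) : ℂ) ^ ((a : ℂ) - 1)‖ < 1 := by
    rw [norm_q_cpow]
    exact Real.rpow_lt_one q.2.1.le q.2.2 (by simp; linarith)
  have hn : (((a + 1 : ℝ)) : ℂ) = (a : ℂ) + 1 := by push_cast; rfl
  have hr := (differentiable_q_cpow (q := q) (2 * a)).analyticAt ((a : ℂ) + 1)
  have hp := (differentiable_q_cpow (q := q) (a + 1)).analyticAt ((a : ℂ) + 1)
  have hqz : AnalyticAt ℂ (fun z => ((q : ℝ) : ℂ) ^ z) ((a : ℂ) + 1) :=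
    Differentiable.analyticAt (differentiable_id.const_cpow (Or.inl ofReal_q_ne)) _
  have hlz : AnalyticAt ℂ (fun z => (((q : ℝ)⁻¹ - q : ℝ) : ℂ) ^ z) ((a : ℂ) + 1) :=
    Differentiable.analyticAt (differentiable_id.const_cpow (Or.inl hl)) _
  have main := hasResidue_of_simple_zero (f := hh.zeta a 1 x) (n := a + 1)
    (c := fun z => h x * ((1 + ((q : ℝ) : ℂ) ^ z) * ((((q : ℝ)⁻¹ - q : ℝ) : ℂ) ^ z /
      ((1 - ((q : ℝ) : ℂ) ^ 2) * (((q : ℝ) : ℂ) ^ (z - 2 * a) - 1)))))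
    (A := fun z => ((q : ℝ) : ℂ) ^ (z - 2 * a))
    (B := fun z => ((q : ℝ) : ℂ) ^ (z - 2 * a) * zetaRem q (a + 1) z -
      zetaSub q (((q : ℝ) : ℂ) ^ ((a : ℂ) - 1)) z)
    (p := fun z => ((q : ℝ) : ℂ) ^ (z - (a + 1))) (p' := Complex.log ((q : ℝ) : ℂ))
    (by rw [hn]; exact analyticAt_const.mul ((analyticAt_const.add hqz).mul
          (hlz.div (analyticAt_const.mul (hr.sub analyticAt_const)) hden)))
    (by rw [hn]; exact hr)
    (by rw [hn]; exact (hr.mul (analyticAt_zetaRem _)).sub (analyticAt_zetaSub _ ht1))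
    (by rw [hn]; exact hp) (by rw [hn]; simp)
    (by
      rw [hn]
      have := ((hasDerivAt_id ((a : ℂ) + 1)).sub_const ((a : ℂ) + 1)).const_cpow
        (c := ((q : ℝ) : ℂ)) (Or.inl ofReal_q_ne)
      simpa using this)
    log_q_ne
    (by
      rw [hn]
      filter_upwards [hball, hre] with z h1 h2 h3
      rw [hh.zeta_eq ha x h3, zetaSum_eq h1 h3 h2]
      ring)
  convert main using 1
  rw [hn, zetaRes]
  ring

end IsHaarState

end

theorem mainTheorem1 (q : Set.Ioo (0 : ℝ) 1) (a : ℝ) (ha : 1 < a) :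
    (∃! h : SUq2 q →ₗ[ℂ] ℂ, IsHaarState q h) ∧
    ∀ (h : SUq2 q →ₗ[ℂ] ℂ) (hh : IsHaarState q h),
      hh.spectralDim a 1 = a + 1 ∧
      (∀ (x : SUq2 q) (z : ℂ), a + 1 < z.re → hh.ZetaTraceClass a 1 x z) ∧
      (∀ x : SUq2 q, HasResidue (hh.zeta a 1 x) (a + 1) (hh.ncIntegral a 1 x)) ∧
      hh.ncIntegral a 1 1 ≠ 0 ∧
      ∀ x : SUq2 q, hh.ncIntegral a 1 x / hh.ncIntegral a 1 1 = h x := by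
  refine ⟨⟨SUq2.haar q, SUq2.isHaarState_haar, fun h hh => hh.eq_haar⟩, fun h hh => ?_⟩
  have hint : ∀ x, hh.ncIntegral a 1 x = h x * SUq2.zetaRes q a := fun x => by
    rw [IsHaarState.ncIntegral, hh.spectralDim_eq ha, (hh.hasResidue_zeta ha x).residueAt_eq]
  have h1 : hh.ncIntegral a 1 1 = SUq2.zetaRes q a := by rw [hint, hh.map_one, one_mul]
  have h0 := SUq2.zetaRes_ne_zero (q := q) ha
  refine ⟨hh.spectralDim_eq ha, fun x z hz => hh.zetaTraceClass ha x hz, fun x => ?_, ?_,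
    fun x => ?_⟩
  · rw [hint]
    exact hh.hasResidue_zeta ha x
  · rwa [h1]
  · rw [hint, h1, mul_div_cancel_right₀ _ h0]
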